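/- **Setting.** The $n=ab$ qubits ($a,b\ge 1$) sit on the sites of an $a\times b$ square lattice. The target is an Ising Hamiltonian $H=\sum_{(i,j)\in E}J_{ij}Z_iZ_j+\sum_i h_iZ_i$ on a graph $G$ whose vertices are the qubits, with maximum degree at most $\Delta$, with $0<J_{\min}\le |J_{ij}|\le J_{\max}$ on edges, and with $|h_i|\le h_{\max}$. Let $E_0$ be the least eigenvalue of $H$. Circuits consist of layers of gates acting on disjoint qubits; the gates are $T$ gates, one-qubit Clifford gates, and two-qubit Clifford gates on nearest neighbours of the lattice. The depth of a circuit is its number of layers. A *variational circuit for $H$ of computing depth at most $c$* consists of variational layers $L_1,\dots,L_m$, applied in this order. Each $L_j$ is a mixer circuit followed by a circuit of the form $V_{j,1}S_1V_{j,2}S_2\cdots S_{M-1}V_{j,M}$ that implements $e^{-i\gamma_jH}$ exactly up to a global phase, such that: * the permuting circuits $S_k$, which are the same for all $j$, consist of layers of nearest-neighbour SWAP gates only; * for every $j$, the depths of the mixer of $L_j$ and of $V_{j,1},\dots,V_{j,M}$ sum to at most $c$; * every coupling term is implemented by the gates of a computing circuit: for every edge $(i,j')$ of $G$ there is some $V_{j,k}$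 that links the current positions of the spins $i$ and $j'$ (their positions after the SWAP gates that precede $V_{j,k}$ in its variational layer). This means that, going through the layers of $V_{j,k}$ in order, one gets from one of the two positions to the other by either staying put or moving between two qubits acted on by a common gate in each layer. The *embedding overhead* of the circuit is $\lambda=\sum_k\mathrm{depth}(S_k)$. For a noise rate $p$ and an initial product state $\rho_0$ of density matrices, the noisy circuit $\Phi_p$ applies single-qubit depolarizing noise $\rho\mapsto(1-p)\rho+pI/2$ to every qubit before the first layer of gates and after every layer of gates. A classical algorithm is a program for a unit-cost random access machine with natural-number registers and arrays (addition, truncated subtraction, comparison) and exact real registers and arrays ($+,-,\times,/,\sqrt{\ }$, comparison, no rounding to integers), with only natural numbers as constants; every assignment and every test costs one step. Its input is $a$, $b$, $\epsilon$ and the list of edges, couplings and fields of $H$; in part (b), also $p$, the one-qubit Bloch vectors of $\rho_0$, and the circuit, with Clifford gates given by their action on Pauli strings. **Theorem 2 (Variational circuits).** Fix $\Delta$, $c$, $J_{\min}>0$, $J_{\max}$ and $h_{\max}$. (a) *(Overhead $\lambda=O(1)$.)* For every $\Lambda$ there are a classical algorithm and a constant $K$ such that, for every $H$ as above that has a variational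 circuit of computing depth at most $c$ with $\lambda\le\Lambda$, and for every $\epsilon>0$, the algorithm outputs a number within $\epsilon n$ of the ground energy $E_0$ in at most $K\,n\,2^{1/\epsilon^2}$ steps. (b) *(Overhead $\lambda=\omega(1)$.)* For every constant noise rate $p\in(0,1]$ there are a threshold $\lambda_0$, a classical algorithm and constants $K,k$ such that, for every $H$ as above, every variational circuit for $H$ of computing depth at most $c$ with $\lambda\ge\lambda_0$, every initial product state $\rho_0$, and every $\epsilon>0$, the algorithm outputs a number within $\epsilon n$ of the noisy output energy $\mathrm{tr}(H\Phi_p(\rho_0))$ in at most $K(n+1/\epsilon)^k$ steps. In particular, for every $p\in(0,1]$, every circuit falls under (a) with $\Lambda=\lambda_0(p)$ or under (b). In a family with $\lambda=\omega(1)$, all but the circuits with $\lambda<\lambda_0(p)$ fall under (b). -/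

import Mathlib

open scoped Matrix Kronecker ComplexOrder

/-! ### Classical algorithms: while-programs on a unit-cost real RAM

Memory consists of natural-number registers, real registers, and finitely many (per program) named
arrays of naturals and of reals.  On naturals the only arithmetic is `+` and truncated `-`; on reals
it is exact `+, -, *, /, sqrt`.  Reals can be compared but not rounded to naturals. -/

/-- Memory contents. -/
structure Mem where
  nat : ℕ → ℕ
  real : ℕ → ℝ
  natArr : ℕ → ℕ → ℕ
  realArr : ℕ → ℕ → ℝ

/-- Expressions of type natural number. -/
inductive NExpr where
  | const (c : ℕ)
  | var (i : ℕ)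
  | arr (k : ℕ) (e : NExpr)
  | add (e f : NExpr)
  | sub (e f : NExpr)

/-- Real expressions; the only constants are the natural numbers. -/
inductive RExpr where
  | cast (e : NExpr)
  | var (i : ℕ)
  | arr (k : ℕ) (e : NExpr)
  | add (x y : RExpr)
  | sub (x y : RExpr)
  | mul (x y : RExpr)
  | div (x y : RExpr)
  | sqrt (x : RExpr)

/-- Tests. -/
inductive Test where
  | natLe (e f : NExpr)
  | natEq (e f : NExpr)
  | realLe (x y : RExpr)
  | neg (c : Test)
  | conj (c c' : Test)

/-- Programs. -/
inductive Prog where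
  | skip
  | setNat (i : ℕ) (e : NExpr)
  | setReal (i : ℕ) (x : RExpr)
  | setNatArr (k : ℕ) (addr e : NExpr)
  | setRealArr (k : ℕ) (addr : NExpr) (x : RExpr)
  | seq (P Q : Prog)
  | cond (c : Test) (P Q : Prog)
  | loop (c : Test) (P : Prog)

def NExpr.eval (s : Mem) : NExpr → ℕ
  | .const c => c
  | .var i => s.nat i
  | .arr k e => s.natArr k (e.eval s)
  | .add e f => e.eval s + f.eval s
  | .sub e f => e.eval s - f.eval s

noncomputable def RExpr.eval (s : Mem) : RExpr → ℝ
  | .cast e => (e.eval s : ℝ)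
  | .var i => s.real i
  | .arr k e => s.realArr k (e.eval s)
  | .add x y => x.eval s + y.eval s
  | .sub x y => x.eval s - y.eval s
  | .mul x y => x.eval s * y.eval s
  | .div x y => x.eval s / y.eval s
  | .sqrt x => Real.sqrt (x.eval s)

def Test.Holds (s : Mem) : Test → Prop
  | .natLe e f => e.eval s ≤ f.eval s
  | .natEq e f => e.eval s = f.eval s
  | .realLe x y => x.eval s ≤ y.eval s
  | .neg c => ¬ c.Holds s
  | .conj c c' => c.Holds s ∧ c'.Holds s

/-- `Exec P s t s'`: started in memory `s`, the program `P` halts after `t` steps in memory `s'`.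
Every assignment and every evaluation of a test is one step (the expressions occurring in a program
have a fixed size). -/
inductive Exec : Prog → Mem → ℕ → Mem → Prop
  | skip (s : Mem) : Exec .skip s 1 s
  | setNat (s : Mem) (i : ℕ) (e : NExpr) :
      Exec (.setNat i e) s 1 { s with nat := Function.update s.nat i (e.eval s) }
  | setReal (s : Mem) (i : ℕ) (x : RExpr) :
      Exec (.setReal i x) s 1 { s with real := Function.update s.real i (x.eval s) }
  | setNatArr (s : Mem) (k : ℕ) (addr e : NExpr) :
      Exec (.setNatArr k addr e) s 1
        { s with natArr := Function.update s.natArr k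
                  (Function.update (s.natArr k) (addr.eval s) (e.eval s)) }
  | setRealArr (s : Mem) (k : ℕ) (addr : NExpr) (x : RExpr) :
      Exec (.setRealArr k addr x) s 1
        { s with realArr := Function.update s.realArr k
                  (Function.update (s.realArr k) (addr.eval s) (x.eval s)) }
  | seq {P Q : Prog} {s s' s'' : Mem} {t t' : ℕ} :
      Exec P s t s' → Exec Q s' t' s'' → Exec (.seq P Q) s (t + t') s''
  | condTrue {c : Test} {P Q : Prog} {s s' : Mem} {t : ℕ} :
      c.Holds s → Exec P s t s' → Exec (.cond c P Q) s (t + 1) s'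
  | condFalse {c : Test} {P Q : Prog} {s s' : Mem} {t : ℕ} :
      ¬ c.Holds s → Exec Q s t s' → Exec (.cond c P Q) s (t + 1) s'
  | loopTrue {c : Test} {P : Prog} {s s' s'' : Mem} {t t' : ℕ} :
      c.Holds s → Exec P s t s' → Exec (.loop c P) s' t' s'' →
      Exec (.loop c P) s (t + t' + 1) s''
  | loopFalse {c : Test} {P : Prog} {s : Mem} :
      ¬ c.Holds s → Exec (.loop c P) s 1 s

/-! ### Qubits on a two-dimensional lattice -/

/-- Sites of the `a × b` square lattice; one qubit (spin) sits on every site. -/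
abbrev Site (a b : ℕ) := Fin a × Fin b

/-- Row-major number of a site. -/
def Site.idx {a b : ℕ} (u : Site a b) : ℕ := (u.1 : ℕ) * b + (u.2 : ℕ)

/-- Nearest neighbours in the lattice. -/
def Site.Near {a b : ℕ} (u v : Site a b) : Prop :=
  Nat.dist u.1 v.1 + Nat.dist u.2 v.2 = 1

/-- Labels of the computational basis. -/
abbrev Config (a b : ℕ) := Site a b → Fin 2

/-- Operators on the space of all qubits. -/
abbrev Op (a b : ℕ) := Matrix (Config a b) (Config a b) ℂ

/-- The Pauli matrices `I, X, Y, Z`. -/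
noncomputable def pauli : Fin 4 → Matrix (Fin 2) (Fin 2) ℂ :=
  ![!![1, 0; 0, 1], !![0, 1; 1, 0], !![0, -Complex.I; Complex.I, 0], !![1, 0; 0, -1]]

/-- A one-qubit operator acting on the qubit `u`. -/
noncomputable def embedOne {a b : ℕ} (u : Site a b) (A : Matrix (Fin 2) (Fin 2) ℂ) : Op a b :=
  Matrix.of fun σ τ => open Classical in
    if ∀ w, w ≠ u → σ w = τ w then A (σ u) (τ u) else 0

/-- A two-qubit operator acting on the ordered pair of distinct qubits `u, v`. -/
noncomputable def embedTwo {a b : ℕ} (u v : Site a b)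
    (A : Matrix (Fin 2 × Fin 2) (Fin 2 × Fin 2) ℂ) : Op a b :=
  Matrix.of fun σ τ => open Classical in
    if ∀ w, w ≠ u → w ≠ v → σ w = τ w then A (σ u, σ v) (τ u, τ v) else 0

/-- The product state `⨂ ρ u`. -/
noncomputable def productState {a b : ℕ} (ρ : Site a b → Matrix (Fin 2) (Fin 2) ℂ) : Op a b :=
  Matrix.of fun σ τ => ∏ u, ρ u (σ u) (τ u)

/-- One-qubit density matrices. -/
def IsDensity (ρ : Matrix (Fin 2) (Fin 2) ℂ) : Prop :=
  ρ.PosSemidef ∧ ρ.trace = 1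

/-! ### Ising Hamiltonians -/

/-- The data of `H = ∑_{(i,j) ∈ E} J_ij Z_i Z_j + ∑_i h_i Z_i`; only the values of `J` on edges
matter. -/
structure Ising (a b : ℕ) where
  graph : SimpleGraph (Site a b)
  J : Sym2 (Site a b) → ℝ
  h : Site a b → ℝ

/-- Pauli `Z` on the qubit `u`. -/
noncomputable def zOp {a b : ℕ} (u : Site a b) : Op a b := embedOne u (pauli 3)

theorem embedOne_diagonal {a b : ℕ} (u : Site a b) (d : Fin 2 → ℂ) :
    embedOne u (Matrix.diagonal d) = Matrix.diagonal fun σ => d (σ u) := by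
  classical
  ext σ τ
  by_cases h : σ = τ
  · subst h
    simp [embedOne]
  · simp only [embedOne, Matrix.of_apply, Matrix.diagonal_apply, h, if_false]
    split_ifs with h1 h2
    · refine absurd (funext fun w => ?_) h
      by_cases hw : w = u
      · rw [hw, h2]
      · exact h1 w hw
    · rfl
    · rfl

theorem pauli_three : pauli 3 = Matrix.diagonal ![1, -1] := by
  ext i j
  fin_cases i <;> fin_cases j <;> simp [pauli]

theorem zOp_mul_comm {a b : ℕ} (u v : Site a b) : zOp u * zOp v = zOp v * zOp u := by
  simp only [zOp, pauli_three, embedOne_diagonal, Matrix.diagonal_mul_diagonal]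
  congr 1
  funext σ
  exact mul_comm _ _

/-- `Z_i Z_j` for the unordered pair `{i, j}`. -/
noncomputable def zzOp {a b : ℕ} : Sym2 (Site a b) → Op a b :=
  Sym2.lift ⟨fun u v => zOp u * zOp v, zOp_mul_comm⟩

/-- The Hamiltonian as an operator. -/
noncomputable def Ising.op {a b : ℕ} (H : Ising a b) : Op a b :=
  (∑ᶠ e ∈ H.graph.edgeSet, (H.J e : ℂ) • zzOp e) + ∑ u, (H.h u : ℂ) • zOp u

/-- The ground energy: the least eigenvalue of the Hamiltonian. -/
noncomputable def Ising.groundEnergy {a b : ℕ} (H : Ising a b) : ℝ :=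
  sInf {E : ℝ | Module.End.HasEigenvalue (Matrix.toLin' H.op) (E : ℂ)}

/-- Degree at most `Δ`, couplings with `Jmin ≤ |J_ij| ≤ Jmax` and fields with `|h_i| ≤ hmax`. -/
structure Ising.Bounded {a b : ℕ} (H : Ising a b) (Δ : ℕ) (Jmin Jmax hmax : ℝ) : Prop where
  degree : ∀ u, (H.graph.neighborSet u).ncard ≤ Δ
  coupling : ∀ e ∈ H.graph.edgeSet, Jmin ≤ |H.J e| ∧ |H.J e| ≤ Jmax
  field : ∀ u, |H.h u| ≤ hmax

/-! ### Clifford + T circuits and depolarizing noise -/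

/-- One-qubit Clifford unitaries: unitaries mapping Pauli matrices to Pauli matrices up to sign. -/
def IsCliffordOne (U : Matrix (Fin 2) (Fin 2) ℂ) : Prop :=
  U ∈ Matrix.unitaryGroup (Fin 2) ℂ ∧
    ∀ P : Fin 4, ∃ (Q : Fin 4) (s : Fin 2), Uᴴ * pauli P * U = (-1 : ℂ) ^ (s : ℕ) • pauli Q

/-- Two-qubit Clifford unitaries. -/
def IsCliffordTwo (U : Matrix (Fin 2 × Fin 2) (Fin 2 × Fin 2) ℂ) : Prop :=
  U ∈ Matrix.unitaryGroup (Fin 2 × Fin 2) ℂ ∧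
    ∀ P P' : Fin 4, ∃ (Q Q' : Fin 4) (s : Fin 2),
      Uᴴ * (pauli P ⊗ₖ pauli P') * U = (-1 : ℂ) ^ (s : ℕ) • (pauli Q ⊗ₖ pauli Q')

/-- A gate together with the qubits that it acts on. -/
inductive Gate (a b : ℕ) where
  | tGate (u : Site a b)
  | cliffordOne (u : Site a b) (U : Matrix (Fin 2) (Fin 2) ℂ)
  | cliffordTwo (u v : Site a b) (U : Matrix (Fin 2 × Fin 2) (Fin 2 × Fin 2) ℂ)

/-- The set of qubits that a gate acts on. -/
def Gate.support {a b : ℕ} : Gate a b → Set (Site a b)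
  | .tGate u => {u}
  | .cliffordOne u _ => {u}
  | .cliffordTwo u v _ => {u, v}

/-- The gate set: `T`, one-qubit Clifford gates, nearest-neighbour two-qubit Clifford gates. -/
def Gate.Valid {a b : ℕ} : Gate a b → Prop
  | .tGate _ => True
  | .cliffordOne _ U => IsCliffordOne U
  | .cliffordTwo u v U => u.Near v ∧ IsCliffordTwo U

/-- `T = diag(1, e^{iπ/4})`. -/
noncomputable def tMatrix : Matrix (Fin 2) (Fin 2) ℂ :=
  !![1, 0; 0, Complex.exp (Complex.I * (Real.pi / 4))]

/-- `SWAP |x, y⟩ = |y, x⟩`. -/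
def swapMatrix : Matrix (Fin 2 × Fin 2) (Fin 2 × Fin 2) ℂ :=
  Matrix.of fun x y => if x = y.swap then 1 else 0

noncomputable def Gate.unitary {a b : ℕ} : Gate a b → Op a b
  | .tGate u => embedOne u tMatrix
  | .cliffordOne u U => embedOne u U
  | .cliffordTwo u v U => embedTwo u v U

/-- A layer is a list of gates, meant to be applied simultaneously. -/
abbrev Layer (a b : ℕ) := List (Gate a b)

/-- A circuit is a list of layers in the order of application; its depth is its length. -/
abbrev Circuit (a b : ℕ) := List (Layer a b)

/-- The gates of a layer come from the gate set and act on disjoint sets of qubits. -/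
def Layer.Valid {a b : ℕ} (L : Layer a b) : Prop :=
  (∀ g ∈ L, g.Valid) ∧ L.Pairwise fun g g' => Disjoint g.support g'.support

noncomputable def Layer.unitary {a b : ℕ} (L : Layer a b) : Op a b :=
  (L.map Gate.unitary).prod

/-- `U_d ⋯ U_1` for the circuit with layers `U_1, …, U_d`. -/
noncomputable def Circuit.unitary {a b : ℕ} (C : Circuit a b) : Op a b :=
  C.foldl (fun W L => Layer.unitary L * W) 1

/-- Depolarizing noise `ρ ↦ (1 - p) ρ + p tr_u(ρ) ⊗ I/2` on the qubit `u`. -/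
noncomputable def depolarizeAt {a b : ℕ} (p : ℝ) (u : Site a b) (ρ : Op a b) : Op a b :=
  Matrix.of fun σ τ => (1 - p : ℂ) * ρ σ τ +
    p * (if σ u = τ u then
      (1 / 2) * ∑ x, ρ (Function.update σ u x) (Function.update τ u x) else 0)

/-- Depolarizing noise on every qubit. -/
noncomputable def depolarize {a b : ℕ} (p : ℝ) (ρ : Op a b) : Op a b :=
  (Finset.univ : Finset (Site a b)).toList.foldr (depolarizeAt p) ρ

/-- The noisy circuit: a layer of noise at the beginning and one after each layer of gates. -/
noncomputable def Circuit.noisy {a b : ℕ} (C : Circuit a b) (p : ℝ) (ρ : Op a b) : Op a b :=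
  C.foldl (fun ρ L => depolarize p (Layer.unitary L * ρ * (Layer.unitary L)ᴴ)) (depolarize p ρ)

/-- `Linked C u v`: going through the layers of `C` one can move from `u` to `v`, in each layer
staying put or moving between two qubits acted on by the same gate. -/
def Linked {a b : ℕ} : Circuit a b → Site a b → Site a b → Prop
  | [], u, v => u = v
  | L :: C, u, v =>
      ∃ w, (w = u ∨ ∃ g ∈ L, u ∈ g.support ∧ w ∈ g.support) ∧ Linked C w v

/-! ### Variational circuits -/

/-- A layer of SWAP gates, given by the pairs of qubits that are exchanged. -/
abbrev SwapLayer (a b : ℕ) := List (Site a b × Site a b)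

def SwapLayer.toLayer {a b : ℕ} (S : SwapLayer a b) : Layer a b :=
  S.map fun e => .cliffordTwo e.1 e.2 swapMatrix

/-- The permutation of the qubits effected by a sequence of layers of SWAP gates: the content of
site `u` ends up on site `swapPerm S u`. -/
def swapPerm {a b : ℕ} (S : List (SwapLayer a b)) : Equiv.Perm (Site a b) :=
  S.flatten.foldl (fun π e => Equiv.swap e.1 e.2 * π) 1

/-- The building blocks of a 2D variational circuit with `m` variational layers: mixers, computing
blocks `V j k` and permuting blocks `S k`, all numbered in the order of application. -/
structure Ansatz (a b : ℕ) where
  m : ℕ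
  M : ℕ
  γ : Fin m → ℝ
  mixer : Fin m → Circuit a b
  V : Fin m → Fin (M + 1) → Circuit a b
  S : Fin M → List (SwapLayer a b)

/-- The circuit `V j 0, S 0, V j 1, S 1, …, S (M - 1), V j M`. -/
def Ansatz.cost {a b : ℕ} (A : Ansatz a b) (j : Fin A.m) : Circuit a b :=
  (List.ofFn fun k : Fin A.M => A.V j k.castSucc ++ (A.S k).map SwapLayer.toLayer).flatten ++
    A.V j (Fin.last A.M)

/-- The whole circuit: every variational layer is a mixer followed by a cost circuit. -/
def Ansatz.circuit {a b : ℕ} (A : Ansatz a b) : Circuit a b :=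
  (List.ofFn fun j => A.mixer j ++ A.cost j).flatten

/-- The embedding overhead factor `∑ k, depth (S k)`. -/
def Ansatz.overhead {a b : ℕ} (A : Ansatz a b) : ℕ := ∑ k, (A.S k).length

/-- Where the permuting blocks preceding `V j k` have moved the spins. -/
def Ansatz.position {a b : ℕ} (A : Ansatz a b) (k : Fin (A.M + 1)) : Equiv.Perm (Site a b) :=
  swapPerm ((List.ofFn A.S).take k).flatten

/-- `A` is a variational circuit for the Ising Hamiltonian `H`, with computing depth at most `c`
per variational layer. -/
structure Ansatz.Implements {a b : ℕ} (A : Ansatz a b) (H : Ising a b) (c : ℕ) : Prop where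
  /-- all layers are layers of nearest-neighbour gates from the gate set -/
  valid : ∀ L ∈ A.circuit, Layer.Valid L
  /-- the cost circuits implement `e^{-iγH}`, up to a global phase -/
  cost_eq : ∀ j, ∃ θ : ℝ, (A.cost j).unitary =
    Complex.exp (Complex.I * θ) • NormedSpace.exp (-(Complex.I * (A.γ j : ℂ)) • H.op)
  /-- every coupling term is implemented by the gates of some computing block, acting on the current
  positions of the two spins -/
  term : ∀ u v, H.graph.Adj u v → ∃ j k,
    Linked (A.V j k) (A.position k u) (A.position k v) ∨
      Linked (A.V j k) (A.position k v) (A.position k u)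
  /-- computing blocks and mixers have bounded total depth -/
  depth : ∀ j, (∑ k, (A.V j k).length) + (A.mixer j).length ≤ c

/-- The expectation value of the energy `tr (H Φ(ρ₀))` at the output of the noisy circuit. -/
noncomputable def noisyEnergy {a b : ℕ} (H : Ising a b) (A : Ansatz a b) (p : ℝ)
    (ρ : Site a b → Matrix (Fin 2) (Fin 2) ℂ) : ℂ :=
  Matrix.trace (H.op * A.circuit.noisy p (productState ρ))

/-! ### Input formats -/

/-- Registers and arrays not reserved for inputs are zero at the start. -/
structure Mem.Fresh (s : Mem) : Prop where
  nat : ∀ i, 8 ≤ i → s.nat i = 0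
  real : ∀ i, 8 ≤ i → s.real i = 0
  natArr : ∀ k, 8 ≤ k → ∀ i, s.natArr k i = 0
  realArr : ∀ k, 8 ≤ k → ∀ i, s.realArr k i = 0

/-- The memory holds the lattice dimensions, the target precision, and the Hamiltonian as a list of
edges with their couplings and an array of fields. -/
structure Mem.HoldsIsing {a b : ℕ} (s : Mem) (H : Ising a b) (ε : ℝ) : Prop where
  fresh : s.Fresh
  dims : s.nat 0 = a ∧ s.nat 1 = b
  prec : s.real 0 = ε
  edges : ∃ l : List (Site a b × Site a b),
    (l.map fun e => s(e.1, e.2)).Nodup ∧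
    (∀ e, e ∈ (l.map fun e => s(e.1, e.2)) ↔ e ∈ H.graph.edgeSet) ∧
    s.nat 2 = l.length ∧
    ∀ (i : ℕ) (hi : i < l.length),
      s.natArr 0 i = (l[i]).1.idx ∧ s.natArr 1 i = (l[i]).2.idx ∧
      s.realArr 0 i = H.J s((l[i]).1, (l[i]).2)
  fields : ∀ u : Site a b, s.realArr 1 u.idx = H.h u

/-- The memory describes the gate `g` at address `q`: its kind, its qubits, and, for a Clifford
gate, the table of its action `P ↦ U† P U = ± Q` on Pauli matrices. -/
def Mem.HoldsGate {a b : ℕ} (s : Mem) (q : ℕ) : Gate a b → Prop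
  | .tGate _ => s.natArr 2 q = 1
  | .cliffordOne _ U => s.natArr 2 q = 2 ∧
      ∀ P : Fin 4, ∃ (Q : Fin 4) (x : Fin 2),
        s.natArr 5 (16 * q + P) = Q ∧ s.natArr 6 (16 * q + P) = x ∧
        Uᴴ * pauli P * U = (-1 : ℂ) ^ (x : ℕ) • pauli Q
  | .cliffordTwo u v U => s.natArr 2 q = 3 ∧ s.natArr 3 q = u.idx ∧ s.natArr 4 q = v.idx ∧
      ∀ P P' : Fin 4, ∃ (Q Q' : Fin 4) (x : Fin 2),
        s.natArr 5 (16 * q + (4 * P + P')) = 4 * Q + Q' ∧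
        s.natArr 6 (16 * q + (4 * P + P')) = x ∧
        Uᴴ * (pauli P ⊗ₖ pauli P') * U = (-1 : ℂ) ^ (x : ℕ) • (pauli Q ⊗ₖ pauli Q')

/-- The memory holds the depth of the circuit `C`, the noise rate, the Bloch vectors of the initial
product state, and for every time step `t` and site `w` a description of the gate acting there. -/
structure Mem.HoldsCircuit {a b : ℕ} (s : Mem) (C : Circuit a b) (p : ℝ)
    (ρ : Site a b → Matrix (Fin 2) (Fin 2) ℂ) : Prop where
  depth : s.nat 3 = C.length
  noise : s.real 1 = p
  bloch : ∀ u : Site a b, s.realArr 2 u.idx = (Matrix.trace (pauli 1 * ρ u)).re ∧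
    s.realArr 3 u.idx = (Matrix.trace (pauli 2 * ρ u)).re ∧
    s.realArr 4 u.idx = (Matrix.trace (pauli 3 * ρ u)).re
  idle : ∀ (t : ℕ) (ht : t < C.length) (w : Site a b), (∀ g ∈ C[t], w ∉ g.support) →
    s.natArr 2 (t * (a * b) + w.idx) = 0
  gates : ∀ (t : ℕ) (ht : t < C.length) (w : Site a b), ∀ g ∈ C[t], w ∈ g.support →
    s.HoldsGate (t * (a * b) + w.idx) g

/-!
Both parts of the theorem come down to an explicit program on the real RAM, an error bound, and a
bound for its number of steps. Programs are verified with the predicate `Runs`, total correctness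
with a time bound; `Frame` records what a program leaves unchanged.

*Small overhead.* A coupling term is implemented by a computing block, whose gates move over at most
`c` lattice bonds, on positions that the SWAP gates have shifted by at most `Λ` bonds each. Hence
coupled spins have distance at most `r = c + 2 Λ` in the lattice (`Ansatz.Implements.dist_le`), so
the Hamiltonian is two-dimensional and local. Dropping all couplings across the borders of strips of
width `ℓ ≈ 1 / ε` changes the energy of every configuration by at most `ε n`. What remains is a chain
(`chainPos`) whose interactions have range `(r + 1) ℓ`, and its least energy is found by dynamic
programming over `2 ^ O(1 / ε)` boundary configurations (`isLeast_chainEnergy`). Since `H` is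
diagonal, its least eigenvalue is the least energy of a configuration
(`Ising.isLeast_groundEnergy`), and `2 ^ O(1 / ε)` is at most a constant times `2 ^ (1 / ε ^ 2)`.

*Large overhead.* In the Heisenberg picture, a Clifford gate maps a Pauli string to one Pauli string
up to sign, a `T` gate maps it to at most two with coefficients `± 1 / √2`, and a layer of noise
multiplies it by `(1 - p) ^ w`, where `w` is its weight. A path of Pauli strings is therefore
determined by one bit per branching. The program follows the paths of all terms of the Hamiltonian
backwards through the circuit for all strings of `B` bits, abandons a path as soon as its weights add
up to more than `B`, and averages. A path that is not abandoned uses at most `B` bits, and it passes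
at most `B` layers of gates, because nontrivial Pauli strings stay nontrivial; the running time does
not depend on the depth of the circuit.

For the error, split `1 - p ≤ θ * θ` with `θ < 1`: one factor `θ` per unit of weight makes up for the
growth of paths, and the other one gives `θ ^ B` for the abandoned paths
(`Contracts.samplePath_error`). That the first factor suffices is `Contracts`: weight every
nontrivial Pauli factor by `g = 2 ^ (f - 1 / 2)`. Going backwards through a computing layer, which may
double the weight and branch, halves `f` at worst, since `√2 * (2 ^ (f / 2 - 1 / 2)) ^ 2 = g`. A layer
of SWAP gates preserves the weight and does not branch, so the noise increases `f` by
`τ = - log₂ θ`. A variational layer has at most `c` computing layers and `λ` layers of SWAP gates,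
which bring `f` back to `2 ^ c / 2` once `τ λ` is large enough (`Ansatz.contracts`). Then
`B = O(log (1 / ε))` bits suffice.
-/

/-! ### Total correctness of programs with a time bound -/

/-- Started in `s`, the program `P` halts within `T` steps in a memory that satisfies `Q`. -/
def Runs (P : Prog) (s : Mem) (T : ℕ) (Q : Mem → Prop) : Prop :=
  ∃ t s', Exec P s t s' ∧ t ≤ T ∧ Q s'

/-- Sequential composition of programs. -/
infixr:60 " ;; " => Prog.seq

namespace Prog

/-- The effect of a loop-free program; on loops the value is irrelevant. -/
noncomputable def run : Prog → Mem → Mem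
  | skip, s => s
  | setNat i e, s => { s with nat := Function.update s.nat i (e.eval s) }
  | setReal i x, s => { s with real := Function.update s.real i (x.eval s) }
  | setNatArr k addr e, s =>
      { s with natArr := Function.update s.natArr k
                (Function.update (s.natArr k) (addr.eval s) (e.eval s)) }
  | setRealArr k addr x, s =>
      { s with realArr := Function.update s.realArr k
                (Function.update (s.realArr k) (addr.eval s) (x.eval s)) }
  | seq P Q, s => run Q (run P s)
  | cond c P Q, s => open Classical in if c.Holds s then run P s else run Q s
  | loop _ _, s => s

/-- A bound for the running time of a loop-free program. -/
def cost : Prog → ℕ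
  | seq P Q => P.cost + Q.cost
  | cond _ P Q => P.cost + Q.cost + 1
  | _ => 1

/-- The program contains no loop. -/
def loopFree : Prog → Bool
  | seq P Q => P.loopFree && Q.loopFree
  | cond _ P Q => P.loopFree && Q.loopFree
  | loop _ _ => false
  | _ => true

/-- Whether the program contains an assignment to the natural register `i`. -/
def wNat : Prog → ℕ → Bool
  | setNat j _, i => Nat.beq i j
  | seq P Q, i => P.wNat i || Q.wNat i
  | cond _ P Q, i => P.wNat i || Q.wNat i
  | loop _ P, i => P.wNat i
  | _, _ => false

/-- Whether the program contains an assignment to the real register `i`. -/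
def wReal : Prog → ℕ → Bool
  | setReal j _, i => Nat.beq i j
  | seq P Q, i => P.wReal i || Q.wReal i
  | cond _ P Q, i => P.wReal i || Q.wReal i
  | loop _ P, i => P.wReal i
  | _, _ => false

/-- Whether the program contains an assignment to an entry of the array `i` of naturals. -/
def wNatArr : Prog → ℕ → Bool
  | setNatArr j _ _, i => Nat.beq i j
  | seq P Q, i => P.wNatArr i || Q.wNatArr i
  | cond _ P Q, i => P.wNatArr i || Q.wNatArr i
  | loop _ P, i => P.wNatArr i
  | _, _ => false

/-- Whether the program contains an assignment to an entry of the array `i` of reals. -/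
def wRealArr : Prog → ℕ → Bool
  | setRealArr j _ _, i => Nat.beq i j
  | seq P Q, i => P.wRealArr i || Q.wRealArr i
  | cond _ P Q, i => P.wRealArr i || Q.wRealArr i
  | loop _ P, i => P.wRealArr i
  | _, _ => false

/-- `for i < bd do body`, with the counter in the natural register `i`. -/
def forTo (i : ℕ) (bd : NExpr) (body : Prog) : Prog :=
  setNat i (.const 0) ;;
    loop (.natLe (.add (.var i) (.const 1)) bd) (body ;; setNat i (.add (.var i) (.const 1)))

end Prog

/-- The memories agree on everything to which `P` assigns nothing. -/
structure Frame (P : Prog) (s s' : Mem) : Prop where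
  nat : ∀ i, P.wNat i = false → s'.nat i = s.nat i
  real : ∀ i, P.wReal i = false → s'.real i = s.real i
  natArr : ∀ i, P.wNatArr i = false → s'.natArr i = s.natArr i
  realArr : ∀ i, P.wRealArr i = false → s'.realArr i = s.realArr i

theorem Frame.refl (P : Prog) (s : Mem) : Frame P s s :=
  ⟨fun _ _ => rfl, fun _ _ => rfl, fun _ _ => rfl, fun _ _ => rfl⟩

theorem Frame.trans {P : Prog} {s s' s'' : Mem} (h : Frame P s s') (h' : Frame P s' s'') :
    Frame P s s'' :=
  ⟨fun i hi => (h'.nat i hi).trans (h.nat i hi), fun i hi => (h'.real i hi).trans (h.real i hi),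
    fun i hi => (h'.natArr i hi).trans (h.natArr i hi),
    fun i hi => (h'.realArr i hi).trans (h.realArr i hi)⟩

/-- A program that assigns less has a larger frame. -/
theorem Frame.mono {P Q : Prog} {s s' : Mem} (h : Frame P s s')
    (h1 : ∀ i, Q.wNat i = false → P.wNat i = false)
    (h2 : ∀ i, Q.wReal i = false → P.wReal i = false)
    (h3 : ∀ i, Q.wNatArr i = false → P.wNatArr i = false)
    (h4 : ∀ i, Q.wRealArr i = false → P.wRealArr i = false) : Frame Q s s' :=
  ⟨fun i hi => h.nat i (h1 i hi), fun i hi => h.real i (h2 i hi),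
    fun i hi => h.natArr i (h3 i hi), fun i hi => h.realArr i (h4 i hi)⟩

theorem Frame.seq_left {P Q : Prog} {s s' : Mem} (h : Frame P s s') : Frame (P ;; Q) s s' :=
  h.mono (fun i hi => by simp_all [Prog.wNat]) (fun i hi => by simp_all [Prog.wReal])
    (fun i hi => by simp_all [Prog.wNatArr]) (fun i hi => by simp_all [Prog.wRealArr])

theorem Frame.seq_right {P Q : Prog} {s s' : Mem} (h : Frame Q s s') : Frame (P ;; Q) s s' :=
  h.mono (fun i hi => by simp_all [Prog.wNat]) (fun i hi => by simp_all [Prog.wReal])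
    (fun i hi => by simp_all [Prog.wNatArr]) (fun i hi => by simp_all [Prog.wRealArr])

theorem Exec.frame {P : Prog} {s s' : Mem} {t : ℕ} (h : Exec P s t s') : Frame P s s' := by
  induction h with
  | skip s => exact Frame.refl _ _
  | setNat s i e =>
    refine ⟨fun j hj => ?_, fun _ _ => rfl, fun _ _ => rfl, fun _ _ => rfl⟩
    exact Function.update_of_ne (Nat.ne_of_beq_eq_false hj) _ _
  | setReal s i e =>
    refine ⟨fun _ _ => rfl, fun j hj => ?_, fun _ _ => rfl, fun _ _ => rfl⟩
    exact Function.update_of_ne (Nat.ne_of_beq_eq_false hj) _ _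
  | setNatArr s i a e =>
    refine ⟨fun _ _ => rfl, fun _ _ => rfl, fun j hj => ?_, fun _ _ => rfl⟩
    exact Function.update_of_ne (Nat.ne_of_beq_eq_false hj) _ _
  | setRealArr s i a e =>
    refine ⟨fun _ _ => rfl, fun _ _ => rfl, fun _ _ => rfl, fun j hj => ?_⟩
    exact Function.update_of_ne (Nat.ne_of_beq_eq_false hj) _ _
  | seq _ _ h1 h2 => exact h1.seq_left.trans h2.seq_right
  | condTrue _ _ h =>
    exact h.mono (fun i hi => by simp_all [Prog.wNat]) (fun i hi => by simp_all [Prog.wReal])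
      (fun i hi => by simp_all [Prog.wNatArr]) (fun i hi => by simp_all [Prog.wRealArr])
  | condFalse _ _ h =>
    exact h.mono (fun i hi => by simp_all [Prog.wNat]) (fun i hi => by simp_all [Prog.wReal])
      (fun i hi => by simp_all [Prog.wNatArr]) (fun i hi => by simp_all [Prog.wRealArr])
  | loopTrue _ _ _ h1 h2 =>
    exact Frame.trans ⟨h1.nat, h1.real, h1.natArr, h1.realArr⟩ h2
  | loopFalse _ => exact Frame.refl _ _

namespace Runs

variable {P P' : Prog} {s : Mem} {T T' : ℕ} {Q Q' : Mem → Prop}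

theorem mono (h : Runs P s T Q) (hT : T ≤ T') (hQ : ∀ s', Frame P s s' → Q s' → Q' s') :
    Runs P s T' Q' := by
  obtain ⟨t, s', he, ht, hq⟩ := h
  exact ⟨t, s', he, ht.trans hT, hQ _ he.frame hq⟩

theorem seq (h : Runs P s T (fun s' => Runs P' s' T' Q)) : Runs (P ;; P') s (T + T') Q := by
  obtain ⟨t, s', he, ht, t', s'', he', ht', hq⟩ := h
  exact ⟨t + t', s'', he.seq he', by omega, hq⟩

/-- Sequential composition; the second program may rely on what the first leaves unchanged. -/
theorem seq_frame (h : Runs P s T Q) (h' : ∀ s', Frame P s s' → Q s' → Runs P' s' T' Q') :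
    Runs (P ;; P') s (T + T') Q' :=
  Runs.seq (h.mono le_rfl h')

theorem of_run (hP : P.loopFree = true) (h : Q (P.run s)) : Runs P s P.cost Q := by
  suffices H : ∀ (P : Prog), P.loopFree = true → ∀ s, ∃ t, Exec P s t (P.run s) ∧ t ≤ P.cost by
    obtain ⟨t, he, ht⟩ := H P hP s
    exact ⟨t, _, he, ht, h⟩
  clear hP h
  intro P
  induction P with
  | skip => exact fun _ s => ⟨1, .skip s, le_rfl⟩
  | setNat i e => exact fun _ s => ⟨1, .setNat s i e, le_rfl⟩
  | setReal i e => exact fun _ s => ⟨1, .setReal s i e, le_rfl⟩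
  | setNatArr i e f => exact fun _ s => ⟨1, .setNatArr s i e f, le_rfl⟩
  | setRealArr i e f => exact fun _ s => ⟨1, .setRealArr s i e f, le_rfl⟩
  | seq P Q hP hQ =>
    intro h s
    simp only [Prog.loopFree, Bool.and_eq_true] at h
    obtain ⟨t, he, ht⟩ := hP h.1 s
    obtain ⟨t', he', ht'⟩ := hQ h.2 (P.run s)
    exact ⟨t + t', he.seq he', by simp only [Prog.cost]; omega⟩
  | cond c P Q hP hQ =>
    intro h s
    simp only [Prog.loopFree, Bool.and_eq_true] at h
    by_cases hc : c.Holds s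
    · obtain ⟨t, he, ht⟩ := hP h.1 s
      refine ⟨t + 1, ?_, by simp only [Prog.cost]; omega⟩
      simpa [Prog.run, hc] using Exec.condTrue (Q := Q) hc he
    · obtain ⟨t, he, ht⟩ := hQ h.2 s
      refine ⟨t + 1, ?_, by simp only [Prog.cost]; omega⟩
      simpa [Prog.run, hc] using Exec.condFalse (P := P) hc he
  | loop c P => exact fun h => by simp [Prog.loopFree] at h

theorem cond {c : Test} (h1 : c.Holds s → Runs P s T Q) (h2 : ¬ c.Holds s → Runs P' s T' Q) :
    Runs (.cond c P P') s (T + T' + 1) Q := by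
  by_cases hc : c.Holds s
  · obtain ⟨t, s', he, ht, hq⟩ := h1 hc
    exact ⟨t + 1, s', .condTrue hc he, by omega, hq⟩
  · obtain ⟨t, s', he, ht, hq⟩ := h2 hc
    exact ⟨t + 1, s', .condFalse hc he, by omega, hq⟩

/-- A loop whose invariant `I j` carries a counter `j` that decreases in every iteration. -/
theorem while_loop {c : Test} {N : ℕ} (I : ℕ → Mem → Prop) (h0 : I N s)
    (hstep : ∀ j s', Frame P s s' → I j s' → c.Holds s' →
      Runs P s' T (fun s'' => ∃ j' < j, I j' s''))
    (hend : ∀ j s', Frame P s s' → I j s' → ¬ c.Holds s' → Q s') :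
    Runs (.loop c P) s (N * (T + 1) + 1) Q := by
  suffices H : ∀ N s', Frame P s s' → I N s' → Runs (.loop c P) s' (N * (T + 1) + 1) Q from
    H N s (Frame.refl _ _) h0
  intro N
  induction N using Nat.strong_induction_on with
  | _ N ih =>
    intro s' hF hI
    by_cases hc : c.Holds s'
    · obtain ⟨t, s'', he, ht, j, hj, hI'⟩ := hstep N s' hF hI hc
      obtain ⟨t', s''', he', ht', hq⟩ := ih j hj s'' (hF.trans he.frame) hI'
      refine ⟨t + t' + 1, s''', .loopTrue hc he he', ?_, hq⟩
      have : (j + 1) * (T + 1) ≤ N * (T + 1) := Nat.mul_le_mul_right _ hj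
      rw [Nat.add_mul] at this
      omega
    · exact ⟨1, s', .loopFalse hc, by omega, hend N s' hF hI hc⟩

theorem for_loop {i : ℕ} {bd : NExpr} {N : ℕ} (I : ℕ → Mem → Prop) (hi : P.wNat i = false)
    (hbd : ∀ s', Frame (Prog.forTo i bd P) s s' → bd.eval s' = N)
    (h0 : I 0 { s with nat := Function.update s.nat i 0 })
    (hstep : ∀ j s', j < N → Frame (Prog.forTo i bd P) s s' → s'.nat i = j → I j s' →
      Runs P s' T (fun s'' => I (j + 1) { s'' with nat := Function.update s''.nat i (j + 1) }))
    (hend : ∀ s', Frame (Prog.forTo i bd P) s s' → I N s' → Q s') :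
    Runs (Prog.forTo i bd P) s (N * (T + 2) + 2) Q := by
  have hset := Exec.setNat s i (.const 0)
  have hF0 : Frame (Prog.forTo i bd P) s { s with nat := Function.update s.nat i 0 } :=
    hset.frame.seq_left
  have key : Runs (.loop (.natLe (.add (.var i) (.const 1)) bd)
      (P ;; .setNat i (.add (.var i) (.const 1)))) { s with nat := Function.update s.nat i 0 }
      (N * (T + 1 + 1) + 1) Q := by
    refine while_loop (fun j s' => ∃ k, k + j = N ∧ s'.nat i = k ∧ I k s')
      ⟨0, by simp, by simp, h0⟩ ?_ ?_
    · rintro j s' hF ⟨k, hk, hik, hI⟩ hc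
      have hF' : Frame (Prog.forTo i bd P) s s' :=
        hF0.trans (Frame.seq_right ⟨hF.nat, hF.real, hF.natArr, hF.realArr⟩)
      have hb := hbd s' hF'
      simp only [Test.Holds, NExpr.eval, hik, hb] at hc
      refine Runs.seq_frame (hstep k s' (by omega) hF' hik hI) ?_
      intro s'' hF'' hI''
      refine ⟨1, _, .setNat _ _ _, le_rfl, j - 1, by omega, k + 1, by omega, by
        simp [NExpr.eval, hF''.nat i hi, hik], ?_⟩
      simpa [NExpr.eval, hF''.nat i hi, hik] using hI''
    · rintro j s' hF ⟨k, hk, hik, hI⟩ hc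
      have hF' : Frame (Prog.forTo i bd P) s s' :=
        hF0.trans (Frame.seq_right ⟨hF.nat, hF.real, hF.natArr, hF.realArr⟩)
      have hb := hbd s' hF'
      simp only [Test.Holds, NExpr.eval, hik, hb] at hc
      have : k = N := by omega
      subst this
      exact hend s' hF' hI
  obtain ⟨t, s', he, ht, hq⟩ := key
  exact ⟨1 + t, s', hset.seq he, by ring_nf at ht ⊢; omega, hq⟩

end Runs

/-- `c * e` for a constant `c`. -/
def NExpr.smul : ℕ → NExpr → NExpr
  | 0, _ => .const 0
  | c + 1, e => .add e (NExpr.smul c e)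

theorem NExpr.eval_smul (s : Mem) (c : ℕ) (e : NExpr) : (NExpr.smul c e).eval s = c * e.eval s := by
  induction c with
  | zero => simp [NExpr.smul, NExpr.eval]
  | succ c ih => rw [NExpr.smul, NExpr.eval, ih]; ring

/-! ### Minimizing the energy of a spin chain with bounded interaction range -/

/-- The spin `±1` that belongs to a bit. -/
def sgn (x : Bool) : ℝ := if x then -1 else 1

/-- The number below `2 ^ d` with binary digits `γ 0, γ 1, …`. -/
def code (d : ℕ) (γ : ℕ → Bool) : ℕ := ∑ i ∈ Finset.range d, 2 ^ i * (γ i).toNat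

theorem code_succ (d : ℕ) (γ : ℕ → Bool) : code (d + 1) γ = code d γ + 2 ^ d * (γ d).toNat :=
  Finset.sum_range_succ _ _

theorem code_succ' (d : ℕ) (γ : ℕ → Bool) :
    code (d + 1) γ = 2 * code d (fun i => γ (i + 1)) + (γ 0).toNat := by
  simp only [code, Finset.sum_range_succ', Finset.mul_sum, pow_succ]
  simp only [pow_zero, one_mul]
  congr 1
  exact Finset.sum_congr rfl fun i _ => by ring

theorem code_lt (d : ℕ) (γ : ℕ → Bool) : code d γ < 2 ^ d := by
  induction d with
  | zero => simp [code]
  | succ d ih =>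
    rw [code_succ, pow_succ]
    have : (γ d).toNat ≤ 1 := Bool.toNat_le _
    nlinarith [Nat.two_pow_pos d]

theorem exists_code_eq {d x : ℕ} (hx : x < 2 ^ d) : ∃ γ, code d γ = x := by
  induction d generalizing x with
  | zero => exact ⟨fun _ => false, by simp [code] at *; omega⟩
  | succ d ih =>
    rw [pow_succ] at hx
    obtain ⟨γ, hγ⟩ := ih (x := x / 2) (by omega)
    refine ⟨fun i => if i = 0 then x % 2 = 1 else γ (i - 1), ?_⟩
    rw [code_succ']
    simp only [Nat.add_sub_cancel, Nat.succ_ne_zero, if_false, if_true]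
    have : code d (fun i => γ i) = code d γ := rfl
    rw [this, hγ]
    rcases Nat.mod_two_eq_zero_or_one x with h | h <;> simp [h] <;> omega

/-- `f ± g 1 ± g 2 ± … ± g d` with signs read off from the binary digits of `x`. -/
noncomputable def localField (f : ℝ) (g : ℕ → ℝ) : ℕ → ℕ → ℝ
  | 0, _ => f
  | d + 1, x => if x < 2 ^ d then localField f g d x + g (d + 1)
      else localField f g d (x - 2 ^ d) - g (d + 1)

theorem localField_code (f : ℝ) (g : ℕ → ℝ) (d : ℕ) (γ : ℕ → Bool) :
    localField f g d (code d γ) = f + ∑ i ∈ Finset.range d, g (i + 1) * sgn (γ i) := by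
  induction d with
  | zero => simp [localField]
  | succ d ih =>
    rw [localField, code_succ, Finset.sum_range_succ]
    have := code_lt d γ
    cases h : γ d
    · simp [sgn, this, ih]; ring
    · simp [sgn, ih]; ring

/-- Least energy of the first `t` spins of a chain with fields `f` and couplings `g t d` between
the spins `t` and `t - d`, `1 ≤ d ≤ w + 1`, when the last `w + 1` spins are prescribed by the
digits of `x` (the latest spin is the lowest digit). -/
noncomputable def chainValue (f : ℕ → ℝ) (g : ℕ → ℕ → ℝ) (w : ℕ) : ℕ → ℕ → ℝ
  | 0, _ => 0
  | t + 1, y =>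
      min (chainValue f g w t (y / 2) +
            (if y % 2 = 1 then -1 else 1) * localField (f t) (g t) (w + 1) (y / 2))
          (chainValue f g w t (y / 2 + 2 ^ w) +
            (if y % 2 = 1 then -1 else 1) * localField (f t) (g t) (w + 1) (y / 2 + 2 ^ w))

/-- The digits that describe the last spins before time `t`; the spin `t` of the chain is
`β (t + w + 1)`, the values `β 0, …, β w` stand for irrelevant spins before the chain. -/
def history (w t : ℕ) (β : ℕ → Bool) (i : ℕ) : Bool := β (t + w - i)

/-- Energy of the first `t` spins of the chain. -/
noncomputable def chainEnergy (f : ℕ → ℝ) (g : ℕ → ℕ → ℝ) (w t : ℕ) (β : ℕ → Bool) : ℝ :=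
  ∑ τ ∈ Finset.range t, sgn (β (τ + w + 1)) *
    (f τ + ∑ i ∈ Finset.range (w + 1), g τ (i + 1) * sgn (history w τ β i))

theorem code_history (w t : ℕ) (β : ℕ → Bool) :
    code (w + 1) (history w t β) = code w (history w t β) + 2 ^ w * (β t).toNat := by
  rw [code_succ]
  simp [history]

theorem code_history_succ (w t : ℕ) (β : ℕ → Bool) :
    code (w + 1) (history w (t + 1) β) = 2 * code w (history w t β) + (β (t + w + 1)).toNat := by
  rw [code_succ']
  congr 3
  · funext i
    simp only [history]
    congr 1
    omega
  · simp only [history]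
    congr 1
    omega

theorem chainValue_succ_code (f : ℕ → ℝ) (g : ℕ → ℕ → ℝ) (w t z : ℕ) (x : Bool) :
    chainValue f g w (t + 1) (2 * z + x.toNat) =
      min (chainValue f g w t z + sgn x * localField (f t) (g t) (w + 1) z)
        (chainValue f g w t (z + 2 ^ w) +
          sgn x * localField (f t) (g t) (w + 1) (z + 2 ^ w)) := by
  have h1 : (2 * z + x.toNat) / 2 = z := by have := x.toNat_le; omega
  have h2 : (if (2 * z + x.toNat) % 2 = 1 then (-1 : ℝ) else 1) = sgn x := by
    cases x <;> simp [sgn]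
  rw [chainValue, h1, h2]

theorem chainEnergy_succ (f : ℕ → ℝ) (g : ℕ → ℕ → ℝ) (w t : ℕ) (β : ℕ → Bool) :
    chainEnergy f g w (t + 1) β = chainEnergy f g w t β + sgn (β (t + w + 1)) *
      localField (f t) (g t) (w + 1) (code (w + 1) (history w t β)) := by
  rw [chainEnergy, Finset.sum_range_succ, localField_code]
  rfl

theorem chainValue_le (f : ℕ → ℝ) (g : ℕ → ℕ → ℝ) (w t : ℕ) (β : ℕ → Bool) :
    chainValue f g w t (code (w + 1) (history w t β)) ≤ chainEnergy f g w t β := by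
  induction t with
  | zero => simp [chainValue, chainEnergy]
  | succ t ih =>
    rw [code_history_succ, chainValue_succ_code, chainEnergy_succ]
    rw [code_history] at ih ⊢
    cases h : β t
    · simp only [h, Bool.toNat_false, mul_zero, add_zero] at ih ⊢
      exact (min_le_left _ _).trans (by linarith)
    · simp only [h, Bool.toNat_true, mul_one] at ih ⊢
      exact (min_le_right _ _).trans (by linarith)

theorem chainEnergy_congr (f : ℕ → ℝ) (g : ℕ → ℕ → ℝ) (w t : ℕ) {β β' : ℕ → Bool}
    (h : ∀ i, i < t + w + 1 → β i = β' i) : chainEnergy f g w t β = chainEnergy f g w t β' := by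
  refine Finset.sum_congr rfl fun τ hτ => ?_
  have hτ := Finset.mem_range.1 hτ
  rw [h _ (by omega)]
  congr 2
  refine Finset.sum_congr rfl fun i _ => ?_
  rw [history, history, h _ (by omega)]

/-- Every entry of the dynamic programming table is attained: a configuration is recovered by tracing the
minimizing choices back. -/
theorem exists_chainEnergy_eq (f : ℕ → ℝ) (g : ℕ → ℕ → ℝ) (w t : ℕ) {x : ℕ}
    (hx : x < 2 ^ (w + 1)) :
    ∃ β, code (w + 1) (history w t β) = x ∧ chainEnergy f g w t β = chainValue f g w t x := by
  induction t generalizing x with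
  | zero =>
    obtain ⟨γ, hγ⟩ := exists_code_eq hx
    refine ⟨fun i => γ (w - i), ?_, by simp [chainEnergy, chainValue]⟩
    rw [← hγ]
    refine Finset.sum_congr rfl fun i hi => ?_
    have := Finset.mem_range.1 hi
    simp only [history]
    congr 3
    omega
  | succ t ih =>
    obtain ⟨z, v, hv, hz⟩ : ∃ z, ∃ v : Bool, x = 2 * z + v.toNat ∧ z < 2 ^ w := by
      rw [pow_succ] at hx
      rcases Nat.mod_two_eq_zero_or_one x with h | h
      · exact ⟨x / 2, false, by simp; omega, by omega⟩
      · exact ⟨x / 2, true, by simp; omega, by omega⟩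
    -- the better of the two values of the spin that leaves the window
    have key : ∀ e : Bool, ∃ β, code (w + 1) (history w (t + 1) β) = x ∧
        chainEnergy f g w (t + 1) β = chainValue f g w t (z + 2 ^ w * e.toNat) +
          sgn v * localField (f t) (g t) (w + 1) (z + 2 ^ w * e.toNat) := by
      intro e
      have he : z + 2 ^ w * e.toNat < 2 ^ (w + 1) := by
        rw [pow_succ]
        cases e <;> simp <;> omega
      obtain ⟨β, hβ, hE⟩ := ih he
      have hlt : code w (history w t β) < 2 ^ w := code_lt _ _
      have hcz : code w (history w t β) = z := by
        rw [code_history] at hβ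
        cases e <;> cases h : β t <;> simp [h] at hβ <;> omega
      refine ⟨Function.update β (t + w + 1) v, ?_, ?_⟩
      · rw [code_history_succ, hv, ← hcz]
        congr 2
        · refine Finset.sum_congr rfl fun i _ => ?_
          simp only [history]
          rw [Function.update_of_ne (by omega)]
        · simp
      · rw [chainEnergy_succ, ← hE, ← hβ]
        have e1 : chainEnergy f g w t (Function.update β (t + w + 1) v) = chainEnergy f g w t β :=
          chainEnergy_congr f g w t fun i hi =>
            Function.update_of_ne (show i ≠ t + w + 1 by omega) _ _
        have e2 : code (w + 1) (history w t (Function.update β (t + w + 1) v)) =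
            code (w + 1) (history w t β) := by
          refine Finset.sum_congr rfl fun i _ => ?_
          simp only [history]
          rw [Function.update_of_ne (by omega)]
        rw [e1, e2, Function.update_self]
    subst hv
    rw [chainValue_succ_code]
    rcases min_choice (chainValue f g w t z + sgn v * localField (f t) (g t) (w + 1) z)
        (chainValue f g w t (z + 2 ^ w) +
          sgn v * localField (f t) (g t) (w + 1) (z + 2 ^ w)) with h | h
    · obtain ⟨β, h1, h2⟩ := key false
      exact ⟨β, h1, by rw [h, h2]; simp⟩
    · obtain ⟨β, h1, h2⟩ := key true
      exact ⟨β, h1, by rw [h, h2]; simp⟩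

theorem isLeast_chainEnergy (f : ℕ → ℝ) (g : ℕ → ℕ → ℝ) (w N : ℕ) {m : ℝ}
    (hle : ∀ x < 2 ^ (w + 1), m ≤ chainValue f g w N x)
    (hm : ∃ x < 2 ^ (w + 1), m = chainValue f g w N x) :
    IsLeast (Set.range (chainEnergy f g w N)) m := by
  constructor
  · obtain ⟨x, hx, rfl⟩ := hm
    obtain ⟨β, -, hβ⟩ := exists_chainEnergy_eq f g w N hx
    exact ⟨β, hβ⟩
  · rintro _ ⟨β, rfl⟩
    exact (hle _ (code_lt _ _)).trans (chainValue_le f g w N β)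

/-! ### The Hamiltonian as a sum over a list of edges -/

variable {a b : ℕ}

/-- `l` lists every edge of `G` once, in one of its two orientations. -/
def IsEdgeList (G : SimpleGraph (Site a b)) (l : List (Site a b × Site a b)) : Prop :=
  (l.map fun e => s(e.1, e.2)).Nodup ∧ ∀ e, e ∈ (l.map fun e => s(e.1, e.2)) ↔ e ∈ G.edgeSet

theorem IsEdgeList.adj {G : SimpleGraph (Site a b)} {l : List (Site a b × Site a b)}
    (hl : IsEdgeList G l) {e : Site a b × Site a b} (he : e ∈ l) : G.Adj e.1 e.2 := by
  have := (hl.2 s(e.1, e.2)).1 (List.mem_map_of_mem (f := fun e => s(e.1, e.2)) he)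
  simpa using this

theorem Ising.op_eq_sum {H : Ising a b} {l : List (Site a b × Site a b)}
    (hl : IsEdgeList H.graph l) :
    H.op = (l.map fun e => (H.J s(e.1, e.2) : ℂ) • (zOp e.1 * zOp e.2)).sum +
      ∑ u, (H.h u : ℂ) • zOp u := by
  classical
  have hE : H.graph.edgeSet = ((l.map fun e => s(e.1, e.2)).toFinset : Set (Sym2 (Site a b))) := by
    ext e
    simp only [List.coe_toFinset, Set.mem_ofPred_eq]
    exact (hl.2 e).symm
  rw [Ising.op, hE, finsum_mem_coe_finset, List.sum_toFinset _ hl.1, List.map_map]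
  rfl

/-- The spin `±1` of the basis label `0, 1`. -/
def spin (x : Fin 2) : ℝ := if x = 0 then 1 else -1

/-- The classical energy of a configuration, with the edges taken from a list. -/
noncomputable def Ising.energy (H : Ising a b) (l : List (Site a b × Site a b)) (σ : Config a b) :
    ℝ :=
  (l.map fun e => H.J s(e.1, e.2) * (spin (σ e.1) * spin (σ e.2))).sum + ∑ u, H.h u * spin (σ u)

theorem zOp_eq_diagonal (u : Site a b) :
    zOp u = Matrix.diagonal fun σ => ((spin (σ u) : ℝ) : ℂ) := by
  rw [zOp, pauli_three, embedOne_diagonal]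
  congr 1
  funext σ
  generalize σ u = x
  fin_cases x <;> simp [spin]

theorem Ising.op_eq_diagonal {H : Ising a b} {l : List (Site a b × Site a b)}
    (hl : IsEdgeList H.graph l) :
    H.op = Matrix.diagonal fun σ => ((H.energy l σ : ℝ) : ℂ) := by
  have h1 : ∀ l : List (Site a b × Site a b),
      (l.map fun e => (H.J s(e.1, e.2) : ℂ) • (zOp e.1 * zOp e.2)).sum =
      Matrix.diagonal fun σ => (((l.map fun e => H.J s(e.1, e.2) *
        (spin (σ e.1) * spin (σ e.2))).sum : ℝ) : ℂ) := by
    intro l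
    induction l with
    | nil => simp
    | cons e l ih =>
      rw [List.map_cons, List.sum_cons, ih, zOp_eq_diagonal, zOp_eq_diagonal,
        Matrix.diagonal_mul_diagonal, ← Matrix.diagonal_smul, Matrix.diagonal_add]
      congr 1
      funext σ
      simp
  have h2 : ∀ t : Finset (Site a b), ∑ u ∈ t, (H.h u : ℂ) • zOp u =
      Matrix.diagonal fun σ => ((∑ u ∈ t, H.h u * spin (σ u) : ℝ) : ℂ) := by
    intro t
    induction t using Finset.induction_on with
    | empty => simp
    | insert u t hu ih =>
      rw [Finset.sum_insert hu, ih, zOp_eq_diagonal, ← Matrix.diagonal_smul, Matrix.diagonal_add]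
      congr 1
      funext σ
      simp [Finset.sum_insert hu]
  rw [Ising.op_eq_sum hl, h1, h2, Matrix.diagonal_add]
  congr 1
  funext σ
  simp [Ising.energy]

theorem Ising.isLeast_groundEnergy {H : Ising a b} {l : List (Site a b × Site a b)}
    (hl : IsEdgeList H.graph l) : IsLeast (Set.range (H.energy l)) H.groundEnergy := by
  have : {E : ℝ | Module.End.HasEigenvalue (Matrix.toLin' H.op) (E : ℂ)} =
      Set.range (H.energy l) := by
    ext E
    rw [Ising.op_eq_diagonal hl, Set.mem_ofPred_eq, hasEigenvalue_toLin'_diagonal_iff]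
    simp [Complex.ofReal_inj]
  rw [Ising.groundEnergy, this]
  have hne : (Set.range (H.energy l)).Nonempty := Set.range_nonempty _
  exact ⟨hne.csInf_mem (Set.finite_range _), fun x hx =>
    csInf_le (Set.finite_range _).bddBelow hx⟩

/-- A graph of maximum degree `Δ` has at most `Δ |S|` edges that meet `S`. -/
theorem IsEdgeList.length_le {G : SimpleGraph (Site a b)} {l : List (Site a b × Site a b)}
    {Δ : ℕ} (hl : IsEdgeList G l) (hΔ : ∀ u, (G.neighborSet u).ncard ≤ Δ)
    {l' : List (Site a b × Site a b)} (hl' : l'.Sublist l) (S : Finset (Site a b))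
    (hS : ∀ e ∈ l', e.1 ∈ S ∨ e.2 ∈ S) : l'.length ≤ Δ * S.card := by
  classical
  have hnd : (l'.map fun e => s(e.1, e.2)).Nodup := hl.1.sublist (hl'.map _)
  rw [← List.length_map (f := fun e : Site a b × Site a b => s(e.1, e.2)),
    ← List.toFinset_card_of_nodup hnd]
  have hsub : (l'.map fun e => s(e.1, e.2)).toFinset ⊆
      S.biUnion fun u => (G.neighborFinset u).image fun v => s(u, v) := by
    intro e he
    obtain ⟨⟨u, v⟩, huv, rfl⟩ := List.mem_map.1 (List.mem_toFinset.1 he)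
    have hadj := hl.adj (hl'.subset huv)
    rw [Finset.mem_biUnion]
    rcases hS _ huv with h | h
    · exact ⟨u, h, Finset.mem_image.2 ⟨v, by simpa using hadj, rfl⟩⟩
    · exact ⟨v, h, Finset.mem_image.2 ⟨u, by simpa using hadj.symm, Sym2.eq_swap⟩⟩
  refine (Finset.card_le_card hsub).trans (Finset.card_biUnion_le.trans ?_)
  rw [mul_comm]
  refine Finset.sum_le_card_nsmul _ _ _ fun u _ => Finset.card_image_le.trans ?_
  have := hΔ u
  rwa [Set.ncard_eq_toFinset_card'] at this

/-! ### Locality of the Hamiltonian -/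

/-- The `ℓ¹` distance of the lattice. -/
def Site.dist (u v : Site a b) : ℕ := Nat.dist u.1 v.1 + Nat.dist u.2 v.2

theorem Site.dist_self (u : Site a b) : u.dist u = 0 := by simp [Site.dist]

theorem Site.dist_comm (u v : Site a b) : u.dist v = v.dist u := by
  simp [Site.dist, Nat.dist_comm]

theorem Site.dist_triangle (u v w : Site a b) : u.dist w ≤ u.dist v + v.dist w := by
  have h1 := Nat.dist.triangle_inequality (u.1 : ℕ) v.1 w.1
  have h2 := Nat.dist.triangle_inequality (u.2 : ℕ) v.2 w.2
  simp only [Site.dist]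
  omega

theorem Gate.dist_le_one {g : Gate a b} (hg : g.Valid) {u v : Site a b} (hu : u ∈ g.support)
    (hv : v ∈ g.support) : u.dist v ≤ 1 := by
  cases g with
  | tGate w => simp only [Gate.support, Set.mem_singleton_iff] at hu hv; simp [hu, hv, Site.dist]
  | cliffordOne w U =>
    simp only [Gate.support, Set.mem_singleton_iff] at hu hv; simp [hu, hv, Site.dist]
  | cliffordTwo w w' U =>
    simp only [Gate.support, Set.mem_insert_iff, Set.mem_singleton_iff] at hu hv
    have h : w.dist w' = 1 := hg.1
    rcases hu with rfl | rfl <;> rcases hv with rfl | rfl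
    · simp [Site.dist_self]
    · exact h.le
    · rw [Site.dist_comm]; exact h.le
    · simp [Site.dist_self]

theorem Linked.dist_le {C : Circuit a b} (hC : ∀ L ∈ C, Layer.Valid L) {u v : Site a b}
    (h : Linked C u v) : u.dist v ≤ C.length := by
  induction C generalizing u with
  | nil => rw [show u = v from h]; simp [Site.dist_self]
  | cons L C ih =>
    obtain ⟨w, hw, h⟩ := h
    have h1 := ih (fun L hL => hC L (List.mem_cons_of_mem _ hL)) h
    have h2 : u.dist w ≤ 1 := by
      rcases hw with rfl | ⟨g, hg, hu, hw⟩
      · simp [Site.dist_self]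
      · exact Gate.dist_le_one ((hC L List.mem_cons_self).1 g hg) hu hw
    have := Site.dist_triangle u w v
    rw [List.length_cons]
    omega

/-- The swaps of one layer act on disjoint pairs, so together they move a spin by at most one. -/
theorem SwapLayer.dist_foldl_le {S : SwapLayer a b} (hS : Layer.Valid S.toLayer)
    (π : Equiv.Perm (Site a b)) (u : Site a b) :
    (π u).dist ((S.foldl (fun π e => Equiv.swap e.1 e.2 * π) π) u) ≤ 1 ∧
    ((∀ e ∈ S, π u ≠ e.1 ∧ π u ≠ e.2) →
      (S.foldl (fun π e => Equiv.swap e.1 e.2 * π) π) u = π u) := by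
  induction S generalizing π with
  | nil => simp [Site.dist_self]
  | cons e S ih =>
    simp only [SwapLayer.toLayer, Layer.Valid, List.map_cons, List.mem_cons, forall_eq_or_imp,
      List.pairwise_cons] at hS
    have ih := ih ⟨hS.1.2, hS.2.2⟩ (Equiv.swap e.1 e.2 * π)
    have hdis : ∀ x, x = e.1 ∨ x = e.2 → ∀ e' ∈ S, x ≠ e'.1 ∧ x ≠ e'.2 := by
      intro x hx e' he'
      have := hS.2.1 (.cliffordTwo e'.1 e'.2 swapMatrix) (List.mem_map.2 ⟨e', he', rfl⟩)
      have hx' : x ∉ (Gate.cliffordTwo e'.1 e'.2 swapMatrix).support :=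
        Set.disjoint_left.1 this (by simpa [Gate.support] using hx)
      simpa [Gate.support] using hx'
    have hd : e.1.dist e.2 = 1 := hS.1.1.1
    simp only [List.foldl_cons, List.mem_cons, forall_eq_or_imp]
    by_cases h1 : π u = e.1
    · have hm : (Equiv.swap e.1 e.2 * π) u = e.2 := by simp [h1]
      have := ih.2 (by rw [hm]; exact hdis _ (Or.inr rfl))
      rw [this, hm, h1]
      exact ⟨hd.le, fun h => absurd rfl h.1.1⟩
    · by_cases h2 : π u = e.2
      · have hm : (Equiv.swap e.1 e.2 * π) u = e.1 := by simp [h2]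
        have := ih.2 (by rw [hm]; exact hdis _ (Or.inl rfl))
        rw [this, hm, h2, Site.dist_comm]
        exact ⟨hd.le, fun h => absurd rfl h.1.2⟩
      · have hm : (Equiv.swap e.1 e.2 * π) u = π u := by
          simp [Equiv.swap_apply_of_ne_of_ne h1 h2]
        rw [hm] at ih
        exact ⟨ih.1, fun h => ih.2 h.2⟩

theorem dist_swapPerm_le {S : List (SwapLayer a b)} (hS : ∀ L ∈ S, Layer.Valid L.toLayer)
    (u : Site a b) : u.dist (swapPerm S u) ≤ S.length := by
  suffices H : ∀ π : Equiv.Perm (Site a b),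
      (π u).dist (S.flatten.foldl (fun π e => Equiv.swap e.1 e.2 * π) π u) ≤ S.length from H 1
  induction S with
  | nil => simp [Site.dist_self]
  | cons L S ih =>
    intro π
    rw [List.flatten_cons, List.foldl_append, List.length_cons]
    have h1 := (SwapLayer.dist_foldl_le (hS L List.mem_cons_self) π u).1
    have h2 := ih (fun L hL => hS L (List.mem_cons_of_mem _ hL))
      (L.foldl (fun π e => Equiv.swap e.1 e.2 * π) π)
    have := Site.dist_triangle (π u) (L.foldl (fun π e => Equiv.swap e.1 e.2 * π) π u)
      (S.flatten.foldl (fun π e => Equiv.swap e.1 e.2 * π)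
        (L.foldl (fun π e => Equiv.swap e.1 e.2 * π) π) u)
    omega

theorem Ansatz.mem_circuit_of_mem_V {A : Ansatz a b} {j : Fin A.m} {k : Fin (A.M + 1)}
    {L : Layer a b} (hL : L ∈ A.V j k) : L ∈ A.circuit := by
  refine List.mem_flatten.2 ⟨_, List.mem_ofFn.2 ⟨j, rfl⟩, List.mem_append_right _ ?_⟩
  rcases Fin.eq_castSucc_or_eq_last k with ⟨i, rfl⟩ | rfl
  · exact List.mem_append_left _ (List.mem_flatten.2
      ⟨_, List.mem_ofFn.2 ⟨i, rfl⟩, List.mem_append_left _ hL⟩)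
  · exact List.mem_append_right _ hL

theorem Ansatz.mem_circuit_of_mem_S {A : Ansatz a b} (j : Fin A.m) {k : Fin A.M}
    {L : SwapLayer a b} (hL : L ∈ A.S k) : L.toLayer ∈ A.circuit := by
  refine List.mem_flatten.2 ⟨_, List.mem_ofFn.2 ⟨j, rfl⟩, List.mem_append_right _ ?_⟩
  exact List.mem_append_left _ (List.mem_flatten.2
    ⟨_, List.mem_ofFn.2 ⟨k, rfl⟩, List.mem_append_right _ (List.mem_map_of_mem hL)⟩)

theorem Ansatz.dist_position_le {A : Ansatz a b} (hA : ∀ L ∈ A.circuit, Layer.Valid L)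
    (j : Fin A.m) (k : Fin (A.M + 1)) (u : Site a b) : u.dist (A.position k u) ≤ A.overhead := by
  refine (dist_swapPerm_le ?_ u).trans ?_
  · intro L hL
    obtain ⟨l, hl, hLl⟩ := List.mem_flatten.1 hL
    obtain ⟨i, rfl⟩ := List.mem_ofFn.1 (List.mem_of_mem_take hl)
    exact hA _ (A.mem_circuit_of_mem_S j hLl)
  · rw [List.length_flatten]
    calc (((List.ofFn A.S).take k).map List.length).sum
        ≤ ((List.ofFn A.S).map List.length).sum :=
          List.Sublist.sum_le_sum ((List.take_sublist _ _).map _) (by simp)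
      _ = A.overhead := by
          rw [List.map_ofFn, List.sum_ofFn]
          rfl

theorem Ansatz.Implements.dist_le {A : Ansatz a b} {H : Ising a b} {c Λ : ℕ}
    (hA : A.Implements H c) (hΛ : A.overhead ≤ Λ) {u v : Site a b} (h : H.graph.Adj u v) :
    u.dist v ≤ c + 2 * Λ := by
  obtain ⟨j, k, hjk⟩ := hA.term u v h
  have hlen : (A.V j k).length ≤ c :=
    (Finset.single_le_sum (f := fun k => (A.V j k).length) (fun _ _ => Nat.zero_le _)
      (Finset.mem_univ k)).trans (by have := hA.depth j; omega)
  have hV : ∀ L ∈ A.V j k, Layer.Valid L := fun L hL => hA.valid L (A.mem_circuit_of_mem_V hL)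
  have hd : (A.position k u).dist (A.position k v) ≤ c := by
    rcases hjk with h | h
    · exact (h.dist_le hV).trans hlen
    · rw [Site.dist_comm]; exact (h.dist_le hV).trans hlen
  have h1 := A.dist_position_le hA.valid j k u
  have h2 := A.dist_position_le hA.valid j k v
  rw [Site.dist_comm] at h2
  have h3 := Site.dist_triangle u (A.position k u) v
  have h4 := Site.dist_triangle (A.position k u) (A.position k v) v
  omega

/-! ### Cutting the lattice into strips -/

/-- The place of a site in the order that runs through the lattice in strips of `ℓ` columns, and
through every strip row by row.  The last strip is filled up to `ℓ` columns. -/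
def chainPos (ℓ : ℕ) (u : Site a b) : ℕ :=
  (u.2 : ℕ) / ℓ * (a * ℓ) + (u.1 : ℕ) * ℓ + (u.2 : ℕ) % ℓ

theorem chainPos_lt {ℓ : ℕ} (hℓ : 0 < ℓ) (u : Site a b) :
    chainPos ℓ u < (b / ℓ + 1) * (a * ℓ) := by
  have h1 : (u.2 : ℕ) / ℓ ≤ b / ℓ := Nat.div_le_div_right u.2.2.le
  have h2 : (u.2 : ℕ) % ℓ < ℓ := Nat.mod_lt _ hℓ
  have h3 : ((u.1 : ℕ) + 1) * ℓ ≤ a * ℓ := Nat.mul_le_mul_right _ u.1.2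
  have h4 := Nat.mul_le_mul_right (a * ℓ) h1
  simp only [chainPos]
  rw [Nat.add_mul] at h3 ⊢
  omega

theorem chainPos_injective {ℓ : ℕ} (hℓ : 0 < ℓ) :
    Function.Injective (chainPos ℓ : Site a b → ℕ) := by
  have key : ∀ u : Site a b, chainPos ℓ u % ℓ = (u.2 : ℕ) % ℓ ∧
      chainPos ℓ u / ℓ % a = u.1 ∧ chainPos ℓ u / ℓ / a = (u.2 : ℕ) / ℓ := by
    intro u
    have ha : 0 < a := lt_of_le_of_lt (Nat.zero_le _) u.1.2
    have h2 : (u.2 : ℕ) % ℓ < ℓ := Nat.mod_lt _ hℓ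
    have h1 : chainPos ℓ u = (u.2 : ℕ) % ℓ + ℓ * ((u.1 : ℕ) + a * ((u.2 : ℕ) / ℓ)) := by
      simp only [chainPos]; ring
    rw [h1, Nat.add_mul_mod_self_left, Nat.add_mul_div_left _ _ hℓ, Nat.div_eq_of_lt h2,
      Nat.mod_eq_of_lt h2, zero_add, Nat.add_mul_mod_self_left, Nat.add_mul_div_left _ _ ha,
      Nat.mod_eq_of_lt u.1.2, Nat.div_eq_of_lt u.1.2, zero_add]
    exact ⟨rfl, rfl, rfl⟩
  intro u v huv
  obtain ⟨h1, h2, h3⟩ := key u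
  obtain ⟨h1', h2', h3'⟩ := key v
  rw [huv] at h1 h2 h3
  refine Prod.ext (Fin.ext (h2.symm.trans h2')) (Fin.ext ?_)
  rw [← Nat.mod_add_div (u.2 : ℕ) ℓ, ← h1, ← h3, h1', h3', Nat.mod_add_div]

/-- Inside a strip, positions in the chain differ by at most one row length `ℓ` per step between rows, and by
less than `ℓ` within a row. -/
theorem dist_chainPos_le {ℓ r : ℕ} (hℓ : 0 < ℓ) {u v : Site a b} (hd : u.dist v ≤ r)
    (h : (u.2 : ℕ) / ℓ = (v.2 : ℕ) / ℓ) :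
    Nat.dist (chainPos ℓ u) (chainPos ℓ v) ≤ (r + 1) * ℓ := by
  have h1 : (u.2 : ℕ) % ℓ < ℓ := Nat.mod_lt _ hℓ
  have h2 : (v.2 : ℕ) % ℓ < ℓ := Nat.mod_lt _ hℓ
  simp only [Site.dist, Nat.dist] at hd
  simp only [chainPos, h, Nat.dist]
  have h3 : (u.1 : ℕ) * ℓ ≤ ((v.1 : ℕ) + r) * ℓ := Nat.mul_le_mul_right _ (by omega)
  have h4 : (v.1 : ℕ) * ℓ ≤ ((u.1 : ℕ) + r) * ℓ := Nat.mul_le_mul_right _ (by omega)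
  rw [Nat.add_mul] at h3 h4 ⊢
  omega

/-- The sites from which another strip can be reached by going at most `r` columns to the right. -/
def stripBoundary (a b ℓ r : ℕ) : Finset (Site a b) :=
  Finset.univ.filter fun u => ((u.2 : ℕ) / ℓ + 1) * ℓ < b ∧ ((u.2 : ℕ) / ℓ + 1) * ℓ ≤ u.2 + r

/-- Each of the at most `b / ℓ` inner strip borders has at most `r` sites per row within distance `r`. -/
theorem card_stripBoundary_le {ℓ : ℕ} (hℓ : 0 < ℓ) (r : ℕ) :
    (stripBoundary a b ℓ r).card ≤ a * (b / ℓ * r) := by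
  have : (stripBoundary a b ℓ r).card ≤
      ((Finset.univ : Finset (Fin a)) ×ˢ (Finset.range (b / ℓ) ×ˢ Finset.range r)).card := by
    refine Finset.card_le_card_of_injOn
      (fun u => (u.1, (u.2 : ℕ) / ℓ, ℓ - 1 - (u.2 : ℕ) % ℓ)) ?_ ?_
    · intro u hu
      simp only [stripBoundary, Finset.coe_filter, Finset.mem_univ, true_and,
        Set.mem_ofPred_eq] at hu
      have h1 : (u.2 : ℕ) % ℓ < ℓ := Nat.mod_lt _ hℓ
      have h2 := Nat.mod_add_div (u.2 : ℕ) ℓ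
      rw [mul_comm ℓ] at h2
      have h3 := (Nat.le_div_iff_mul_le hℓ).2 hu.1.le
      simp only [Finset.coe_product, Set.mem_prod, Finset.coe_univ, Set.mem_univ, Finset.coe_range,
        Set.mem_Iio, true_and]
      rw [Nat.add_mul] at hu
      omega
    · intro u _ v _ huv
      simp only [Prod.mk.injEq] at huv
      have h1 : (u.2 : ℕ) % ℓ < ℓ := Nat.mod_lt _ hℓ
      have h1' : (v.2 : ℕ) % ℓ < ℓ := Nat.mod_lt _ hℓ
      have h2 := Nat.mod_add_div (u.2 : ℕ) ℓ
      have h2' := Nat.mod_add_div (v.2 : ℕ) ℓ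
      refine Prod.ext huv.1 (Fin.ext ?_)
      rw [huv.2.1] at h2
      omega
  simpa using this

/-- The edges whose end points are at most `W` apart in the order `chainPos ℓ`. -/
def shortEdges (ℓ W : ℕ) (l : List (Site a b × Site a b)) : List (Site a b × Site a b) :=
  l.filter fun e => Nat.dist (chainPos ℓ e.1) (chainPos ℓ e.2) ≤ W

theorem mem_stripBoundary_of_long {ℓ r : ℕ} (hℓ : 0 < ℓ) {u v : Site a b} (hd : u.dist v ≤ r)
    (h : ¬ Nat.dist (chainPos ℓ u) (chainPos ℓ v) ≤ (r + 1) * ℓ) :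
    u ∈ stripBoundary a b ℓ r ∨ v ∈ stripBoundary a b ℓ r := by
  have hne : (u.2 : ℕ) / ℓ ≠ (v.2 : ℕ) / ℓ := fun h' => h (dist_chainPos_le hℓ hd h')
  simp only [Site.dist, Nat.dist] at hd
  simp only [stripBoundary, Finset.mem_filter, Finset.mem_univ, true_and]
  have hu := Nat.div_mul_le_self (u.2 : ℕ) ℓ
  have hv := Nat.div_mul_le_self (v.2 : ℕ) ℓ
  have hub := u.2.2
  have hvb := v.2.2
  rcases lt_or_gt_of_ne hne with h' | h'
  · have := Nat.mul_le_mul_right ℓ (Nat.succ_le_of_lt h')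
    rw [Nat.succ_eq_add_one] at this
    left
    omega
  · have := Nat.mul_le_mul_right ℓ (Nat.succ_le_of_lt h')
    rw [Nat.succ_eq_add_one] at this
    right
    omega

theorem abs_sum_map_le {α : Type*} {J : ℝ} (f : α → ℝ) (l : List α) (h : ∀ x ∈ l, |f x| ≤ J) :
    |(l.map f).sum| ≤ l.length * J := by
  induction l with
  | nil => simp
  | cons x l ih =>
    have h1 := ih fun y hy => h y (List.mem_cons_of_mem _ hy)
    have h2 := h x List.mem_cons_self
    rw [List.map_cons, List.sum_cons, List.length_cons]
    push_cast
    calc _ ≤ |f x| + |(l.map f).sum| := abs_add_le _ _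
      _ ≤ _ := by linarith

theorem abs_spin (x : Fin 2) : |spin x| = 1 := by
  unfold spin; split_ifs <;> simp

/-- An edge that is long in the chain connects two strips, so one of its ends is among the at most
`a * (b / ℓ * r)` sites of `stripBoundary`; each of these has at most `Δ` edges. -/
theorem Ising.abs_energy_sub_le {H : Ising a b} {l : List (Site a b × Site a b)}
    (hl : IsEdgeList H.graph l) {Δ r ℓ : ℕ} {J ε : ℝ} (hℓ : 0 < ℓ)
    (hΔ : ∀ u, (H.graph.neighborSet u).ncard ≤ Δ) (hJ0 : 0 ≤ J)
    (hJ : ∀ e ∈ H.graph.edgeSet, |H.J e| ≤ J)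
    (hr : ∀ u v, H.graph.Adj u v → u.dist v ≤ r) (hε : (Δ * r : ℕ) * J ≤ ε * ℓ) (σ : Config a b) :
    |H.energy l σ - H.energy (shortEdges ℓ ((r + 1) * ℓ) l) σ| ≤ ε * (a * b : ℕ) := by
  set F : Site a b × Site a b → ℝ := fun e => H.J s(e.1, e.2) * (spin (σ e.1) * spin (σ e.2))
  set p : Site a b × Site a b → Bool := fun e =>
    Nat.dist (chainPos ℓ e.1) (chainPos ℓ e.2) ≤ (r + 1) * ℓ
  have hsplit : ∀ l : List (Site a b × Site a b), (l.map F).sum =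
      ((l.filter p).map F).sum + ((l.filter fun e => !p e).map F).sum := by
    intro l
    induction l with
    | nil => simp
    | cons e l ih =>
      simp only [List.map_cons, List.sum_cons, ih, List.filter_cons]
      cases p e <;> simp <;> ring
  have h1 : H.energy l σ - H.energy (shortEdges ℓ ((r + 1) * ℓ) l) σ =
      ((l.filter fun e => !p e).map F).sum := by
    simp only [Ising.energy, shortEdges]
    have := hsplit l
    simp only [F, p] at this ⊢
    linarith
  have hsub : (l.filter fun e => !p e).Sublist l := List.filter_sublist
  have hlen := hl.length_le hΔ hsub (stripBoundary a b ℓ r) (by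
    intro e he
    have he' := (List.mem_filter.1 he).2
    refine mem_stripBoundary_of_long hℓ (hr _ _ (hl.adj (hsub.subset he))) ?_
    simpa [p] using he')
  have hcard : (l.filter fun e => !p e).length * ℓ ≤ Δ * r * (a * b) := by
    calc _ ≤ Δ * (a * (b / ℓ * r)) * ℓ :=
          Nat.mul_le_mul_right _ (hlen.trans (Nat.mul_le_mul_left _ (card_stripBoundary_le hℓ r)))
      _ = Δ * r * (a * (b / ℓ * ℓ)) := by ring
      _ ≤ _ := Nat.mul_le_mul_left _ (Nat.mul_le_mul_left _ (Nat.div_mul_le_self b ℓ))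
  rw [h1]
  refine (abs_sum_map_le (J := J) F _ ?_).trans ?_
  · intro e he
    have hadj := hl.adj (hsub.subset he)
    have := hJ s(e.1, e.2) (by simpa using hadj)
    simpa [F, abs_mul, abs_spin] using this
  · have hℓ' : (0 : ℝ) < ℓ := by exact_mod_cast hℓ
    have hcard' : ((l.filter fun e => !p e).length : ℝ) * ℓ ≤ (Δ * r : ℕ) * (a * b : ℕ) := by
      exact_mod_cast hcard
    have hab : (0 : ℝ) ≤ (a * b : ℕ) := Nat.cast_nonneg _
    refine le_of_mul_le_mul_right ?_ hℓ'
    calc _ = ((l.filter fun e => !p e).length : ℝ) * ℓ * J := by ring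
      _ ≤ (Δ * r : ℕ) * (a * b : ℕ) * J := mul_le_mul_of_nonneg_right hcard' hJ0
      _ = ((Δ * r : ℕ) * J) * (a * b : ℕ) := by ring
      _ ≤ (ε * ℓ) * (a * b : ℕ) := mul_le_mul_of_nonneg_right hε hab
      _ = _ := by ring

theorem abs_sub_le_of_isLeast {α : Type*} {f g : α → ℝ} {m m' δ : ℝ}
    (hf : IsLeast (Set.range f) m) (hg : IsLeast (Set.range g) m') (h : ∀ x, |f x - g x| ≤ δ) :
    |m' - m| ≤ δ := by
  obtain ⟨⟨x, hx⟩, hm⟩ := hf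
  obtain ⟨⟨y, hy⟩, hm'⟩ := hg
  have h1 := hm ⟨y, rfl⟩
  have h2 := hm' ⟨x, rfl⟩
  have h3 := abs_le.1 (h x)
  have h4 := abs_le.1 (h y)
  rw [abs_le]
  constructor <;> linarith

/-! ### The truncated Hamiltonian as a spin chain -/

/-- Fields of the chain. -/
noncomputable def chainField (H : Ising a b) (ℓ t : ℕ) : ℝ :=
  ∑ u : Site a b, if chainPos ℓ u = t then H.h u else 0

/-- The later of the two places of an edge in the chain. -/
def latePos (ℓ : ℕ) (e : Site a b × Site a b) : ℕ :=
  chainPos ℓ e.1 + (chainPos ℓ e.2 - chainPos ℓ e.1)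

/-- Couplings of the chain, as a table in which row `t` has the entries `t * (W + 1) + d`, `d ≤ W`,
for the couplings of the spin `t` with the spin `t - d`. -/
noncomputable def couplingTable (H : Ising a b) (ℓ W : ℕ) (l : List (Site a b × Site a b))
    (i : ℕ) : ℝ :=
  (l.map fun e => if Nat.dist (chainPos ℓ e.1) (chainPos ℓ e.2) ≤ W ∧
    latePos ℓ e * (W + 1) + Nat.dist (chainPos ℓ e.1) (chainPos ℓ e.2) = i
    then H.J s(e.1, e.2) else 0).sum

theorem couplingTable_cons (H : Ising a b) (ℓ W : ℕ) (e : Site a b × Site a b)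
    (l : List (Site a b × Site a b)) (i : ℕ) :
    couplingTable H ℓ W (e :: l) i =
      (if Nat.dist (chainPos ℓ e.1) (chainPos ℓ e.2) ≤ W ∧
        latePos ℓ e * (W + 1) + Nat.dist (chainPos ℓ e.1) (chainPos ℓ e.2) = i
        then H.J s(e.1, e.2) else 0) + couplingTable H ℓ W l i := by
  simp only [couplingTable, List.map_cons, List.sum_cons]

/-- The configuration of the lattice that belongs to a configuration of the chain. -/
def chainConfig (ℓ w : ℕ) (β : ℕ → Bool) : Config a b := fun u =>
  if β (chainPos ℓ u + w + 1) then 1 else 0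

theorem spin_chainConfig (ℓ w : ℕ) (β : ℕ → Bool) (u : Site a b) :
    spin (chainConfig ℓ w β u) = sgn (β (chainPos ℓ u + w + 1)) := by
  unfold chainConfig spin sgn
  split_ifs <;> simp_all

theorem chainEnergy_eq_energy {H : Ising a b} {l : List (Site a b × Site a b)}
    (hl : ∀ e ∈ l, e.1 ≠ e.2) {ℓ : ℕ} (hℓ : 0 < ℓ) (w : ℕ) (β : ℕ → Bool) :
    chainEnergy (chainField H ℓ)
      (fun t d => couplingTable H ℓ (w + 1) l (t * (w + 1 + 1) + d)) w
      ((b / ℓ + 1) * (a * ℓ)) β =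
    H.energy (shortEdges ℓ (w + 1) l) (chainConfig ℓ w β) := by
  set N := (b / ℓ + 1) * (a * ℓ)
  simp only [chainEnergy, mul_add (sgn _), Finset.sum_add_distrib, Ising.energy]
  rw [add_comm]
  congr 1
  · induction l with
    | nil => simp [couplingTable, shortEdges]
    | cons e l ih =>
      have ih := ih fun e he => hl e (List.mem_cons_of_mem _ he)
      have hne : chainPos ℓ e.1 ≠ chainPos ℓ e.2 := fun h =>
        hl e List.mem_cons_self (chainPos_injective hℓ h)
      simp only [couplingTable_cons, add_mul (ite _ _ _), mul_add (sgn _),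
        Finset.sum_add_distrib] at ih ⊢
      rw [ih, shortEdges, shortEdges, List.filter_cons]
      by_cases hd : Nat.dist (chainPos ℓ e.1) (chainPos ℓ e.2) ≤ w + 1
      · simp only [hd, true_and, decide_true, if_true, List.map_cons, List.sum_cons]
        congr 1
        have hlate : latePos ℓ e < N := by
          have h1 := chainPos_lt hℓ e.1
          have h2 := chainPos_lt hℓ e.2
          simp only [latePos]
          omega
        rw [Finset.sum_eq_single_of_mem (latePos ℓ e) (Finset.mem_range.2 hlate)]
        · have hpos : 1 ≤ Nat.dist (chainPos ℓ e.1) (chainPos ℓ e.2) := Nat.dist_pos_of_ne hne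
          rw [Finset.sum_eq_single_of_mem (Nat.dist (chainPos ℓ e.1) (chainPos ℓ e.2) - 1)
            (Finset.mem_range.2 (by omega))]
          · rw [if_pos (by omega), spin_chainConfig, spin_chainConfig, history]
            rcases le_total (chainPos ℓ e.1) (chainPos ℓ e.2) with h | h
            · have e1 : latePos ℓ e = chainPos ℓ e.2 := by simp only [latePos]; omega
              have e2 : chainPos ℓ e.2 + w -
                  (Nat.dist (chainPos ℓ e.1) (chainPos ℓ e.2) - 1) = chainPos ℓ e.1 + w + 1 := by
                simp only [Nat.dist] at *; omega
              rw [e1, e2]; ring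
            · have e1 : latePos ℓ e = chainPos ℓ e.1 := by simp only [latePos]; omega
              have e2 : chainPos ℓ e.1 + w -
                  (Nat.dist (chainPos ℓ e.1) (chainPos ℓ e.2) - 1) = chainPos ℓ e.2 + w + 1 := by
                simp only [Nat.dist] at *; omega
              rw [e1, e2]; ring
          · intro i _ hi
            rw [if_neg (by omega)]
            simp
        · intro t _ ht
          refine mul_eq_zero_of_right _ (Finset.sum_eq_zero fun i hi => ?_)
          have hi := Finset.mem_range.1 hi
          rw [if_neg]
          · simp
          · intro h
            apply ht
            have h1 := congrArg (· / (w + 1 + 1)) h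
            rw [mul_comm, Nat.mul_add_div (by omega), Nat.div_eq_of_lt (by omega), mul_comm,
              Nat.mul_add_div (by omega), Nat.div_eq_of_lt (by omega)] at h1
            omega
      · simp [hd]
  · have : ∀ t ∈ Finset.range N, sgn (β (t + w + 1)) * chainField H ℓ t =
        ∑ u : Site a b, if chainPos ℓ u = t then H.h u * sgn (β (chainPos ℓ u + w + 1)) else 0 := by
      intro t _
      rw [chainField, Finset.mul_sum]
      refine Finset.sum_congr rfl fun u _ => ?_
      split_ifs with h
      · rw [h]; ring
      · simp
    refine (Finset.sum_congr rfl this).trans ?_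
    rw [Finset.sum_comm]
    refine Finset.sum_congr rfl fun u _ => ?_
    rw [Finset.sum_ite_eq, if_pos (Finset.mem_range.2 (chainPos_lt hℓ u)), spin_chainConfig]

theorem range_chainEnergy {H : Ising a b} {l : List (Site a b × Site a b)}
    (hl : ∀ e ∈ l, e.1 ≠ e.2) {ℓ : ℕ} (hℓ : 0 < ℓ) (w : ℕ) :
    Set.range (chainEnergy (chainField H ℓ)
      (fun t d => couplingTable H ℓ (w + 1) l (t * (w + 1 + 1) + d)) w
      ((b / ℓ + 1) * (a * ℓ))) = Set.range (H.energy (shortEdges ℓ (w + 1) l)) := by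
  classical
  ext x
  constructor
  · rintro ⟨β, rfl⟩
    exact ⟨chainConfig ℓ w β, (chainEnergy_eq_energy hl hℓ w β).symm⟩
  · rintro ⟨σ, rfl⟩
    refine ⟨fun t => decide (∃ u : Site a b, chainPos ℓ u + w + 1 = t ∧ σ u = 1), ?_⟩
    rw [chainEnergy_eq_energy hl hℓ]
    congr 1
    funext u
    have : (∃ v : Site a b, chainPos ℓ v + w + 1 = chainPos ℓ u + w + 1 ∧ σ v = 1) ↔ σ u = 1 := by
      constructor
      · rintro ⟨v, hv, hv'⟩
        rwa [← chainPos_injective hℓ (show chainPos ℓ v = chainPos ℓ u by omega)]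
      · exact fun h => ⟨u, rfl, h⟩
    simp only [chainConfig, this, decide_eq_true_eq]
    generalize σ u = y
    fin_cases y <;> simp

/-! ### The program that minimizes the truncated energy -/

namespace Prog

/-- Strip width: the natural register `8` receives the least `ℓ ≥ 1` with `C ≤ ε ℓ`. -/
def width (C : ℕ) : Prog :=
  setNat 8 (.const 1) ;;
  loop (.neg (.realLe (.cast (.const C)) (.mul (.var 0) (.cast (.var 8)))))
    (setNat 8 (.add (.var 8) (.const 1)))

/-- `a ℓ` and the interaction range `W = (r + 1) ℓ`. -/
def dims (r : ℕ) : Prog :=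
  setNat 9 (.const 0) ;;
  forTo 12 (.var 0) (setNat 9 (.add (.var 9) (.var 8))) ;;
  setNat 11 (.smul (r + 1) (.var 8))

/-- One column of the lattice: its places in the chain and its fields. -/
def placeColumn : Prog :=
  setNat 16 (.add (.var 13) (.var 14)) ;;
  setNat 17 (.var 12) ;;
  forTo 15 (.var 0)
    (setNatArr 8 (.var 17) (.var 16) ;;
     setRealArr 8 (.var 16) (.arr 1 (.var 17)) ;;
     setNat 16 (.add (.var 16) (.var 8)) ;;
     setNat 17 (.add (.var 17) (.var 1)))

/-- Tabulates the places of the sites in the chain and the fields of the chain. -/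
def place : Prog :=
  setNat 13 (.const 0) ;;
  setNat 14 (.const 0) ;;
  forTo 12 (.var 1)
    (placeColumn ;;
     setNat 14 (.add (.var 14) (.const 1)) ;;
     cond (.natEq (.var 14) (.var 8))
       (setNat 14 (.const 0) ;; setNat 13 (.add (.var 13) (.var 9))) skip) ;;
  setNat 10 (.add (.var 13) (.var 9))

end Prog

theorem runs_width {s : Mem} {ε : ℝ} (hε : 0 < ε) (hs : s.real 0 = ε) (C : ℕ) :
    Runs (Prog.width C) s (2 * (⌈C / ε⌉₊ + 2))
      (fun s' => 1 ≤ s'.nat 8 ∧ s'.nat 8 ≤ ⌈C / ε⌉₊ + 1 ∧ (C : ℝ) ≤ ε * s'.nat 8) := by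
  refine Runs.mono (Runs.seq (Runs.of_run (P := .setNat 8 (.const 1)) rfl
    (Runs.while_loop (N := ⌈C / ε⌉₊) (T := 1)
    (fun j s' => s'.nat 8 + j = ⌈C / ε⌉₊ + 1 ∧ 1 ≤ s'.nat 8) ?_ ?_ ?_))) (T := _ + _) ?_
    (fun s' _ h => h)
  · simp [Prog.run, NExpr.eval, add_comm]
  · rintro j s' hF ⟨h1, h2⟩ hc
    have h0 : s'.real 0 = ε := by rw [hF.real 0 rfl]; exact hs
    simp only [Test.Holds, RExpr.eval, NExpr.eval, h0, not_le] at hc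
    have hlt : s'.nat 8 < ⌈C / ε⌉₊ + 1 := by
      by_contra hge
      have h3 : (⌈C / ε⌉₊ : ℝ) ≤ s'.nat 8 := by exact_mod_cast (by omega : ⌈C / ε⌉₊ ≤ s'.nat 8)
      have h4 := (Nat.le_ceil (C / ε)).trans h3
      rw [div_le_iff₀ hε] at h4
      linarith
    refine (Runs.of_run (P := .setNat 8 (.add (.var 8) (.const 1))) rfl
      ⟨j - 1, by omega, ?_, ?_⟩).mono le_rfl fun _ _ h => h
    · simp [Prog.run, NExpr.eval]; omega
    · simp [Prog.run, NExpr.eval]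
  · rintro j s' hF ⟨h1, h2⟩ hc
    have h0 : s'.real 0 = ε := by rw [hF.real 0 rfl]; exact hs
    simp only [Test.Holds, RExpr.eval, NExpr.eval, h0, not_not] at hc
    exact ⟨h2, by omega, hc⟩
  · simp only [Prog.cost]; omega

theorem runs_dims {s : Mem} {ℓ : ℕ} (ha : s.nat 0 = a) (hℓ : s.nat 8 = ℓ) (r : ℕ) :
    Runs (Prog.dims r) s (1 + ((a * (1 + 2) + 2) + 1))
      (fun s' => s'.nat 9 = a * ℓ ∧ s'.nat 11 = (r + 1) * ℓ) := by
  refine Runs.seq (Runs.of_run (P := .setNat 9 (.const 0)) rfl (Runs.seq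
    (Runs.for_loop (T := 1) (fun j s' => s'.nat 9 = j * ℓ ∧ s'.nat 8 = ℓ) rfl ?_ ?_ ?_ ?_)))
  · intro s' hF
    simpa [NExpr.eval, hF.nat 0 rfl, Prog.run] using ha
  · simp [Prog.run, NExpr.eval, hℓ]
  · rintro j s' hj hF hi ⟨h1, h2⟩
    refine Runs.of_run (P := .setNat 9 (.add (.var 9) (.var 8))) rfl ?_
    simp [Prog.run, NExpr.eval, h1, h2, Nat.add_mul]
  · rintro s' hF ⟨h1, h2⟩
    refine Runs.of_run (P := .setNat 11 (.smul (r + 1) (.var 8))) rfl ?_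
    simp [Prog.run, NExpr.eval_smul, NExpr.eval, h1, h2]

theorem Site.idx_injective : Function.Injective (Site.idx : Site a b → ℕ) := by
  intro u v h
  have hb : 0 < b := lt_of_le_of_lt (Nat.zero_le _) u.2.2
  simp only [Site.idx] at h
  have h1 := congrArg (· / b) h
  have h2 := congrArg (· % b) h
  simp only [mul_comm _ b, Nat.mul_add_div hb, Nat.div_eq_of_lt u.2.2, Nat.div_eq_of_lt v.2.2,
    Nat.mul_add_mod, Nat.mod_eq_of_lt u.2.2, Nat.mod_eq_of_lt v.2.2, add_zero] at h1 h2
  exact Prod.ext (Fin.ext h1) (Fin.ext h2)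

/-- The places in the chain and the fields of the chain are tabulated for the sites in `S`. -/
structure Placed (H : Ising a b) (ℓ : ℕ) (S : Site a b → Prop) (s : Mem) : Prop where
  pos : ∀ u, S u → s.natArr 8 u.idx = chainPos ℓ u
  field : ∀ u, S u → s.realArr 8 (chainPos ℓ u) = H.h u
  zero : ∀ t, (∀ u : Site a b, chainPos ℓ u ≠ t) → s.realArr 8 t = 0

theorem runs_placeColumn {H : Ising a b} {s : Mem} {ℓ j : ℕ} (hℓ : 0 < ℓ) (ha : s.nat 0 = a)
    (hb : s.nat 1 = b) (h8 : s.nat 8 = ℓ) (hf : ∀ u : Site a b, s.realArr 1 u.idx = H.h u)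
    (hj : j < b) (h12 : s.nat 12 = j) (h13 : s.nat 13 = j / ℓ * (a * ℓ)) (h14 : s.nat 14 = j % ℓ)
    (hP : Placed H ℓ (fun u => (u.2 : ℕ) < j) s) :
    Runs Prog.placeColumn s (1 + (1 + (a * (4 + 2) + 2)))
      (Placed H ℓ (fun u => (u.2 : ℕ) < j + 1)) := by
  refine Runs.seq (Runs.of_run (P := .setNat 16 _) rfl (Runs.seq
    (Runs.of_run (P := .setNat 17 _) rfl (Runs.for_loop (T := 4) (fun i s' =>
      s'.nat 16 = j / ℓ * (a * ℓ) + j % ℓ + i * ℓ ∧ s'.nat 17 = i * b + j ∧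
      Placed H ℓ (fun u => (u.2 : ℕ) < j ∨ (u.2 : ℕ) = j ∧ (u.1 : ℕ) < i) s') rfl ?_ ?_ ?_ ?_))))
  · intro s' hF
    simpa [NExpr.eval, hF.nat 0 rfl, Prog.run] using ha
  · simp only [Prog.run, NExpr.eval]
    refine ⟨by simp [h13, h14], by simp [h12], ?_⟩
    exact ⟨fun u hu => hP.pos u (by simpa using hu), fun u hu => hP.field u (by simpa using hu),
      hP.zero⟩
  · rintro i s' hi hF - ⟨h16, h17, hP'⟩
    have e8 : s'.nat 8 = ℓ := by rw [hF.nat 8 rfl]; simp [Prog.run, h8]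
    have e1 : s'.nat 1 = b := by rw [hF.nat 1 rfl]; simp [Prog.run, hb]
    have eA : s'.realArr 1 = s.realArr 1 := by rw [hF.realArr 1 rfl]; simp [Prog.run]
    have hpos : chainPos ℓ ((⟨i, hi⟩, ⟨j, hj⟩) : Site a b) = s'.nat 16 := by
      rw [h16]; simp only [chainPos]; ring
    have hidx : Site.idx ((⟨i, hi⟩, ⟨j, hj⟩) : Site a b) = s'.nat 17 := by
      rw [h17]; simp only [Site.idx]
    have hnew : ∀ u : Site a b, (u.2 : ℕ) < j ∨ (u.2 : ℕ) = j ∧ (u.1 : ℕ) < i + 1 →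
        u = (⟨i, hi⟩, ⟨j, hj⟩) ∨ (u.2 : ℕ) < j ∨ (u.2 : ℕ) = j ∧ (u.1 : ℕ) < i := by
      intro u hu
      by_cases h : (u.2 : ℕ) = j ∧ (u.1 : ℕ) = i
      · exact Or.inl (Prod.ext (Fin.ext h.2) (Fin.ext h.1))
      · right; omega
    refine Runs.of_run (P := .seq _ (.seq _ (.seq _ _))) rfl ?_
    simp only [Prog.run, NExpr.eval, RExpr.eval]
    refine ⟨?_, ?_, ?_, ?_, ?_⟩
    · simp [h16, e8]; ring
    · simp [h17, e1]; ring
    · intro u hu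
      rcases hnew u hu with rfl | hu
      · simp [hidx, hpos]
      · by_cases h : u.idx = s'.nat 17
        · have := Site.idx_injective (h.trans hidx.symm)
          subst this
          simp [h, hpos]
        · simp [Function.update_of_ne h, hP'.pos u hu]
    · intro u hu
      have key : u = (⟨i, hi⟩, ⟨j, hj⟩) → s'.realArr 1 (s'.nat 17) = H.h u := by
        rintro rfl
        rw [eA, ← hidx, hf]
      rcases hnew u hu with rfl | hu
      · simp [hpos, key]
      · by_cases h : chainPos ℓ u = s'.nat 16
        · have := chainPos_injective hℓ (h.trans hpos.symm)
          simp [h, key this]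
        · simp [Function.update_of_ne h, hP'.field u hu]
    · intro t ht
      have : t ≠ s'.nat 16 := fun h => ht _ (hpos.trans h.symm)
      simp [Function.update_of_ne this, hP'.zero t ht]
  · rintro s' hF ⟨-, -, hP'⟩
    have key : ∀ u : Site a b, (u.2 : ℕ) < j + 1 → (u.2 : ℕ) < j ∨ (u.2 : ℕ) = j ∧ (u.1 : ℕ) < a :=
      fun u hu => by have := u.1.2; omega
    exact ⟨fun u hu => hP'.pos u (key u hu), fun u hu => hP'.field u (key u hu), hP'.zero⟩

theorem div_mod_succ {ℓ j : ℕ} (hℓ : 0 < ℓ) :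
    (j % ℓ + 1 = ℓ → (j + 1) / ℓ = j / ℓ + 1 ∧ (j + 1) % ℓ = 0) ∧
    (j % ℓ + 1 ≠ ℓ → (j + 1) / ℓ = j / ℓ ∧ (j + 1) % ℓ = j % ℓ + 1) := by
  have h1 : j % ℓ < ℓ := Nat.mod_lt _ hℓ
  have h2 : j + 1 = (j % ℓ + 1) + ℓ * (j / ℓ) := by
    have := Nat.mod_add_div j ℓ; omega
  constructor <;> intro h
  · have h3 : j + 1 = 0 + ℓ * (j / ℓ + 1) := by rw [h2, h]; ring
    constructor
    · rw [h3, Nat.add_mul_div_left _ _ hℓ]; simp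
    · rw [h3, Nat.add_mul_mod_self_left]; simp
  · have h3 : j % ℓ + 1 < ℓ := by omega
    constructor
    · rw [h2, Nat.add_mul_div_left _ _ hℓ, Nat.div_eq_of_lt h3, zero_add]
    · rw [h2, Nat.add_mul_mod_self_left, Nat.mod_eq_of_lt h3]

theorem runs_place {H : Ising a b} {s : Mem} {ℓ : ℕ} (hℓ : 0 < ℓ) (ha : s.nat 0 = a)
    (hb : s.nat 1 = b) (h8 : s.nat 8 = ℓ) (h9 : s.nat 9 = a * ℓ)
    (hf : ∀ u : Site a b, s.realArr 1 u.idx = H.h u) (hz : ∀ t, s.realArr 8 t = 0) :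
    Runs Prog.place s (1 + (1 + ((b * ((1 + (1 + (a * (4 + 2) + 2)) + 5) + 2) + 2) + 1)))
      (fun s' => (∀ u : Site a b, s'.natArr 8 u.idx = chainPos ℓ u) ∧
        (∀ t, s'.realArr 8 t = chainField H ℓ t) ∧ s'.nat 10 = (b / ℓ + 1) * (a * ℓ)) := by
  refine Runs.seq (Runs.of_run (P := .setNat 13 _) rfl (Runs.seq
    (Runs.of_run (P := .setNat 14 _) rfl (Runs.seq
    (Runs.for_loop (T := (1 + (1 + (a * (4 + 2) + 2)) + 5)) (fun j s' =>
      s'.nat 13 = j / ℓ * (a * ℓ) ∧ s'.nat 14 = j % ℓ ∧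
      Placed H ℓ (fun u => (u.2 : ℕ) < j) s') rfl ?_ ?_ ?_ ?_)))))
  · intro s' hF
    simpa [NExpr.eval, hF.nat 1 rfl, Prog.run] using hb
  · simp only [Prog.run, NExpr.eval]
    refine ⟨by simp, by simp, ?_⟩
    exact ⟨fun u hu => by simp at hu, fun u hu => by simp at hu, fun t _ => hz t⟩
  · rintro j s' hj hF hi ⟨h13, h14, hP⟩
    have e8 : s'.nat 8 = ℓ := by rw [hF.nat 8 rfl]; simp [Prog.run, h8]
    have e0 : s'.nat 0 = a := by rw [hF.nat 0 rfl]; simp [Prog.run, ha]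
    have e1 : s'.nat 1 = b := by rw [hF.nat 1 rfl]; simp [Prog.run, hb]
    have e9 : s'.nat 9 = a * ℓ := by rw [hF.nat 9 rfl]; simp [Prog.run, h9]
    have eA : s'.realArr 1 = s.realArr 1 := by rw [hF.realArr 1 rfl]; simp [Prog.run]
    refine Runs.seq_frame (runs_placeColumn hℓ e0 e1 e8 (by rw [eA]; exact hf) hj hi h13 h14 hP)
      ?_
    intro s'' hF'' hP''
    have e8' : s''.nat 8 = ℓ := by rw [hF''.nat 8 rfl, e8]
    have e9' : s''.nat 9 = a * ℓ := by rw [hF''.nat 9 rfl, e9]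
    have e13' : s''.nat 13 = j / ℓ * (a * ℓ) := by rw [hF''.nat 13 rfl, h13]
    have e14' : s''.nat 14 = j % ℓ := by rw [hF''.nat 14 rfl, h14]
    refine (Runs.of_run (P := .seq _ (.cond _ (.seq _ _) _)) rfl ?_).mono
      (T := _) (by simp [Prog.cost]) fun _ _ h => h
    have hdm := div_mod_succ (j := j) hℓ
    by_cases hm : j % ℓ + 1 = ℓ
    · simp only [Prog.run, NExpr.eval, Test.Holds, Function.update_self, e14', hm,
        Function.update_of_ne (show (8 : ℕ) ≠ 14 by decide), e8', if_true]
      refine ⟨?_, ?_, ?_⟩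
      · simp [(hdm.1 hm).1, e13', e9', Nat.add_mul]
      · simp [(hdm.1 hm).2]
      · exact ⟨hP''.pos, hP''.field, hP''.zero⟩
    · simp only [Prog.run, NExpr.eval, Test.Holds, Function.update_self, e14', hm,
        Function.update_of_ne (show (8 : ℕ) ≠ 14 by decide), e8', if_false]
      refine ⟨?_, ?_, ?_⟩
      · simp [(hdm.2 hm).1, e13']
      · simp [(hdm.2 hm).2]
      · exact ⟨hP''.pos, hP''.field, hP''.zero⟩
  · rintro s' hF ⟨h13, -, hP⟩
    have e9 : s'.nat 9 = a * ℓ := by rw [hF.nat 9 rfl]; simp [Prog.run, h9]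
    refine Runs.of_run (P := .setNat 10 _) rfl ?_
    simp only [Prog.run, NExpr.eval]
    refine ⟨fun u => hP.pos u u.2.2, fun t => ?_, ?_⟩
    · by_cases ht : ∃ u : Site a b, chainPos ℓ u = t
      · obtain ⟨u, rfl⟩ := ht
        rw [hP.field u u.2.2, chainField, Finset.sum_eq_single_of_mem u (Finset.mem_univ _)]
        · simp
        · exact fun v _ hv => if_neg fun h => hv (chainPos_injective hℓ h)
      · simp only [not_exists] at ht
        rw [hP.zero t ht, chainField, Finset.sum_eq_zero]
        exact fun u _ => if_neg (ht u)
    · simp [h13, e9]; ring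

namespace Prog

/-- The table of row addresses `t (W + 1)`. -/
def rows : Prog :=
  setNat 27 (.const 0) ;;
  forTo 23 (.var 10)
    (setNatArr 9 (.var 23) (.var 27) ;;
     setNat 27 (.add (.var 27) (.add (.var 11) (.const 1))))

/-- Enters the couplings of range at most `W` into the table of couplings. -/
def couple : Prog :=
  forTo 18 (.var 2)
    (setNat 16 (.arr 8 (.arr 0 (.var 18))) ;;
     setNat 17 (.arr 8 (.arr 1 (.var 18))) ;;
     setNat 19 (.add (.var 16) (.sub (.var 17) (.var 16))) ;;
     setNat 20 (.add (.sub (.var 16) (.var 17)) (.sub (.var 17) (.var 16))) ;;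
     cond (.natLe (.var 20) (.var 11))
       (setNat 21 (.add (.arr 9 (.var 19)) (.var 20)) ;;
        setRealArr 9 (.var 21) (.add (.arr 9 (.var 21)) (.arr 0 (.var 18)))) skip)

/-- The power `2 ^ (W - 1)`. -/
def half : Prog :=
  setNat 22 (.const 1) ;;
  forTo 24 (.sub (.var 11) (.const 1)) (setNat 22 (.add (.var 22) (.var 22)))

end Prog

theorem runs_rows {s : Mem} {N W : ℕ} (hN : s.nat 10 = N) (hW : s.nat 11 = W) :
    Runs Prog.rows s (1 + (N * (2 + 2) + 2))
      (fun s' => ∀ t < N, s'.natArr 9 t = t * (W + 1)) := by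
  refine Runs.seq (Runs.of_run (P := .setNat 27 _) rfl
    (Runs.for_loop (T := 2) (N := N) (fun j s' => s'.nat 27 = j * (W + 1) ∧
      ∀ t < j, s'.natArr 9 t = t * (W + 1)) rfl ?_ ?_ ?_ ?_))
  · intro s' hF
    simpa [NExpr.eval, hF.nat 10 rfl, Prog.run] using hN
  · simp [Prog.run, NExpr.eval]
  · rintro j s' hj hF hi ⟨h27, h⟩
    have e11 : s'.nat 11 = W := by rw [hF.nat 11 rfl]; simp [Prog.run, hW]
    refine Runs.of_run (P := .seq _ _) rfl ?_
    simp only [Prog.run, NExpr.eval]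
    refine ⟨by simp [h27, e11]; ring, fun t ht => ?_⟩
    by_cases htj : t = j
    · simp [htj, hi, h27]
    · simp [hi, Function.update_of_ne htj, h t (by omega)]
  · exact fun s' _ h => h.2

theorem couplingTable_append (H : Ising a b) (ℓ W : ℕ) (l l' : List (Site a b × Site a b))
    (i : ℕ) : couplingTable H ℓ W (l ++ l') i =
      couplingTable H ℓ W l i + couplingTable H ℓ W l' i := by
  simp [couplingTable]

theorem runs_couple {H : Ising a b} {s : Mem} {ℓ W : ℕ} (hℓ : 0 < ℓ)
    {l : List (Site a b × Site a b)}
    (h2 : s.nat 2 = l.length)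
    (hl : ∀ (i : ℕ) (hi : i < l.length),
      s.natArr 0 i = (l[i]).1.idx ∧ s.natArr 1 i = (l[i]).2.idx ∧
      s.realArr 0 i = H.J s((l[i]).1, (l[i]).2))
    (hW : s.nat 11 = W) (hpos : ∀ u : Site a b, s.natArr 8 u.idx = chainPos ℓ u)
    (hrow : ∀ t < (b / ℓ + 1) * (a * ℓ), s.natArr 9 t = t * (W + 1))
    (hz : ∀ i, s.realArr 9 i = 0) :
    Runs Prog.couple s (l.length * (8 + 2) + 2)
      (fun s' => ∀ i, s'.realArr 9 i = couplingTable H ℓ W l i) := by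
  refine Runs.for_loop (T := 8) (N := l.length)
    (fun j s' => ∀ i, s'.realArr 9 i = couplingTable H ℓ W (l.take j) i) rfl ?_ ?_ ?_ ?_
  · intro s' hF
    simpa [NExpr.eval, hF.nat 2 rfl] using h2
  · simpa [couplingTable] using hz
  · intro j s' hj hF hi hI
    have e11 : s'.nat 11 = W := by rw [hF.nat 11 rfl, hW]
    obtain ⟨l0, l1, l2⟩ := hl j hj
    rw [← hF.natArr 0 rfl] at l0
    rw [← hF.natArr 1 rfl] at l1
    rw [← hF.realArr 0 rfl] at l2
    have hp0 : s'.natArr 8 (s'.natArr 0 j) = chainPos ℓ (l[j]).1 := by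
      rw [l0, hF.natArr 8 rfl, hpos]
    have hp1 : s'.natArr 8 (s'.natArr 1 j) = chainPos ℓ (l[j]).2 := by
      rw [l1, hF.natArr 8 rfl, hpos]
    have hlate : latePos ℓ l[j] < (b / ℓ + 1) * (a * ℓ) := by
      have h1 := chainPos_lt hℓ (l[j]).1
      have h2 := chainPos_lt hℓ (l[j]).2
      simp only [latePos]
      omega
    have hr : s'.natArr 9 (latePos ℓ l[j]) = latePos ℓ l[j] * (W + 1) := by
      rw [hF.natArr 9 rfl, hrow _ hlate]
    have htake : ∀ i, couplingTable H ℓ W (l.take (j + 1)) i =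
        couplingTable H ℓ W (l.take j) i +
        (if Nat.dist (chainPos ℓ (l[j]).1) (chainPos ℓ (l[j]).2) ≤ W ∧
          latePos ℓ l[j] * (W + 1) + Nat.dist (chainPos ℓ (l[j]).1) (chainPos ℓ (l[j]).2) = i
          then H.J s((l[j]).1, (l[j]).2) else 0) := by
      intro i
      rw [List.take_add_one, List.getElem?_eq_getElem hj, couplingTable_append]
      simp [couplingTable]
    refine (Runs.of_run (P := .seq _ (.seq _ (.seq _ (.seq _ (.cond _ (.seq _ _) _))))) rfl
      ?_).mono (by simp [Prog.cost]) fun _ _ h => h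
    intro i
    rw [htake]
    simp only [latePos] at hr ⊢
    simp only [Nat.dist] at *
    by_cases hd : chainPos ℓ (l[j]).1 - chainPos ℓ (l[j]).2 +
        (chainPos ℓ (l[j]).2 - chainPos ℓ (l[j]).1) ≤ W
    · simp only [Prog.run, NExpr.eval, RExpr.eval, Test.Holds, Function.update_apply]
      simp [hi, hp0, hp1, e11, hd, hr, Function.update_apply, l2, ← hI]
      split_ifs with h1 h2 h2
      · rw [h1]
      · exact absurd h1.symm h2
      · exact absurd h2.symm h1
      · exact (add_zero _).symm
    · simp only [Prog.run, NExpr.eval, RExpr.eval, Test.Holds, Function.update_apply]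
      simp [hi, hp0, hp1, e11, hd, hI]
  · intro s' _ h
    simpa using h

theorem runs_half {s : Mem} {w : ℕ} (hW : s.nat 11 = w + 1) :
    Runs Prog.half s (1 + (w * (1 + 2) + 2)) (fun s' => s'.nat 22 = 2 ^ w) := by
  refine Runs.seq (Runs.of_run (P := .setNat 22 _) rfl
    (Runs.for_loop (T := 1) (N := w) (fun j s' => s'.nat 22 = 2 ^ j) rfl ?_ ?_ ?_ ?_))
  · intro s' hF
    simp [NExpr.eval, hF.nat 11 rfl, Prog.run, hW]
  · simp [Prog.run, NExpr.eval]
  · intro j s' hj hF hi h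
    refine Runs.of_run (P := .setNat 22 _) rfl ?_
    simp [Prog.run, NExpr.eval, h, pow_succ]; ring
  · exact fun s' _ h => h

namespace Prog

/-- `A x ↦ A (x + 2 ^ d) := A x - g`, `A x := A x + g` for all `x < 2 ^ d`. -/
def split : Prog :=
  forTo 26 (.var 25)
    (setRealArr 10 (.add (.var 26) (.var 25)) (.sub (.arr 10 (.var 26)) (.var 10)) ;;
     setRealArr 10 (.var 26) (.add (.arr 10 (.var 26)) (.var 10)))

/-- Tabulates the local field at the spin `t` (register `23`) for all configurations of the
preceding `W` spins. -/
def localFields : Prog :=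
  setRealArr 10 (.const 0) (.arr 8 (.var 23)) ;;
  setNat 25 (.const 1) ;;
  forTo 24 (.var 11)
    (setReal 10 (.arr 9 (.add (.add (.var 27) (.var 24)) (.const 1))) ;;
     split ;;
     setNat 25 (.add (.var 25) (.var 25)))

/-- `F z ± A z` and `F (z + 2 ^ w) ± A (z + 2 ^ w)` are compared. -/
def transition : Prog :=
  forTo 26 (.var 22)
    (setNat 28 (.add (.var 26) (.var 22)) ;;
     cond (.realLe (.add (.arr 11 (.var 26)) (.arr 10 (.var 26)))
        (.add (.arr 11 (.var 28)) (.arr 10 (.var 28))))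
       (setRealArr 12 (.add (.var 26) (.var 26)) (.add (.arr 11 (.var 26)) (.arr 10 (.var 26))))
       (setRealArr 12 (.add (.var 26) (.var 26)) (.add (.arr 11 (.var 28)) (.arr 10 (.var 28)))) ;;
     cond (.realLe (.sub (.arr 11 (.var 26)) (.arr 10 (.var 26)))
        (.sub (.arr 11 (.var 28)) (.arr 10 (.var 28))))
       (setRealArr 12 (.add (.add (.var 26) (.var 26)) (.const 1))
         (.sub (.arr 11 (.var 26)) (.arr 10 (.var 26))))
       (setRealArr 12 (.add (.add (.var 26) (.var 26)) (.const 1))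
         (.sub (.arr 11 (.var 28)) (.arr 10 (.var 28)))))

/-- Copies the new table of values over the old one. -/
def copy : Prog :=
  forTo 26 (.add (.var 22) (.var 22)) (setRealArr 11 (.var 26) (.arr 12 (.var 26)))

/-- The recursion over the spins of the chain. -/
def recursion : Prog :=
  setNat 27 (.const 0) ;;
  forTo 23 (.var 10)
    (localFields ;; transition ;; copy ;;
     setNat 27 (.add (.var 27) (.add (.var 11) (.const 1))))

/-- The least entry of the final table. -/
def minimum : Prog :=
  setReal 9 (.arr 11 (.const 0)) ;;
  forTo 26 (.add (.var 22) (.var 22))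
    (cond (.realLe (.arr 11 (.var 26)) (.var 9)) (setReal 9 (.arr 11 (.var 26))) skip) ;;
  setReal 0 (.var 9)

end Prog

theorem runs_split {s : Mem} {f : ℝ} {g : ℕ → ℝ} {d : ℕ} (h25 : s.nat 25 = 2 ^ d)
    (h10 : s.real 10 = g (d + 1)) (hA : ∀ x < 2 ^ d, s.realArr 10 x = localField f g d x) :
    Runs Prog.split s (2 ^ d * (2 + 2) + 2)
      (fun s' => ∀ x < 2 ^ (d + 1), s'.realArr 10 x = localField f g (d + 1) x) := by
  refine Runs.for_loop (T := 2) (N := 2 ^ d) (fun j s' =>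
    ∀ x < 2 ^ d, (x < j → s'.realArr 10 x = localField f g (d + 1) x ∧
      s'.realArr 10 (x + 2 ^ d) = localField f g (d + 1) (x + 2 ^ d)) ∧
      (j ≤ x → s'.realArr 10 x = localField f g d x)) rfl ?_ ?_ ?_ ?_
  · intro s' hF
    simpa [NExpr.eval, hF.nat 25 rfl] using h25
  · exact fun x hx => ⟨fun h => by simp at h, fun _ => hA x hx⟩
  · intro j s' hj hF hi h
    have e25 : s'.nat 25 = 2 ^ d := by rw [hF.nat 25 rfl, h25]
    have e10 : s'.real 10 = g (d + 1) := by rw [hF.real 10 rfl, h10]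
    refine Runs.of_run (P := .seq _ _) rfl ?_
    simp only [Prog.run, NExpr.eval, RExpr.eval, hi, e25, e10, Function.update_self,
      Function.update_apply]
    intro x hx
    have hpos := Nat.two_pow_pos d
    have n1 : x + 2 ^ d ≠ j := by omega
    have n2 : j ≠ j + 2 ^ d := by omega
    have n3 : x ≠ j + 2 ^ d := by omega
    simp only [n1, n2, n3, if_false, Nat.add_right_cancel_iff]
    have hxj := h x hx
    by_cases hx' : x = j
    · subst hx'
      refine ⟨fun _ => ?_, fun h => by omega⟩
      have hh := hxj.2 le_rfl
      simp [localField, hx, hh]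
    · simp only [hx', if_false]
      exact ⟨fun h => hxj.1 (by omega), fun h => hxj.2 (by omega)⟩
  · intro s' _ h x hx
    rw [pow_succ] at hx
    by_cases hx' : x < 2 ^ d
    · exact ((h x hx').1 hx').1
    · have := ((h (x - 2 ^ d) (by omega)).1 (by omega)).2
      rwa [Nat.sub_add_cancel (by omega)] at this

theorem runs_localFields {s : Mem} {f : ℝ} {g : ℕ → ℝ} {t W R : ℕ} (h23 : s.nat 23 = t)
    (h11 : s.nat 11 = W) (h27 : s.nat 27 = R) (hf : s.realArr 8 t = f)
    (hg : ∀ d < W, s.realArr 9 (R + (d + 1)) = g (d + 1)) :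
    Runs Prog.localFields s (1 + (1 + (W * ((1 + ((2 ^ W * (2 + 2) + 2) + 1)) + 2) + 2)))
      (fun s' => ∀ x < 2 ^ W, s'.realArr 10 x = localField f g W x) := by
  refine Runs.seq (Runs.of_run (P := .setRealArr 10 _ _) rfl (Runs.seq
    (Runs.of_run (P := .setNat 25 _) rfl
    (Runs.for_loop (T := 1 + ((2 ^ W * (2 + 2) + 2) + 1)) (N := W) (fun d s' =>
      s'.nat 25 = 2 ^ d ∧ ∀ x < 2 ^ d, s'.realArr 10 x = localField f g d x) rfl ?_ ?_ ?_ ?_))))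
  · intro s' hF
    simp [NExpr.eval, hF.nat 11 rfl, Prog.run, h11]
  · simp [Prog.run, NExpr.eval, RExpr.eval, localField, h23, hf]
  · rintro d s' hd hF hi ⟨h25, hA⟩
    have e9 : s'.realArr 9 = s.realArr 9 := by rw [hF.realArr 9 rfl]; simp [Prog.run]
    have e27 : s'.nat 27 = R := by rw [hF.nat 27 rfl]; simp [Prog.run, h27]
    refine Runs.seq (Runs.of_run (P := .setReal 10 _) rfl ?_)
    have hle : 2 ^ d * (2 + 2) + 2 ≤ 2 ^ W * (2 + 2) + 2 := by
      have := Nat.pow_le_pow_right (show 0 < 2 by norm_num) hd.le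
      omega
    refine Runs.seq_frame ((runs_split (f := f) (g := g) (d := d) ?_ ?_ ?_).mono hle
      fun _ _ h => h) ?_
    · simpa [Prog.run] using h25
    · simp [Prog.run, RExpr.eval, NExpr.eval, hi, e27, e9, add_assoc, hg d hd]
    · simpa [Prog.run] using hA
    · intro s'' hF'' h
      have e25 : s''.nat 25 = 2 ^ d := by rw [hF''.nat 25 rfl]; simp [Prog.run, h25]
      refine Runs.of_run (P := .setNat 25 _) rfl ?_
      refine ⟨?_, ?_⟩
      · simp [Prog.run, NExpr.eval, e25, pow_succ]; ring
      · simpa [Prog.run] using h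
  · exact fun s' _ h => h.2

theorem runs_transition {s : Mem} {f : ℕ → ℝ} {g : ℕ → ℕ → ℝ} {w t : ℕ} (h22 : s.nat 22 = 2 ^ w)
    (hA : ∀ x < 2 ^ (w + 1), s.realArr 10 x = localField (f t) (g t) (w + 1) x)
    (hF : ∀ x < 2 ^ (w + 1), s.realArr 11 x = chainValue f g w t x) :
    Runs Prog.transition s (2 ^ w * (7 + 2) + 2)
      (fun s' => ∀ x < 2 ^ (w + 1), s'.realArr 12 x = chainValue f g w (t + 1) x) := by
  refine Runs.for_loop (T := 7) (N := 2 ^ w) (fun j s' =>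
    ∀ x < 2 * j, s'.realArr 12 x = chainValue f g w (t + 1) x) rfl ?_ ?_ ?_ ?_
  · intro s' hF'
    simpa [NExpr.eval, hF'.nat 22 rfl] using h22
  · simp
  · intro z s' hz hF' hi h
    have e22 : s'.nat 22 = 2 ^ w := by rw [hF'.nat 22 rfl, h22]
    have hz1 : z < 2 ^ (w + 1) := by rw [pow_succ]; omega
    have hz2 : z + 2 ^ w < 2 ^ (w + 1) := by rw [pow_succ]; omega
    have a1 := hA z hz1
    have a2 := hA _ hz2
    have f1 := hF z hz1
    have f2 := hF _ hz2
    rw [← hF'.realArr 10 rfl] at a1 a2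
    rw [← hF'.realArr 11 rfl] at f1 f2
    have v0 := chainValue_succ_code f g w t z false
    have v1 := chainValue_succ_code f g w t z true
    simp only [Bool.toNat_false, Bool.toNat_true, sgn, ← a1, ← a2, ← f1, ← f2, add_zero, one_mul,
      if_true, Bool.false_eq_true, if_false, neg_one_mul, ← sub_eq_add_neg] at v0 v1
    refine (Runs.of_run (P := .seq _ (.seq (.cond _ _ _) (.cond _ _ _))) rfl
      (Q := fun s'' => (∀ x < 2 * z, s''.realArr 12 x = s'.realArr 12 x) ∧
        s''.realArr 12 (2 * z) = chainValue f g w (t + 1) (2 * z) ∧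
        s''.realArr 12 (2 * z + 1) = chainValue f g w (t + 1) (2 * z + 1)) ?_).mono
      (by simp [Prog.cost]) ?_
    · rw [v0, v1]
      have n0 : ∀ x < z + z, x ≠ z + z := fun x hx => by omega
      have n1 : ∀ x < z + z, x ≠ z + z + 1 := fun x hx => by omega
      have n2 : 2 * z = z + z := by omega
      have n3 : z + z ≠ z + z + 1 := by omega
      generalize q1 : s'.realArr 11 z = F0
      generalize q2 : s'.realArr 11 (z + 2 ^ w) = F1
      generalize q3 : s'.realArr 10 z = A0
      generalize q4 : s'.realArr 10 (z + 2 ^ w) = A1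
      by_cases h1 : F0 + A0 ≤ F1 + A1 <;> by_cases h2 : F0 - A0 ≤ F1 - A1 <;>
      · simp only [Prog.run, NExpr.eval, RExpr.eval, Test.Holds, hi, e22, Function.update_self,
          Function.update_of_ne (show (26 : ℕ) ≠ 28 by decide),
          Function.update_of_ne (show (11 : ℕ) ≠ 12 by decide),
          Function.update_of_ne (show (10 : ℕ) ≠ 12 by decide), q1, q2, q3, q4, h1, h2, if_true,
          if_false, min_def, n2, Function.update_of_ne n3, and_true]
        intro x hx
        rw [Function.update_of_ne (n1 x hx), Function.update_of_ne (n0 x hx)]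
    · rintro s'' - ⟨h1, h2, h3⟩ x hx
      show s''.realArr 12 x = _
      rcases (by omega : x < 2 * z ∨ x = 2 * z ∨ x = 2 * z + 1) with h' | rfl | rfl
      · rw [h1 x h', h x h']
      · exact h2
      · exact h3
  · intro s' _ h x hx
    exact h x (by rw [pow_succ] at hx; omega)

theorem runs_copy {s : Mem} {n : ℕ} {F : ℕ → ℝ} (h22 : s.nat 22 + s.nat 22 = n)
    (hF : ∀ x < n, s.realArr 12 x = F x) :
    Runs Prog.copy s (n * (1 + 2) + 2) (fun s' => ∀ x < n, s'.realArr 11 x = F x) := by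
  refine Runs.for_loop (T := 1) (N := n) (fun j s' => ∀ x < j, s'.realArr 11 x = F x) rfl ?_ ?_ ?_
    (fun _ _ h => h)
  · intro s' hF'
    simpa [NExpr.eval, hF'.nat 22 rfl] using h22
  · simp
  · intro j s' hj hF' hi h
    refine Runs.of_run (P := .setRealArr 11 _ _) rfl ?_
    intro x hx
    have := hF j hj
    rw [← hF'.realArr 12 rfl] at this
    by_cases hxj : x = j
    · simp [Prog.run, NExpr.eval, RExpr.eval, hi, hxj, this]
    · simp [Prog.run, NExpr.eval, RExpr.eval, hi, hxj, h x (by omega)]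

theorem runs_recursion {s : Mem} {f : ℕ → ℝ} {G : ℕ → ℝ} {w N : ℕ} (h22 : s.nat 22 = 2 ^ w)
    (h11 : s.nat 11 = w + 1) (h10 : s.nat 10 = N) (hf : ∀ t, s.realArr 8 t = f t)
    (hG : ∀ i, s.realArr 9 i = G i) (hz : ∀ i, s.realArr 11 i = 0) :
    Runs Prog.recursion s (1 + (N * (20 * (w + 1) * 2 ^ (w + 1)) + 2))
      (fun s' => ∀ x < 2 ^ (w + 1), s'.realArr 11 x =
        chainValue f (fun t d => G (t * (w + 1 + 1) + d)) w N x) := by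
  set g : ℕ → ℕ → ℝ := fun t d => G (t * (w + 1 + 1) + d)
  have hpw := Nat.two_pow_pos w
  refine Runs.mono (T := _ + _) (Runs.seq (Runs.of_run (P := .setNat 27 _) rfl
    (Runs.for_loop (T := 20 * (w + 1) * 2 ^ (w + 1) - 2) (N := N) (fun t s' =>
      s'.nat 27 = t * (w + 1 + 1) ∧
      ∀ x < 2 ^ (w + 1), s'.realArr 11 x = chainValue f g w t x) rfl ?_ ?_ ?_
      fun _ _ h => h.2))) ?_ fun _ _ h => h
  · intro s' hF
    simp [NExpr.eval, hF.nat 10 rfl, Prog.run, h10]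
  · simp [Prog.run, NExpr.eval, chainValue, hz]
  · rintro t s' ht hF hi ⟨h27, hV⟩
    have e22 : s'.nat 22 = 2 ^ w := by rw [hF.nat 22 rfl]; simp [Prog.run, h22]
    have e11 : s'.nat 11 = w + 1 := by rw [hF.nat 11 rfl]; simp [Prog.run, h11]
    have ef : s'.realArr 8 t = f t := by rw [hF.realArr 8 rfl]; simp [Prog.run, hf]
    have eG : ∀ d < w + 1, s'.realArr 9 (t * (w + 1 + 1) + (d + 1)) = g t (d + 1) := by
      intro d _
      rw [hF.realArr 9 rfl]; simp [Prog.run, hG, g]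
    refine Runs.mono (T := (1 + (1 + ((w + 1) * ((1 + ((2 ^ (w + 1) * (2 + 2) + 2) + 1)) + 2) + 2)))
        + ((2 ^ w * (7 + 2) + 2) + ((2 ^ (w + 1) * (1 + 2) + 2) + 1)))
      (Runs.seq_frame (runs_localFields hi e11 h27 ef eG) ?_) ?_ fun _ _ h => h
    · intro s1 hF1 hA
      have e1 : ∀ x < 2 ^ (w + 1), s1.realArr 11 x = chainValue f g w t x := by
        rw [hF1.realArr 11 rfl]; exact hV
      have e22' : s1.nat 22 = 2 ^ w := by rw [hF1.nat 22 rfl, e22]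
      refine Runs.seq_frame (runs_transition e22' hA e1) ?_
      intro s2 hF2 h2
      have e22'' : s2.nat 22 + s2.nat 22 = 2 ^ (w + 1) := by
        rw [hF2.nat 22 rfl, e22', pow_succ]; ring
      refine Runs.seq_frame (runs_copy e22'' h2) ?_
      intro s3 hF3 h3
      have e27 : s3.nat 27 = t * (w + 1 + 1) := by
        rw [hF3.nat 27 rfl, hF2.nat 27 rfl, hF1.nat 27 rfl, h27]
      have e11' : s3.nat 11 = w + 1 := by
        rw [hF3.nat 11 rfl, hF2.nat 11 rfl, hF1.nat 11 rfl, e11]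
      refine Runs.of_run (P := .setNat 27 _) rfl ?_
      refine ⟨?_, ?_⟩
      · simp [Prog.run, NExpr.eval, e27, e11']; ring
      · simpa [Prog.run] using h3
    · rw [pow_succ]
      refine Nat.le_sub_of_add_le ?_
      nlinarith
  · have : 2 ≤ 20 * (w + 1) * 2 ^ (w + 1) := by rw [pow_succ]; nlinarith
    rw [Nat.sub_add_cancel this]
    exact le_rfl

theorem runs_minimum {s : Mem} {n : ℕ} {F : ℕ → ℝ} (hn : 0 < n) (h22 : s.nat 22 + s.nat 22 = n)
    (hF : ∀ x < n, s.realArr 11 x = F x) :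
    Runs Prog.minimum s (1 + ((n * (3 + 2) + 2) + 1))
      (fun s' => (∀ x < n, s'.real 0 ≤ F x) ∧ ∃ x < n, s'.real 0 = F x) := by
  refine Runs.seq (Runs.of_run (P := .setReal 9 _) rfl (Runs.seq
    (Runs.for_loop (T := 3) (N := n) (fun j s' => (∀ x < j, s'.real 9 ≤ F x) ∧
      ∃ x < n, s'.real 9 = F x) rfl ?_ ?_ ?_ ?_)))
  · intro s' hF'
    simpa [NExpr.eval, hF'.nat 22 rfl, Prog.run] using h22
  · exact ⟨by simp, 0, hn, by simp [Prog.run, RExpr.eval, NExpr.eval, hF 0 hn]⟩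
  · rintro j s' hj hF' hi ⟨h1, x, hx, h2⟩
    have e11 : s'.realArr 11 j = F j := by rw [hF'.realArr 11 rfl]; simp [Prog.run, hF j hj]
    refine (Runs.of_run (P := .cond _ (.setReal 9 _) .skip) rfl ?_).mono (by simp [Prog.cost])
      fun _ _ h => h
    simp only [Prog.run, NExpr.eval, RExpr.eval, Test.Holds, hi, e11]
    split_ifs with h
    · refine ⟨fun y hy => ?_, j, hj, by simp⟩
      simp only [Function.update_self]
      by_cases hyj : y = j
      · rw [hyj]
      · exact h.trans (h1 y (by omega))
    · refine ⟨fun y hy => ?_, x, hx, h2⟩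
      by_cases hyj : y = j
      · rw [hyj]; exact (not_le.1 h).le
      · exact h1 y (by omega)
  · rintro s' - ⟨h1, h2⟩
    refine Runs.of_run (P := .setReal 0 _) rfl ?_
    simpa [Prog.run, RExpr.eval] using ⟨h1, h2⟩

/-- The whole program of the low-overhead case, for interactions of range `r`. -/
def Prog.groundEnergy (C r : ℕ) : Prog :=
  width C ;; dims r ;; place ;; rows ;; couple ;; half ;; recursion ;; minimum

theorem runs_groundEnergy {H : Ising a b} {s : Mem} {Δ r C : ℕ} {J ε : ℝ} (hε : 0 < ε)
    (hs : s.HoldsIsing H ε) (hΔ : ∀ u, (H.graph.neighborSet u).ncard ≤ Δ) (hJ0 : 0 ≤ J)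
    (hJ : ∀ e ∈ H.graph.edgeSet, |H.J e| ≤ J) (hr : ∀ u v, H.graph.Adj u v → u.dist v ≤ r)
    (hC : (Δ * r : ℕ) * J ≤ C) (ha : 0 < a) (hb : 0 < b) :
    Runs (Prog.groundEnergy C r) s
      ((120 + 10 * Δ) * (a * b) * 2 ^ (3 * ((r + 1) * (⌈C / ε⌉₊ + 1))))
      (fun s' => |s'.real 0 - H.groundEnergy| ≤ ε * (a * b : ℕ)) := by
  obtain ⟨l, hnd, hmem, hlen, hlist⟩ := hs.edges
  have hl : IsEdgeList H.graph l := ⟨hnd, hmem⟩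
  set L := ⌈C / ε⌉₊ + 1 with hL
  set n := a * b with hn
  have hn1 : 1 ≤ n := Nat.mul_pos ha hb
  have key : ∃ T, Runs (Prog.groundEnergy C r) s T
      (fun s' => |s'.real 0 - H.groundEnergy| ≤ ε * n) ∧
      ∃ ℓ w, 1 ≤ ℓ ∧ ℓ ≤ L ∧ w + 1 = (r + 1) * ℓ ∧
      T ≤ 2 * (L + 1) + (20 * n + 20) + ((b / ℓ + 1) * (a * ℓ) * 4 + 3) + (l.length * 10 + 2)
        + (w * 3 + 3) + ((b / ℓ + 1) * (a * ℓ) * (20 * (w + 1) * 2 ^ (w + 1)) + 3)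
        + (2 ^ (w + 1) * 5 + 4) + (3 * a + 4) := by
    obtain ⟨t1, s1, he1, ht1, hℓ1, hℓL, hCε⟩ := runs_width hε hs.prec C
    have hF1 := he1.frame
    generalize hℓ : s1.nat 8 = ℓ at hℓ1 hℓL hCε
    obtain ⟨w, hw⟩ : ∃ w, w + 1 = (r + 1) * ℓ :=
      ⟨(r + 1) * ℓ - 1, Nat.sub_add_cancel (Nat.mul_pos (Nat.succ_pos r) hℓ1)⟩
    obtain ⟨t2, s2, he2, ht2, h9, h11⟩ := runs_dims (a := a) (ℓ := ℓ)
      (by rw [hF1.nat 0 rfl]; exact hs.dims.1) hℓ r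
    have hF2 := he2.frame
    obtain ⟨t3, s3, he3, ht3, hpos, hfield, h10⟩ := runs_place (H := H) (ℓ := ℓ) (s := s2) hℓ1
      (by rw [hF2.nat 0 rfl, hF1.nat 0 rfl]; exact hs.dims.1)
      (by rw [hF2.nat 1 rfl, hF1.nat 1 rfl]; exact hs.dims.2)
      (by rw [hF2.nat 8 rfl, hℓ]) h9
      (by rw [hF2.realArr 1 rfl, hF1.realArr 1 rfl]; exact hs.fields)
      (by rw [hF2.realArr 8 rfl, hF1.realArr 8 rfl]; exact hs.fresh.realArr 8 le_rfl)
    have hF3 := he3.frame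
    have h11' : s3.nat 11 = w + 1 := by rw [hF3.nat 11 rfl, h11, hw]
    obtain ⟨t4, s4, he4, ht4, hrow⟩ := runs_rows h10 h11'
    have hF4 := he4.frame
    obtain ⟨t5, s5, he5, ht5, hcouple⟩ := runs_couple (H := H) (ℓ := ℓ) (W := w + 1) (s := s4) hℓ1
      (l := l) (by rw [hF4.nat 2 rfl, hF3.nat 2 rfl, hF2.nat 2 rfl, hF1.nat 2 rfl]; exact hlen)
      (by
        rw [hF4.natArr 0 rfl, hF3.natArr 0 rfl, hF2.natArr 0 rfl, hF1.natArr 0 rfl,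
          hF4.natArr 1 rfl, hF3.natArr 1 rfl, hF2.natArr 1 rfl, hF1.natArr 1 rfl,
          hF4.realArr 0 rfl, hF3.realArr 0 rfl, hF2.realArr 0 rfl, hF1.realArr 0 rfl]
        exact hlist)
      (by rw [hF4.nat 11 rfl, h11']) (by rw [hF4.natArr 8 rfl]; exact hpos) hrow
      (by
        rw [hF4.realArr 9 rfl, hF3.realArr 9 rfl, hF2.realArr 9 rfl, hF1.realArr 9 rfl]
        exact hs.fresh.realArr 9 (by norm_num))
    have hF5 := he5.frame
    obtain ⟨t6, s6, he6, ht6, h22⟩ := runs_half (s := s5) (w := w)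
      (by rw [hF5.nat 11 rfl, hF4.nat 11 rfl, h11'])
    have hF6 := he6.frame
    obtain ⟨t7, s7, he7, ht7, hV⟩ := runs_recursion (s := s6) (f := chainField H ℓ)
      (G := couplingTable H ℓ (w + 1) l) h22
      (by rw [hF6.nat 11 rfl, hF5.nat 11 rfl, hF4.nat 11 rfl, h11'])
      (by rw [hF6.nat 10 rfl, hF5.nat 10 rfl, hF4.nat 10 rfl, h10])
      (by rw [hF6.realArr 8 rfl, hF5.realArr 8 rfl, hF4.realArr 8 rfl]; exact hfield)
      (by rw [hF6.realArr 9 rfl]; exact hcouple)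
      (by
        rw [hF6.realArr 11 rfl, hF5.realArr 11 rfl, hF4.realArr 11 rfl, hF3.realArr 11 rfl,
          hF2.realArr 11 rfl, hF1.realArr 11 rfl]
        exact hs.fresh.realArr 11 (by norm_num))
    have hF7 := he7.frame
    obtain ⟨t8, s8, he8, ht8, hle, hex⟩ := runs_minimum (n := 2 ^ (w + 1)) (s := s7)
      (by positivity) (by rw [hF7.nat 22 rfl, h22, pow_succ]; ring) hV
    have hne : ∀ e ∈ l, e.1 ≠ e.2 := fun e he => (hl.adj he).ne
    have hmin := isLeast_chainEnergy _ _ _ _ hle hex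
    rw [range_chainEnergy hne hℓ1] at hmin
    have herr := fun σ => Ising.abs_energy_sub_le hl hℓ1 hΔ hJ0 hJ hr (hC.trans hCε) σ
    rw [← hw] at herr
    refine ⟨_, ⟨_, s8, he1.seq (he2.seq (he3.seq (he4.seq (he5.seq (he6.seq (he7.seq he8)))))),
      le_rfl, abs_sub_le_of_isLeast (Ising.isLeast_groundEnergy hl) hmin herr⟩, ℓ, w, hℓ1, hℓL, hw,
      ?_⟩
    have e3 : b * ((1 + (1 + (a * (4 + 2) + 2)) + 5) + 2) + 2 ≤ 17 * n + 2 := by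
      rw [hn]; nlinarith
    omega
  obtain ⟨T, hT, ℓ, w, hℓ1, hℓL, hw, hle⟩ := key
  refine hT.mono (hle.trans ?_) fun _ _ h => h
  have hlenle : l.length ≤ Δ * n := by
    have := hl.length_le hΔ (List.Sublist.refl l) Finset.univ (by simp)
    simpa [hn] using this
  set X := 2 ^ ((r + 1) * L) with hX
  have hWX : (r + 1) * L < X := Nat.lt_two_pow_self
  have hwL : w + 1 ≤ (r + 1) * L := by rw [hw]; exact Nat.mul_le_mul_left _ hℓL
  have hpX : 2 ^ (w + 1) ≤ X := Nat.pow_le_pow_right (by norm_num) hwL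
  have hLX : L ≤ X := by nlinarith
  have hX1 : 1 ≤ X := Nat.one_le_two_pow
  have hN : (b / ℓ + 1) * (a * ℓ) ≤ n * (2 * X) := by
    calc (b / ℓ + 1) * (a * ℓ) = a * (b / ℓ * ℓ + ℓ) := by ring
      _ ≤ a * (b + ℓ) := by gcongr; exact Nat.div_mul_le_self b ℓ
      _ ≤ a * (b * (2 * X)) := by gcongr; nlinarith
      _ = n * (2 * X) := by rw [hn]; ring
  have h3 : 2 ^ (3 * ((r + 1) * L)) = X * X * X := by rw [hX]; ring
  rw [h3]
  have hXXX : X * X ≤ X * X * X := Nat.le_mul_of_pos_right _ hX1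
  have hXX : X ≤ X * X := Nat.le_mul_of_pos_right _ hX1
  have hna : a ≤ n := by rw [hn]; exact Nat.le_mul_of_pos_right _ hb
  have hnX : X * X * X ≤ n * (X * X * X) := Nat.le_mul_of_pos_left _ hn1
  have hnn : n ≤ n * (X * X * X) := Nat.le_mul_of_pos_right _ (by positivity)
  have hmain : (b / ℓ + 1) * (a * ℓ) * (20 * (w + 1) * 2 ^ (w + 1)) ≤ 40 * (n * (X * X * X)) := by
    calc _ ≤ n * (2 * X) * (20 * X * X) := by gcongr; omega
      _ = _ := by ring
  have hNX : (b / ℓ + 1) * (a * ℓ) ≤ 2 * (n * (X * X * X)) := by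
    calc _ ≤ n * (2 * X) := hN
      _ = 2 * (n * X) := by ring
      _ ≤ _ := by gcongr; omega
  have hΔn : Δ * n ≤ Δ * (n * (X * X * X)) := by gcongr
  have : (120 + 10 * Δ) * n * (X * X * X) =
      120 * (n * (X * X * X)) + 10 * (Δ * (n * (X * X * X))) := by ring
  rw [this]
  generalize n * (X * X * X) = Y at *
  generalize Δ * Y = Z at *
  omega

/-- The running time of the program for the low-overhead case is dominated by `2 ^ (1 / ε ^ 2)`. -/
theorem two_pow_le_rpow (D C : ℕ) {ε : ℝ} (hε : 0 < ε) :
    (2 : ℝ) ^ (D * (⌈C / ε⌉₊ + 1)) ≤ 2 ^ (D ^ 2 * C ^ 2 + 2 * D) * (2 : ℝ) ^ (1 / ε ^ 2) := by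
  rw [← Real.rpow_natCast, ← Real.rpow_natCast, ← Real.rpow_add (by norm_num)]
  refine Real.rpow_le_rpow_of_exponent_le (by norm_num) ?_
  have h1 : (⌈C / ε⌉₊ : ℝ) ≤ C * (1 / ε) + 1 := by
    rw [mul_one_div]
    exact (Nat.ceil_lt_add_one (by positivity)).le
  have h2 : (1 / ε ^ 2 : ℝ) = (1 / ε) ^ 2 := by simp
  rw [h2]
  push_cast
  set x := 1 / ε
  have hD : (0 : ℝ) ≤ D := Nat.cast_nonneg _
  have := mul_le_mul_of_nonneg_left h1 hD
  nlinarith [sq_nonneg (x - D * C), sq_nonneg (D * C : ℝ), sq_nonneg x]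

theorem exists_prog_groundEnergy (Δ c Λ : ℕ) (Jmin Jmax hmax : ℝ) : ∃ (P : Prog) (K : ℝ),
    ∀ (a b : ℕ) (H : Ising a b) (A : Ansatz a b), 0 < a → 0 < b →
      H.Bounded Δ Jmin Jmax hmax → A.Implements H c → A.overhead ≤ Λ →
      ∀ (ε : ℝ) (s : Mem), 0 < ε → s.HoldsIsing H ε →
        ∃ (t : ℕ) (s' : Mem), Exec P s t s' ∧
          (t : ℝ) ≤ K * (a * b : ℕ) * (2 : ℝ) ^ (1 / ε ^ 2) ∧
          |s'.real 0 - H.groundEnergy| ≤ ε * (a * b : ℕ) := by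
  set r := c + 2 * Λ
  set C := ⌈(Δ * r : ℕ) * |Jmax|⌉₊
  set D := 3 * (r + 1)
  refine ⟨Prog.groundEnergy C r, (120 + 10 * Δ : ℕ) * 2 ^ (D ^ 2 * C ^ 2 + 2 * D), ?_⟩
  intro a b H A ha hb hH hA hΛ ε s hε hs
  obtain ⟨t, s', he, ht, hq⟩ := runs_groundEnergy (J := |Jmax|) hε hs hH.degree (abs_nonneg _)
    (fun e he => (hH.coupling e he).2.trans (le_abs_self _)) (fun u v h => hA.dist_le hΛ h)
    (Nat.le_ceil _) ha hb
  refine ⟨t, s', he, ?_, hq⟩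
  have h1 : (t : ℝ) ≤ ((120 + 10 * Δ) * (a * b) * 2 ^ (D * (⌈C / ε⌉₊ + 1)) : ℕ) := by
    refine Nat.cast_le.2 (ht.trans (le_of_eq ?_))
    rw [mul_assoc 3]
  refine h1.trans ?_
  rw [Nat.cast_mul, Nat.cast_mul, Nat.cast_pow, Nat.cast_ofNat]
  calc _ ≤ ((120 + 10 * Δ : ℕ) : ℝ) * (a * b : ℕ) *
        (2 ^ (D ^ 2 * C ^ 2 + 2 * D) * (2 : ℝ) ^ (1 / ε ^ 2)) := by
        gcongr
        exact two_pow_le_rpow D C hε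
    _ = _ := by ring

/-! ### Local operators -/

theorem sum_agree_off_one (u : Site a b) (σ : Config a b) (F : Config a b → ℂ) :
    (∑ κ, open Classical in if ∀ w, w ≠ u → σ w = κ w then F κ else 0) =
      ∑ x, F (Function.update σ u x) := by
  classical
  rw [← Finset.sum_filter]
  refine Finset.sum_nbij' (fun κ => κ u) (fun x => Function.update σ u x) ?_ ?_ ?_ ?_ ?_
  · simp
  · intro x _
    simp only [Finset.mem_filter, Finset.mem_univ, true_and]
    intro w hw
    rw [Function.update_of_ne hw]
  · intro κ hκ
    simp only [Finset.mem_filter, Finset.mem_univ, true_and] at hκ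
    funext w
    by_cases hw : w = u
    · subst hw; simp
    · rw [Function.update_of_ne hw, hκ w hw]
  · simp
  · intro κ hκ
    simp only [Finset.mem_filter, Finset.mem_univ, true_and] at hκ
    congr 1
    funext w
    by_cases hw : w = u
    · subst hw; simp
    · rw [Function.update_of_ne hw, hκ w hw]

theorem sum_agree_off_two {u v : Site a b} (huv : u ≠ v) (σ : Config a b) (F : Config a b → ℂ) :
    (∑ κ, open Classical in if ∀ w, w ≠ u → w ≠ v → σ w = κ w then F κ else 0) =
      ∑ x : Fin 2 × Fin 2, F (Function.update (Function.update σ u x.1) v x.2) := by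
  classical
  have key : ∀ κ : Config a b, (∀ w, w ≠ u → w ≠ v → σ w = κ w) →
      Function.update (Function.update σ u (κ u)) v (κ v) = κ := by
    intro κ hκ
    funext w
    by_cases hw : w = v
    · subst hw; simp
    · by_cases hw' : w = u
      · subst hw'; simp [hw]
      · rw [Function.update_of_ne hw, Function.update_of_ne hw', hκ w hw' hw]
  rw [← Finset.sum_filter]
  refine Finset.sum_nbij' (fun κ => (κ u, κ v))
    (fun x => Function.update (Function.update σ u x.1) v x.2) ?_ ?_ ?_ ?_ ?_
  · simp
  · intro x _
    simp only [Finset.mem_filter, Finset.mem_univ, true_and]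
    intro w hw hw'
    rw [Function.update_of_ne hw', Function.update_of_ne hw]
  · intro κ hκ
    simp only [Finset.mem_filter, Finset.mem_univ, true_and] at hκ
    exact key κ hκ
  · intro x _
    simp [Function.update_of_ne huv]
  · intro κ hκ
    simp only [Finset.mem_filter, Finset.mem_univ, true_and] at hκ
    rw [key κ hκ]

theorem embedOne_mul_apply (u : Site a b) (A : Matrix (Fin 2) (Fin 2) ℂ) (ρ : Op a b)
    (σ τ : Config a b) :
    (embedOne u A * ρ) σ τ = ∑ x, A (σ u) x * ρ (Function.update σ u x) τ := by
  classical
  rw [Matrix.mul_apply]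
  have := sum_agree_off_one u σ fun κ => A (σ u) (κ u) * ρ κ τ
  simp only [Function.update_self] at this
  rw [← this]
  refine Finset.sum_congr rfl fun κ _ => ?_
  simp only [embedOne, Matrix.of_apply, ite_mul, zero_mul]

theorem conjTranspose_embedOne (u : Site a b) (A : Matrix (Fin 2) (Fin 2) ℂ) :
    (embedOne u A)ᴴ = embedOne u Aᴴ := by
  classical
  ext σ τ
  simp only [Matrix.conjTranspose_apply, embedOne, Matrix.of_apply]
  have : (∀ w, w ≠ u → τ w = σ w) ↔ ∀ w, w ≠ u → σ w = τ w :=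
    forall₂_congr fun w _ => eq_comm
  simp only [this]
  split_ifs <;> simp

theorem conjTranspose_embedTwo (u v : Site a b) (A : Matrix (Fin 2 × Fin 2) (Fin 2 × Fin 2) ℂ) :
    (embedTwo u v A)ᴴ = embedTwo u v Aᴴ := by
  classical
  ext σ τ
  simp only [Matrix.conjTranspose_apply, embedTwo, Matrix.of_apply]
  have : (∀ w, w ≠ u → w ≠ v → τ w = σ w) ↔ ∀ w, w ≠ u → w ≠ v → σ w = τ w :=
    forall₃_congr fun w _ _ => eq_comm
  simp only [this]
  split_ifs <;> simp

theorem mul_embedOne_apply (u : Site a b) (A : Matrix (Fin 2) (Fin 2) ℂ) (ρ : Op a b)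
    (σ τ : Config a b) :
    (ρ * embedOne u A) σ τ = ∑ x, ρ σ (Function.update τ u x) * A x (τ u) := by
  have h := embedOne_mul_apply u Aᴴ ρᴴ τ σ
  rw [← conjTranspose_embedOne, ← Matrix.conjTranspose_mul, Matrix.conjTranspose_apply] at h
  have h' := congrArg star h
  rw [star_star] at h'
  rw [h', star_sum]
  refine Finset.sum_congr rfl fun x _ => ?_
  simp [mul_comm]

theorem embedTwo_mul_apply {u v : Site a b} (huv : u ≠ v)
    (A : Matrix (Fin 2 × Fin 2) (Fin 2 × Fin 2) ℂ) (ρ : Op a b) (σ τ : Config a b) :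
    (embedTwo u v A * ρ) σ τ = ∑ x : Fin 2 × Fin 2, A (σ u, σ v) x *
      ρ (Function.update (Function.update σ u x.1) v x.2) τ := by
  classical
  rw [Matrix.mul_apply]
  have := sum_agree_off_two huv σ fun κ => A (σ u, σ v) (κ u, κ v) * ρ κ τ
  simp only [Function.update_self, Function.update_of_ne huv] at this
  rw [← this]
  refine Finset.sum_congr rfl fun κ _ => ?_
  simp only [embedTwo, Matrix.of_apply, ite_mul, zero_mul]

/-- An operator that acts as `M` on the qubits `u, v` and as `f w` on every other qubit `w`. -/
noncomputable def pairState (u v : Site a b) (M : Matrix (Fin 2 × Fin 2) (Fin 2 × Fin 2) ℂ)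
    (f : Site a b → Matrix (Fin 2) (Fin 2) ℂ) : Op a b :=
  Matrix.of fun σ τ => M (σ u, σ v) (τ u, τ v) *
    ∏ w ∈ (Finset.univ.erase u).erase v, f w (σ w) (τ w)

theorem productState_eq_pairState {u v : Site a b} (huv : u ≠ v)
    (f : Site a b → Matrix (Fin 2) (Fin 2) ℂ) :
    productState f = pairState u v (f u ⊗ₖ f v) f := by
  ext σ τ
  simp only [productState, pairState, Matrix.of_apply, Matrix.kroneckerMap_apply]
  rw [← Finset.mul_prod_erase _ _ (Finset.mem_univ u),
    ← Finset.mul_prod_erase (Finset.univ.erase u) _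
      (Finset.mem_erase.2 ⟨huv.symm, Finset.mem_univ v⟩), mul_assoc]

theorem pairState_smul (u v : Site a b) (x : ℂ) (M : Matrix (Fin 2 × Fin 2) (Fin 2 × Fin 2) ℂ)
    (f : Site a b → Matrix (Fin 2) (Fin 2) ℂ) : pairState u v (x • M) f = x • pairState u v M f := by
  ext σ τ
  simp [pairState, mul_assoc]

theorem pairState_congr {u v : Site a b} (M : Matrix (Fin 2 × Fin 2) (Fin 2 × Fin 2) ℂ)
    {f f' : Site a b → Matrix (Fin 2) (Fin 2) ℂ} (h : ∀ w, w ≠ u → w ≠ v → f w = f' w) :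
    pairState u v M f = pairState u v M f' := by
  ext σ τ
  simp only [pairState, Matrix.of_apply]
  congr 1
  refine Finset.prod_congr rfl fun w hw => ?_
  simp only [Finset.mem_erase, Finset.mem_univ, and_true] at hw
  rw [h w hw.2 hw.1]

theorem conjTranspose_pairState (u v : Site a b)
    (M : Matrix (Fin 2 × Fin 2) (Fin 2 × Fin 2) ℂ) (f : Site a b → Matrix (Fin 2) (Fin 2) ℂ) :
    (pairState u v M f)ᴴ = pairState u v Mᴴ fun w => (f w)ᴴ := by
  ext σ τ
  simp [pairState, Matrix.conjTranspose_apply, star_mul', star_prod]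

theorem embedTwo_mul_pairState {u v : Site a b} (huv : u ≠ v)
    (A M : Matrix (Fin 2 × Fin 2) (Fin 2 × Fin 2) ℂ) (f : Site a b → Matrix (Fin 2) (Fin 2) ℂ) :
    embedTwo u v A * pairState u v M f = pairState u v (A * M) f := by
  ext σ τ
  rw [embedTwo_mul_apply huv]
  simp only [pairState, Matrix.of_apply, Function.update_self, Function.update_of_ne huv,
    Matrix.mul_apply (M := A), Finset.sum_mul]
  refine Finset.sum_congr rfl fun x _ => ?_
  rw [mul_assoc]
  congr 2
  refine Finset.prod_congr rfl fun w hw => ?_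
  simp only [Finset.mem_erase, Finset.mem_univ, and_true] at hw
  rw [Function.update_of_ne hw.1, Function.update_of_ne hw.2]

theorem pairState_mul_embedTwo {u v : Site a b} (huv : u ≠ v)
    (A M : Matrix (Fin 2 × Fin 2) (Fin 2 × Fin 2) ℂ) (f : Site a b → Matrix (Fin 2) (Fin 2) ℂ) :
    pairState u v M f * embedTwo u v A = pairState u v (M * A) f := by
  have h := embedTwo_mul_pairState huv Aᴴ Mᴴ fun w => (f w)ᴴ
  rw [← conjTranspose_embedTwo, ← conjTranspose_pairState, ← Matrix.conjTranspose_mul,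
    ← Matrix.conjTranspose_mul, ← conjTranspose_pairState] at h
  exact Matrix.conjTranspose_injective h

theorem productState_update_apply (u : Site a b) (f : Site a b → Matrix (Fin 2) (Fin 2) ℂ)
    (M : Matrix (Fin 2) (Fin 2) ℂ) (σ τ : Config a b) :
    productState (Function.update f u M) σ τ =
      M (σ u) (τ u) * ∏ w ∈ Finset.univ.erase u, f w (σ w) (τ w) := by
  simp only [productState, Matrix.of_apply]
  rw [← Finset.mul_prod_erase _ _ (Finset.mem_univ u), Function.update_self]
  congr 1
  refine Finset.prod_congr rfl fun w hw => ?_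
  rw [Function.update_of_ne (Finset.ne_of_mem_erase hw)]

theorem productState_update_add (u : Site a b) (f : Site a b → Matrix (Fin 2) (Fin 2) ℂ)
    (M N : Matrix (Fin 2) (Fin 2) ℂ) :
    productState (Function.update f u (M + N)) =
      productState (Function.update f u M) + productState (Function.update f u N) := by
  ext σ τ
  simp only [productState_update_apply, Matrix.add_apply, add_mul]

theorem productState_update_smul (u : Site a b) (f : Site a b → Matrix (Fin 2) (Fin 2) ℂ)
    (x : ℂ) (M : Matrix (Fin 2) (Fin 2) ℂ) :
    productState (Function.update f u (x • M)) = x • productState (Function.update f u M) := by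
  ext σ τ
  simp only [productState_update_apply, Matrix.smul_apply, smul_eq_mul, mul_assoc]

theorem embedOne_mul_productState (u : Site a b) (A M : Matrix (Fin 2) (Fin 2) ℂ)
    (f : Site a b → Matrix (Fin 2) (Fin 2) ℂ) :
    embedOne u A * productState (Function.update f u M) =
      productState (Function.update f u (A * M)) := by
  ext σ τ
  rw [embedOne_mul_apply]
  simp only [productState_update_apply, Function.update_self, Matrix.mul_apply, Finset.sum_mul]
  refine Finset.sum_congr rfl fun x _ => ?_
  rw [mul_assoc]
  congr 2
  refine Finset.prod_congr rfl fun w hw => ?_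
  rw [Function.update_of_ne (Finset.ne_of_mem_erase hw)]

theorem productState_mul_embedOne (u : Site a b) (A M : Matrix (Fin 2) (Fin 2) ℂ)
    (f : Site a b → Matrix (Fin 2) (Fin 2) ℂ) :
    productState (Function.update f u M) * embedOne u A =
      productState (Function.update f u (M * A)) := by
  ext σ τ
  rw [mul_embedOne_apply]
  simp only [productState_update_apply, Function.update_self, Matrix.mul_apply, Finset.sum_mul]
  refine Finset.sum_congr rfl fun x _ => ?_
  rw [mul_right_comm]
  congr 1
  refine Finset.prod_congr rfl fun w hw => ?_
  rw [Function.update_of_ne (Finset.ne_of_mem_erase hw)]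

/-- `M` acts as the identity outside of the set `S` of qubits. -/
structure ActsOn (S : Set (Site a b)) (M : Op a b) : Prop where
  agree : ∀ σ τ, M σ τ ≠ 0 → ∀ w, w ∉ S → σ w = τ w
  indep : ∀ σ τ σ' τ', (∀ w ∈ S, σ w = σ' w ∧ τ w = τ' w) → (∀ w, w ∉ S → σ w = τ w) →
    (∀ w, w ∉ S → σ' w = τ' w) → M σ τ = M σ' τ'

theorem ActsOn.commute {S S' : Set (Site a b)} {M N : Op a b} (hM : ActsOn S M)
    (hN : ActsOn S' N) (hd : Disjoint S S') : Commute M N := by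
  classical
  have hd' : ∀ w, w ∈ S → w ∉ S' := fun w h h' => Set.disjoint_left.1 hd h h'
  have key : ∀ {S S' : Set (Site a b)} {M N : Op a b}, ActsOn S M → ActsOn S' N →
      (∀ w, w ∈ S → w ∉ S') → ∀ σ τ, (M * N) σ τ =
        M σ (fun w => if w ∈ S then τ w else σ w) * N (fun w => if w ∈ S then τ w else σ w) τ := by
    intro S S' M N hM hN hd σ τ
    rw [Matrix.mul_apply]
    refine Finset.sum_eq_single_of_mem _ (Finset.mem_univ _) fun κ _ hκ => ?_
    by_contra h
    refine hκ (funext fun w => ?_)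
    split_ifs with hw
    · exact hN.agree κ τ (right_ne_zero_of_mul h) w (hd w hw)
    · exact (hM.agree σ κ (left_ne_zero_of_mul h) w hw).symm
  ext σ τ
  rw [key hM hN hd', key hN hM fun w h h' => hd' w h' h]
  by_cases h : ∀ w, w ∉ S → w ∉ S' → σ w = τ w
  · rw [mul_comm]
    congr 1
    · refine hN.indep _ _ _ _ ?_ ?_ ?_
      · intro w hw
        have hw2 : w ∉ S := fun h => hd' w h hw
        simp [hw, hw2]
      · intro w hw
        split_ifs with h'
        · rfl
        · exact h w h' hw
      · intro w hw
        simp [hw]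
    · refine hM.indep _ _ _ _ ?_ ?_ ?_
      · intro w hw
        simp [hw, hd' w hw]
      · intro w hw
        simp [hw]
      · intro w hw
        split_ifs with h'
        · rfl
        · exact h w hw h'
  · push Not at h
    obtain ⟨w, hw, hw', hne⟩ := h
    rw [show N (fun w => if w ∈ S then τ w else σ w) τ = 0 from ?_,
      show M (fun w => if w ∈ S' then τ w else σ w) τ = 0 from ?_, mul_zero, mul_zero]
    · by_contra h
      have := hM.agree _ _ h w hw
      simp [hw', hne] at this
    · by_contra h
      have := hN.agree _ _ h w hw'
      simp [hw, hne] at this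

theorem actsOn_embedOne (u : Site a b) (A : Matrix (Fin 2) (Fin 2) ℂ) :
    ActsOn {u} (embedOne u A) := by
  classical
  constructor
  · intro σ τ h w hw
    simp only [embedOne, Matrix.of_apply] at h
    split_ifs at h with h1
    · exact h1 w hw
    · exact absurd rfl h
  · intro σ τ σ' τ' h h1 h2
    have h1' : ∀ w, w ≠ u → σ w = τ w := h1
    have h2' : ∀ w, w ≠ u → σ' w = τ' w := h2
    simp only [embedOne, Matrix.of_apply]
    rw [if_pos h1', if_pos h2', (h u rfl).1, (h u rfl).2]

theorem actsOn_embedTwo (u v : Site a b) (A : Matrix (Fin 2 × Fin 2) (Fin 2 × Fin 2) ℂ) :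
    ActsOn {u, v} (embedTwo u v A) := by
  classical
  constructor
  · intro σ τ h w hw
    simp only [embedTwo, Matrix.of_apply] at h
    simp only [Set.mem_insert_iff, Set.mem_singleton_iff, not_or] at hw
    split_ifs at h with h1
    · exact h1 w hw.1 hw.2
    · exact absurd rfl h
  · intro σ τ σ' τ' h h1 h2
    have h1' : ∀ w, w ≠ u → w ≠ v → σ w = τ w := fun w hw hw' => h1 w (by simp [hw, hw'])
    have h2' : ∀ w, w ≠ u → w ≠ v → σ' w = τ' w := fun w hw hw' => h2 w (by simp [hw, hw'])
    simp only [embedTwo, Matrix.of_apply]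
    rw [if_pos h1', if_pos h2', (h u (by simp)).1, (h u (by simp)).2, (h v (by simp)).1,
      (h v (by simp)).2]

theorem Gate.actsOn (g : Gate a b) : ActsOn g.support g.unitary := by
  cases g with
  | tGate u => exact actsOn_embedOne u _
  | cliffordOne u U => exact actsOn_embedOne u _
  | cliffordTwo u v U => exact actsOn_embedTwo u v _

/-! ### Pauli strings in the Heisenberg picture -/

/-- The Pauli operator that acts on the site `u` as the Pauli matrix with the number `q u.idx`. -/
noncomputable def pauliString (q : ℕ → ℕ) : Op a b :=
  productState fun u => pauli (Fin.ofNat 4 (q u.idx))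

/-- The expectation value of a Pauli string in a state. -/
noncomputable def expect (ρ : Op a b) (q : ℕ → ℕ) : ℂ := Matrix.trace (pauliString q * ρ)

theorem pauliString_update (q : ℕ → ℕ) (u : Site a b) (m : ℕ) :
    (pauliString (Function.update q u.idx m) : Op a b) =
      productState (Function.update (fun w => pauli (Fin.ofNat 4 (q w.idx))) u
        (pauli (Fin.ofNat 4 m))) := by
  rw [pauliString]
  congr 1
  funext w
  by_cases hw : w = u
  · subst hw; simp
  · rw [Function.update_of_ne hw, Function.update_of_ne fun h => hw (Site.idx_injective h)]

theorem pauliString_eq_update (q : ℕ → ℕ) (u : Site a b) :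
    (pauliString q : Op a b) =
      productState (Function.update (fun w => pauli (Fin.ofNat 4 (q w.idx))) u
        (pauli (Fin.ofNat 4 (q u.idx)))) := by
  rw [← pauliString_update, Function.update_eq_self]

theorem expect_conj (G ρ : Op a b) (q : ℕ → ℕ) :
    expect (G * ρ * Gᴴ) q = Matrix.trace (Gᴴ * pauliString q * G * ρ) := by
  rw [expect, ← Matrix.mul_assoc, Matrix.trace_mul_comm]
  simp only [Matrix.mul_assoc]

theorem conj_embedOne_pauliString (U : Matrix (Fin 2) (Fin 2) ℂ) (u : Site a b) (q : ℕ → ℕ) :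
    (embedOne u U)ᴴ * pauliString q * embedOne u U =
      productState (Function.update (fun w => pauli (Fin.ofNat 4 (q w.idx))) u
        (Uᴴ * pauli (Fin.ofNat 4 (q u.idx)) * U)) := by
  rw [conjTranspose_embedOne, pauliString_eq_update q u, embedOne_mul_productState,
    productState_mul_embedOne]

theorem expect_cliffordOne {U : Matrix (Fin 2) (Fin 2) ℂ} {u : Site a b} {q : ℕ → ℕ} {m x : ℕ}
    (h : Uᴴ * pauli (Fin.ofNat 4 (q u.idx)) * U = (-1 : ℂ) ^ x • pauli (Fin.ofNat 4 m))
    (ρ : Op a b) :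
    expect (embedOne u U * ρ * (embedOne u U)ᴴ) q =
      (-1) ^ x * expect ρ (Function.update q u.idx m) := by
  rw [expect_conj, conj_embedOne_pauliString, h, productState_update_smul, ← pauliString_update,
    Matrix.smul_mul, Matrix.trace_smul, smul_eq_mul, expect]

theorem expect_cliffordTwo {U : Matrix (Fin 2 × Fin 2) (Fin 2 × Fin 2) ℂ} {u v : Site a b}
    (huv : u ≠ v) {q : ℕ → ℕ} {m m' x : ℕ}
    (h : Uᴴ * (pauli (Fin.ofNat 4 (q u.idx)) ⊗ₖ pauli (Fin.ofNat 4 (q v.idx))) * U =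
      (-1 : ℂ) ^ x • (pauli (Fin.ofNat 4 m) ⊗ₖ pauli (Fin.ofNat 4 m'))) (ρ : Op a b) :
    expect (embedTwo u v U * ρ * (embedTwo u v U)ᴴ) q =
      (-1) ^ x * expect ρ (Function.update (Function.update q u.idx m) v.idx m') := by
  have hidx : u.idx ≠ v.idx := fun h => huv (Site.idx_injective h)
  rw [expect_conj, conjTranspose_embedTwo, pauliString, productState_eq_pairState huv,
    embedTwo_mul_pairState huv, pairState_mul_embedTwo huv, h, pairState_smul, Matrix.smul_mul,
    Matrix.trace_smul, smul_eq_mul, expect, pauliString, productState_eq_pairState huv]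
  simp only [Function.update_self, Function.update_of_ne hidx]
  congr 3
  refine pairState_congr _ fun w hwu hwv => ?_
  rw [Function.update_of_ne fun h => hwv (Site.idx_injective h),
    Function.update_of_ne fun h => hwu (Site.idx_injective h)]

theorem exp_pi_div_four :
    Complex.exp (Complex.I * (Real.pi / 4)) = (√2 / 2 : ℝ) * (1 + Complex.I) := by
  have h : Complex.I * (Real.pi / 4) = ((Real.pi / 4 : ℝ) : ℂ) * Complex.I := by
    push_cast; ring
  rw [h, Complex.exp_mul_I, ← Complex.ofReal_cos, ← Complex.ofReal_sin, Real.cos_pi_div_four,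
    Real.sin_pi_div_four]
  ring

theorem sqrt_two_sq_complex : ((√2 : ℝ) : ℂ) * ((√2 : ℝ) : ℂ) = 2 := by
  rw [← Complex.ofReal_mul, Real.mul_self_sqrt (by norm_num)]
  norm_num

theorem conj_two : (starRingEnd ℂ) 2 = 2 := Complex.conj_eq_iff_im.2 (by simp)

theorem tMatrix_conj_pauli_one : tMatrixᴴ * pauli 1 * tMatrix =
    ((√2 / 2 : ℝ) : ℂ) • (pauli 1 + (-1 : ℂ) • pauli 2) := by
  ext i j
  fin_cases i <;> fin_cases j <;>
    simp [tMatrix, pauli, Matrix.mul_apply, exp_pi_div_four, Complex.conj_ofReal,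
      conj_two]

theorem tMatrix_conj_pauli_two : tMatrixᴴ * pauli 2 * tMatrix =
    ((√2 / 2 : ℝ) : ℂ) • (pauli 1 + pauli 2) := by
  ext i j
  fin_cases i <;> fin_cases j <;>
    simp [tMatrix, pauli, Matrix.mul_apply, exp_pi_div_four, Complex.conj_ofReal,
      conj_two] <;> ring_nf <;>
    simp <;> ring

theorem tMatrix_conj_pauli_zero : tMatrixᴴ * pauli 0 * tMatrix = pauli 0 := by
  ext i j
  fin_cases i <;> fin_cases j <;>
    simp [tMatrix, pauli, Matrix.mul_apply, exp_pi_div_four, Complex.conj_ofReal,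
      conj_two]
  have := sqrt_two_sq_complex
  ring_nf
  simp only [pow_two, this]
  norm_num

theorem tMatrix_conj_pauli_three : tMatrixᴴ * pauli 3 * tMatrix = pauli 3 := by
  ext i j
  fin_cases i <;> fin_cases j <;>
    simp [tMatrix, pauli, Matrix.mul_apply, exp_pi_div_four, Complex.conj_ofReal,
      conj_two]
  have := sqrt_two_sq_complex
  ring_nf
  simp only [pow_two, this]
  norm_num

theorem expect_tGate_fix {u : Site a b} {q : ℕ → ℕ} (h : q u.idx = 0 ∨ q u.idx = 3) (ρ : Op a b) :
    expect (embedOne u tMatrix * ρ * (embedOne u tMatrix)ᴴ) q = expect ρ q := by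
  have : tMatrixᴴ * pauli (Fin.ofNat 4 (q u.idx)) * tMatrix = pauli (Fin.ofNat 4 (q u.idx)) := by
    rcases h with h | h <;> rw [h]
    · exact tMatrix_conj_pauli_zero
    · exact tMatrix_conj_pauli_three
  have := expect_cliffordOne (x := 0) (by rw [this, pow_zero, one_smul]) ρ
  rwa [pow_zero, one_mul, Function.update_eq_self] at this

theorem expect_tGate_one {u : Site a b} {q : ℕ → ℕ} (h : q u.idx = 1) (ρ : Op a b) :
    expect (embedOne u tMatrix * ρ * (embedOne u tMatrix)ᴴ) q =
      (√2 / 2 : ℝ) * (expect ρ (Function.update q u.idx 1) -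
        expect ρ (Function.update q u.idx 2)) := by
  rw [expect_conj, conj_embedOne_pauliString, h, show Fin.ofNat 4 1 = 1 from rfl,
    tMatrix_conj_pauli_one, productState_update_smul, productState_update_add,
    productState_update_smul, expect, expect, pauliString_update, pauliString_update]
  simp only [Matrix.smul_mul, Matrix.add_mul, Matrix.trace_smul, Matrix.trace_add, smul_eq_mul]
  rw [neg_one_mul, ← sub_eq_add_neg]
  rfl

theorem expect_tGate_two {u : Site a b} {q : ℕ → ℕ} (h : q u.idx = 2) (ρ : Op a b) :
    expect (embedOne u tMatrix * ρ * (embedOne u tMatrix)ᴴ) q =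
      (√2 / 2 : ℝ) * (expect ρ (Function.update q u.idx 1) +
        expect ρ (Function.update q u.idx 2)) := by
  rw [expect_conj, conj_embedOne_pauliString, h, show Fin.ofNat 4 2 = 2 from rfl,
    tMatrix_conj_pauli_two, productState_update_smul, productState_update_add, expect, expect,
    pauliString_update, pauliString_update]
  simp only [Matrix.smul_mul, Matrix.add_mul, Matrix.trace_smul, Matrix.trace_add, smul_eq_mul]
  rfl

/-! ### Depolarizing noise -/

theorem sum_pauli_mul_pauli (s x y t : Fin 2) :
    ∑ P, pauli P s x * pauli P y t = if s = t ∧ x = y then 2 else 0 := by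
  fin_cases s <;> fin_cases x <;> fin_cases y <;> fin_cases t <;>
    simp [Fin.sum_univ_four, pauli] <;> norm_num

/-- Depolarizing noise as a mixture of Pauli errors. -/
theorem depolarizeAt_eq (p : ℝ) (u : Site a b) (ρ : Op a b) :
    depolarizeAt p u ρ = (1 - p : ℂ) • ρ +
      (p / 4 : ℂ) • ∑ P, embedOne u (pauli P) * ρ * embedOne u (pauli P) := by
  classical
  ext σ τ
  have key : (∑ P, embedOne u (pauli P) * ρ * embedOne u (pauli P)) σ τ =
      if σ u = τ u then
        2 * ∑ x, ρ (Function.update σ u x) (Function.update τ u x) else 0 := by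
    rw [Matrix.sum_apply]
    simp only [mul_embedOne_apply, embedOne_mul_apply, Finset.sum_mul]
    have h1 : ∀ P y x, pauli P (σ u) x * ρ (Function.update σ u x) (Function.update τ u y) *
        pauli P y (τ u) = ρ (Function.update σ u x) (Function.update τ u y) *
          (pauli P (σ u) x * pauli P y (τ u)) := fun P y x => by ring
    simp only [h1]
    rw [Finset.sum_comm]
    have h2 : ∀ y, ∑ P, ∑ x, ρ (Function.update σ u x) (Function.update τ u y) *
        (pauli P (σ u) x * pauli P y (τ u)) =
        if σ u = τ u then 2 * ρ (Function.update σ u y) (Function.update τ u y) else 0 := by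
      intro y
      rw [Finset.sum_comm]
      simp only [← Finset.mul_sum, sum_pauli_mul_pauli]
      split_ifs with h
      · simp only [h, true_and, mul_ite, mul_zero]
        rw [Finset.sum_ite_eq' Finset.univ y]
        simp [mul_comm]
      · simp [h]
    rw [Finset.sum_congr rfl fun y _ => h2 y]
    split_ifs with h
    · rw [Finset.mul_sum]
    · simp
  rw [Matrix.add_apply, Matrix.smul_apply, Matrix.smul_apply, key]
  simp only [depolarizeAt, Matrix.of_apply, smul_eq_mul]
  split_ifs <;> ring

theorem sum_pauli_conj (Q : Fin 4) :
    ∑ P, pauli P * pauli Q * pauli P = (if Q = 0 then 4 else 0 : ℂ) • pauli Q := by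
  ext i j
  simp only [Fin.sum_univ_four]
  fin_cases Q <;> fin_cases i <;> fin_cases j <;>
    simp [pauli] <;> norm_num

theorem pauli_conjTranspose (P : Fin 4) : (pauli P)ᴴ = pauli P := by
  ext i j
  fin_cases P <;> fin_cases i <;> fin_cases j <;> simp [pauli]

theorem productState_update_sum {ι : Type*} (t : Finset ι) (u : Site a b)
    (f : Site a b → Matrix (Fin 2) (Fin 2) ℂ) (M : ι → Matrix (Fin 2) (Fin 2) ℂ) :
    productState (Function.update f u (∑ i ∈ t, M i)) =
      ∑ i ∈ t, productState (Function.update f u (M i)) := by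
  ext σ τ
  simp only [productState_update_apply, Matrix.sum_apply, Finset.sum_mul]

theorem expect_depolarizeAt (p : ℝ) (u : Site a b) (ρ : Op a b) (q : ℕ → ℕ)
    (hq : q u.idx < 4) :
    expect (depolarizeAt p u ρ) q = (if q u.idx = 0 then 1 else 1 - p : ℂ) * expect ρ q := by
  have h : ∑ P, expect (embedOne u (pauli P) * ρ * embedOne u (pauli P)) q =
      (if q u.idx = 0 then 4 else 0 : ℂ) * expect ρ q := by
    have h1 : ∀ P, expect (embedOne u (pauli P) * ρ * embedOne u (pauli P)) q =
        Matrix.trace (productState (Function.update (fun w => pauli (Fin.ofNat 4 (q w.idx))) u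
          (pauli P * pauli (Fin.ofNat 4 (q u.idx)) * pauli P)) * ρ) := by
      intro P
      have h2 := conj_embedOne_pauliString (pauli P) u q
      have h3 := expect_conj (embedOne u (pauli P)) ρ q
      rw [h2] at h3
      rwa [conjTranspose_embedOne, pauli_conjTranspose] at h3
    rw [Finset.sum_congr rfl fun P _ => h1 P, ← Matrix.trace_sum, ← Finset.sum_mul,
      ← productState_update_sum, sum_pauli_conj, productState_update_smul,
      ← pauliString_eq_update, Matrix.smul_mul, Matrix.trace_smul, smul_eq_mul, expect]
    congr 2
    have : Fin.ofNat 4 (q u.idx) = 0 ↔ q u.idx = 0 := by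
      rw [Fin.ext_iff]
      simp [Fin.ofNat, Nat.mod_eq_of_lt hq]
    simp only [this]
  rw [depolarizeAt_eq]
  have : expect ((1 - p : ℂ) • ρ +
      (p / 4 : ℂ) • ∑ P, embedOne u (pauli P) * ρ * embedOne u (pauli P)) q =
      (1 - p) * expect ρ q +
        (p / 4) * ∑ P, expect (embedOne u (pauli P) * ρ * embedOne u (pauli P)) q := by
    simp only [expect, Matrix.mul_add, Matrix.mul_smul, Matrix.trace_add, Matrix.trace_smul,
      smul_eq_mul, Matrix.mul_sum, Matrix.trace_sum]
  rw [this, h]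
  split_ifs <;> ring

/-- The number of nontrivial factors of a Pauli string on `n` sites. -/
def weight (n : ℕ) (q : ℕ → ℕ) : ℕ := ∑ i ∈ Finset.range n, if q i = 0 then 0 else 1

theorem Site.idx_lt (u : Site a b) : u.idx < a * b := by
  have h1 : ((u.1 : ℕ) + 1) * b ≤ a * b := Nat.mul_le_mul_right _ u.1.2
  have h2 := u.2.2
  rw [Nat.add_mul] at h1
  simp only [Site.idx]
  omega

theorem Site.exists_idx_eq {i : ℕ} (hi : i < a * b) : ∃ u : Site a b, u.idx = i := by
  have hb : 0 < b := Nat.pos_of_ne_zero fun h => by simp [h] at hi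
  refine ⟨(⟨i / b, Nat.div_lt_of_lt_mul (by rwa [mul_comm] at hi)⟩, ⟨i % b, Nat.mod_lt _ hb⟩), ?_⟩
  simp only [Site.idx]
  exact Nat.div_add_mod' i b

theorem Site.image_idx : (Finset.univ : Finset (Site a b)).image Site.idx =
    Finset.range (a * b) := by
  ext i
  simp only [Finset.mem_image, Finset.mem_univ, true_and, Finset.mem_range]
  exact ⟨fun ⟨u, hu⟩ => hu ▸ u.idx_lt, Site.exists_idx_eq⟩

@[to_additive]
theorem Site.prod_idx {M : Type*} [CommMonoid M] (F : ℕ → M) :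
    ∏ u : Site a b, F u.idx = ∏ i ∈ Finset.range (a * b), F i := by
  rw [← Site.image_idx, Finset.prod_image fun _ _ _ _ h => Site.idx_injective h]

theorem expect_depolarize (p : ℝ) (ρ : Op a b) (q : ℕ → ℕ) (hq : ∀ i < a * b, q i < 4) :
    expect (depolarize p ρ) q = (1 - p : ℂ) ^ weight (a * b) q * expect ρ q := by
  have h : ∀ l : List (Site a b), expect (l.foldr (depolarizeAt p) ρ) q =
      (l.map fun u => if q u.idx = 0 then (1 : ℂ) else 1 - p).prod * expect ρ q := by
    intro l
    induction l with
    | nil => simp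
    | cons u l ih =>
      rw [List.foldr_cons, expect_depolarizeAt _ _ _ _ (hq _ u.idx_lt), ih, List.map_cons,
        List.prod_cons, mul_assoc]
  rw [depolarize, h, Finset.prod_map_toList,
    Site.prod_idx (fun i => if q i = 0 then (1 : ℂ) else 1 - p), weight, ← Finset.prod_pow_eq_pow_sum]
  congr 1
  refine Finset.prod_congr rfl fun i _ => ?_
  split_ifs <;> simp

theorem expect_productState (ρ : Site a b → Matrix (Fin 2) (Fin 2) ℂ) (q : ℕ → ℕ) :
    expect (productState ρ) q = ∏ u : Site a b, Matrix.trace (pauli (Fin.ofNat 4 (q u.idx)) * ρ u) := by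
  classical
  have hmul : pauliString q * productState ρ =
      productState fun u => pauli (Fin.ofNat 4 (q u.idx)) * ρ u := by
    ext σ τ
    simp only [pauliString, productState, Matrix.mul_apply, Matrix.of_apply,
      ← Finset.prod_mul_distrib, Finset.prod_univ_sum, Fintype.piFinset_univ]
  rw [expect, hmul]
  simp only [Matrix.trace, Matrix.diag, productState, Matrix.of_apply, Finset.prod_univ_sum,
    Fintype.piFinset_univ]

/-! ### Action of Clifford gates on the weight of Pauli strings -/

theorem trace_pauli (P : Fin 4) : (pauli P).trace = if P = 0 then 2 else 0 := by
  fin_cases P <;> simp [pauli, Matrix.trace, Fin.sum_univ_two]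
  norm_num

theorem trace_pauli_mul (P Q : Fin 4) : (pauli P * pauli Q).trace = if P = Q then 2 else 0 := by
  fin_cases P <;> fin_cases Q <;>
    simp [pauli, Matrix.trace, Fin.sum_univ_two] <;> norm_num

theorem neg_one_pow_mul_ne_zero {x : ℕ} {z : ℂ} : (-1 : ℂ) ^ x * z ≠ 0 ↔ z ≠ 0 := by
  have : (-1 : ℂ) ^ x ≠ 0 := pow_ne_zero _ (by norm_num)
  simp [this]

theorem clifford_one_eq_zero_iff {U : Matrix (Fin 2) (Fin 2) ℂ}
    (hU : U ∈ Matrix.unitaryGroup (Fin 2) ℂ) {P Q : Fin 4} {x : ℕ}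
    (h : Uᴴ * pauli P * U = (-1 : ℂ) ^ x • pauli Q) : P = 0 ↔ Q = 0 := by
  have h1 := congrArg Matrix.trace h
  rw [Matrix.trace_mul_comm, ← Matrix.mul_assoc, ← Matrix.star_eq_conjTranspose,
    Matrix.mem_unitaryGroup_iff.1 hU, one_mul, Matrix.trace_smul, smul_eq_mul] at h1
  have h2 : (pauli P).trace ≠ 0 ↔ (pauli Q).trace ≠ 0 := by rw [h1, neg_one_pow_mul_ne_zero]
  simpa [trace_pauli] using h2

theorem clifford_two_eq_zero_iff {U : Matrix (Fin 2 × Fin 2) (Fin 2 × Fin 2) ℂ}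
    (hU : U ∈ Matrix.unitaryGroup (Fin 2 × Fin 2) ℂ) {P P' Q Q' : Fin 4} {x : ℕ}
    (h : Uᴴ * (pauli P ⊗ₖ pauli P') * U = (-1 : ℂ) ^ x • (pauli Q ⊗ₖ pauli Q')) :
    (P = 0 ∧ P' = 0) ↔ (Q = 0 ∧ Q' = 0) := by
  have h1 := congrArg Matrix.trace h
  rw [Matrix.trace_mul_comm, ← Matrix.mul_assoc, ← Matrix.star_eq_conjTranspose,
    Matrix.mem_unitaryGroup_iff.1 hU, one_mul, Matrix.trace_smul, smul_eq_mul,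
    Matrix.trace_kronecker, Matrix.trace_kronecker] at h1
  have h2 : (pauli P).trace * (pauli P').trace ≠ 0 ↔ (pauli Q).trace * (pauli Q').trace ≠ 0 := by
    rw [h1, neg_one_pow_mul_ne_zero]
  rw [and_comm, and_comm (a := Q = 0)]
  simpa [trace_pauli, mul_ne_zero_iff] using h2

theorem swapMatrix_conj (A B : Matrix (Fin 2) (Fin 2) ℂ) :
    swapMatrixᴴ * (A ⊗ₖ B) * swapMatrix = B ⊗ₖ A := by
  have h1 : ∀ (M : Matrix (Fin 2 × Fin 2) (Fin 2 × Fin 2) ℂ) x y,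
      (M * swapMatrix) x y = M x y.swap := by
    intro M x y
    rw [Matrix.mul_apply]
    simp [swapMatrix]
  have h2 : ∀ (M : Matrix (Fin 2 × Fin 2) (Fin 2 × Fin 2) ℂ) x y,
      (swapMatrixᴴ * M) x y = M x.swap y := by
    intro M x y
    rw [Matrix.mul_apply]
    simp [swapMatrix, Matrix.conjTranspose_apply]
  ext x y
  rw [h1, h2]
  simp [mul_comm]

theorem swap_table {P P' Q Q' : Fin 4} {x : ℕ}
    (h : swapMatrixᴴ * (pauli P ⊗ₖ pauli P') * swapMatrix =
      (-1 : ℂ) ^ x • (pauli Q ⊗ₖ pauli Q')) : Q = P' ∧ Q' = P := by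
  rw [swapMatrix_conj] at h
  have h1 := congrArg (fun M => Matrix.trace (M * (pauli P' ⊗ₖ pauli P))) h
  simp only [Matrix.smul_mul, ← Matrix.mul_kronecker_mul, Matrix.trace_smul,
    Matrix.trace_kronecker, trace_pauli_mul, smul_eq_mul, if_true] at h1
  by_contra hne
  rw [not_and_or] at hne
  rcases hne with hne | hne <;> simp [hne] at h1

/-! ### The gates of a layer in the order of the sites -/

/-- The site at which a gate is processed. -/
def Gate.lead : Gate a b → Site a b
  | .tGate u => u
  | .cliffordOne u _ => u
  | .cliffordTwo u _ _ => u

theorem Gate.lead_mem (g : Gate a b) : g.lead ∈ g.support := by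
  cases g <;> simp [Gate.lead, Gate.support]

/-- The gates of a layer that are processed at the `i`-th site. -/
def gatesAt (L : Layer a b) (i : ℕ) : Layer a b := L.filter fun g => g.lead.idx = i

theorem Layer.unitary_commute {L : Layer a b} (hL : Layer.Valid L) :
    (L.map Gate.unitary).Pairwise Commute := by
  rw [List.pairwise_map]
  exact hL.2.imp fun {g g'} h => g.actsOn.commute g'.actsOn h

theorem perm_flatMap_gatesAt (L : Layer a b) (n : ℕ) :
    ((List.range n).flatMap (gatesAt L)).Perm (L.filter fun g => g.lead.idx < n) := by
  induction n with
  | zero => simp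
  | succ n ih =>
    rw [List.range_succ, List.flatMap_append, List.flatMap_singleton]
    have h := List.filter_append_perm (fun g : Gate a b => decide (g.lead.idx < n))
      (L.filter fun g => g.lead.idx < n + 1)
    refine List.Perm.trans ?_ h
    rw [List.filter_filter, List.filter_filter]
    refine List.Perm.append ?_ ?_
    · refine ih.trans (List.Perm.of_eq (List.filter_congr fun g _ => ?_))
      by_cases h : g.lead.idx < n
      · have h' : g.lead.idx < n + 1 := by omega
        simp [h, h']
      · simp [h]
    · refine List.Perm.of_eq (List.filter_congr fun g _ => ?_)
      by_cases h : g.lead.idx = n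
      · simp [h]
      · by_cases h' : g.lead.idx < n
        · simp [h, h']
        · have h'' : ¬ g.lead.idx < n + 1 := by omega
          simp [h, h'']

/-- The part of a layer that is processed at the sites `i, i + 1, …, i + k - 1`. -/
noncomputable def sitesUnitary (L : Layer a b) (i k : ℕ) : Op a b :=
  ((List.range' i k).map fun j => Layer.unitary (gatesAt L j)).prod

theorem Layer.unitary_eq_sitesUnitary {L : Layer a b} (hL : Layer.Valid L) :
    Layer.unitary L = sitesUnitary L 0 (a * b) := by
  have h1 : (L.filter fun g => g.lead.idx < a * b) = L :=
    List.filter_eq_self.2 fun g _ => by simpa using g.lead.idx_lt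
  have h2 := perm_flatMap_gatesAt L (a * b)
  rw [h1] at h2
  rw [Layer.unitary, (h2.symm.map Gate.unitary).prod_eq' (Layer.unitary_commute hL), sitesUnitary,
    ← List.range_eq_range']
  generalize List.range (a * b) = l
  induction l with
  | nil => simp
  | cons i l ih =>
    rw [List.flatMap_cons, List.map_append, List.prod_append, ih, List.map_cons, List.prod_cons,
      Layer.unitary]

theorem sitesUnitary_succ (L : Layer a b) (i k : ℕ) :
    sitesUnitary L i (k + 1) = Layer.unitary (gatesAt L i) * sitesUnitary L (i + 1) k := by
  simp [sitesUnitary, List.range'_succ]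

/-- At most one gate of a valid layer acts on a given site. -/
theorem Layer.Valid.eq_of_mem {L : Layer a b} (hL : Layer.Valid L) {g g' : Gate a b} (hg : g ∈ L)
    (hg' : g' ∈ L) {w : Site a b} (hw : w ∈ g.support) (hw' : w ∈ g'.support) : g = g' := by
  by_contra hne
  have hsymm : Std.Symm fun g g' : Gate a b => Disjoint g.support g'.support :=
    ⟨fun _ _ h => h.symm⟩
  exact Set.disjoint_left.1 (hL.2.forall hg hg' hne) hw hw'

theorem gatesAt_eq_nil {L : Layer a b} {i : ℕ} (h : ∀ g ∈ L, g.lead.idx ≠ i) :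
    gatesAt L i = [] := by
  simpa [gatesAt, List.filter_eq_nil_iff] using h

theorem gatesAt_eq_singleton {L : Layer a b} (hL : Layer.Valid L) {g : Gate a b} (hg : g ∈ L) :
    gatesAt L g.lead.idx = [g] := by
  have h1 : ∀ g' ∈ gatesAt L g.lead.idx, g' = g := by
    intro g' hg'
    have h := List.mem_filter.1 hg'
    have h2 := Site.idx_injective (of_decide_eq_true h.2)
    exact hL.eq_of_mem h.1 hg (h2 ▸ g'.lead_mem) g.lead_mem
  have h2 : g ∈ gatesAt L g.lead.idx := List.mem_filter.2 ⟨hg, by simp⟩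
  have h3 : (gatesAt L g.lead.idx).Pairwise fun g g' => Disjoint g.support g'.support :=
    hL.2.sublist List.filter_sublist
  match hl : gatesAt L g.lead.idx with
  | [] => simp [hl] at h2
  | [g'] => rw [h1 g' (by simp [hl])]
  | g' :: g'' :: l =>
    rw [hl] at h1 h3
    have e1 := h1 g' (by simp)
    have e2 := h1 g'' (by simp)
    subst e1
    subst e2
    have := (List.pairwise_cons.1 h3).1 _ (List.mem_cons_self ..)
    exact absurd (Set.disjoint_left.1 this (Gate.lead_mem _) (Gate.lead_mem _)) id

/-! ### Sampling of Pauli paths -/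

/-- The average of `f` over all strings of `k` bits. -/
noncomputable def bitAvg (k : ℕ) (f : ℕ → ℂ) : ℂ := (∑ r ∈ Finset.range (2 ^ k), f r) / 2 ^ k

theorem bitAvg_const (k : ℕ) (z : ℂ) : bitAvg k (fun _ => z) = z := by
  simp [bitAvg]

theorem bitAvg_congr {k : ℕ} {f g : ℕ → ℂ} (h : ∀ r < 2 ^ k, f r = g r) :
    bitAvg k f = bitAvg k g := by
  rw [bitAvg, bitAvg, Finset.sum_congr rfl fun r hr => h r (Finset.mem_range.1 hr)]

/-- Averaging over the leading bit first. -/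
theorem bitAvg_succ (k : ℕ) (f : ℕ → ℂ) :
    bitAvg (k + 1) f = (bitAvg k f + bitAvg k fun r => f (2 ^ k + r)) / 2 := by
  rw [bitAvg, bitAvg, bitAvg, pow_succ 2 k, mul_two, Finset.sum_range_add, pow_succ]
  have : (2 : ℂ) ^ k ≠ 0 := pow_ne_zero _ two_ne_zero
  field_simp

/-- A state of the sampling procedure: the current Pauli string, the number `k` of unused random
bits, the number `r < 2 ^ k` that these bits form, and the accumulated coefficient. -/
structure PathState where
  q : ℕ → ℕ
  k : ℕ
  r : ℕ
  x : ℝ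

/-- The sampling step at the site `i`; the table of gates is read from the memory `D` at the
address `adr`. A `T` gate replaces `X` by `√2 X` or `-√2 Y`, and `Y` by `√2 X` or `√2 Y`. -/
noncomputable def siteStep (D : Mem) (adr i : ℕ) (σ : PathState) : PathState :=
  if D.natArr 2 adr = 1 then
    if σ.q i = 1 ∨ σ.q i = 2 then
      if 2 ^ (σ.k - 1) ≤ σ.r then
        ⟨Function.update σ.q i 2, σ.k - 1, σ.r - 2 ^ (σ.k - 1),
          if σ.q i = 1 then -(σ.x * √2) else σ.x * √2⟩
      else ⟨Function.update σ.q i 1, σ.k - 1, σ.r, σ.x * √2⟩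
    else σ
  else if D.natArr 2 adr = 2 then
    ⟨Function.update σ.q i (D.natArr 5 (16 * adr + σ.q i)), σ.k, σ.r,
      if D.natArr 6 (16 * adr + σ.q i) = 1 then -σ.x else σ.x⟩
  else if D.natArr 2 adr = 3 then
    if D.natArr 3 adr = i then
      ⟨Function.update (Function.update σ.q i
          (D.natArr 5 (16 * adr + (4 * σ.q i + σ.q (D.natArr 4 adr))) / 4)) (D.natArr 4 adr)
          (D.natArr 5 (16 * adr + (4 * σ.q i + σ.q (D.natArr 4 adr))) % 4), σ.k, σ.r,
        if D.natArr 6 (16 * adr + (4 * σ.q i + σ.q (D.natArr 4 adr))) = 1 then -σ.x else σ.x⟩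
    else σ
  else σ

/-- The memory `D` holds the table of the layer `L` at the addresses `base, base + 1, …`. -/
structure HoldsLayer (D : Mem) (base : ℕ) (L : Layer a b) : Prop where
  idle : ∀ w : Site a b, (∀ g ∈ L, w ∉ g.support) → D.natArr 2 (base + w.idx) = 0
  gates : ∀ w : Site a b, ∀ g ∈ L, w ∈ g.support → D.HoldsGate (base + w.idx) g

/-- The site `u` is idle, or its gate has been processed at one of the sites before `i`. -/
def Processed (L : Layer a b) (i : ℕ) (u : Site a b) : Prop :=
  ∀ g ∈ L, u ∈ g.support → g.lead.idx < i

/-- All entries of the Pauli string are numbers of Pauli matrices. -/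
def IsString (n : ℕ) (q : ℕ → ℕ) : Prop := ∀ i < n, q i < 4

open Classical in
/-- Potential of a Pauli string inside a layer: `α` for every nontrivial factor on which the gate
still has to be processed, `β` for all other nontrivial factors. -/
noncomputable def potential (L : Layer a b) (α β : ℝ) (i : ℕ) (q : ℕ → ℕ) : ℝ :=
  ∏ u : Site a b, if q u.idx = 0 then 1 else if Processed L i u then β else α

open Classical in
/-- The number of nontrivial factors on which the gate still has to be processed. -/
noncomputable def pending (L : Layer a b) (i : ℕ) (q : ℕ → ℕ) : ℕ :=
  ∑ u : Site a b, if q u.idx = 0 then 0 else if Processed L i u then 0 else 1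

/-- `L` consists of SWAP gates. -/
def IsSwapLayer (L : Layer a b) : Prop := ∀ g ∈ L, ∃ u v, g = .cliffordTwo u v swapMatrix

/-- The factors `α ≥ β ≥ 1` compensate for the growth of Pauli paths in the layer `L`: a factor `√2`
for every branching and a doubling of the weight, but nothing of this for a layer of SWAP gates. -/
def Compensates (L : Layer a b) (α β : ℝ) : Prop :=
  1 ≤ β ∧ (√2 * β ^ 2 ≤ α ∨ IsSwapLayer L ∧ α = β)

theorem one_le_sqrt_two : (1 : ℝ) ≤ √2 := Real.one_le_sqrt.2 (by norm_num)

theorem Compensates.le {L : Layer a b} {α β : ℝ} (h : Compensates L α β) : β ≤ α := by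
  rcases h.2 with h2 | h2
  · have := one_le_sqrt_two
    have := h.1
    nlinarith
  · exact h2.2.ge

theorem processed_succ_of_no_lead {L : Layer a b} {i : ℕ} (h : ∀ g ∈ L, g.lead.idx ≠ i)
    (u : Site a b) : Processed L (i + 1) u ↔ Processed L i u :=
  forall₃_congr fun g hg _ => by have := h g hg; omega

theorem not_processed_lead {L : Layer a b} {g : Gate a b} (hg : g ∈ L) {u : Site a b}
    (hu : u ∈ g.support) : ¬ Processed L g.lead.idx u := fun h => lt_irrefl _ (h g hg hu)

theorem processed_succ_lead {L : Layer a b} (hL : Layer.Valid L) {g : Gate a b} (hg : g ∈ L)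
    {u : Site a b} (hu : u ∈ g.support) : Processed L (g.lead.idx + 1) u := by
  intro g' hg' hu'
  rw [hL.eq_of_mem hg' hg hu' hu]
  omega

theorem processed_succ_iff {L : Layer a b} (hL : Layer.Valid L) {g : Gate a b} (hg : g ∈ L)
    {u : Site a b} (hu : u ∉ g.support) :
    Processed L (g.lead.idx + 1) u ↔ Processed L g.lead.idx u := by
  refine forall₃_congr fun g' hg' hu' => ?_
  have : g'.lead.idx ≠ g.lead.idx := by
    intro h
    have h1 := Site.idx_injective h
    have h2 := hL.eq_of_mem hg' hg (h1 ▸ g'.lead_mem) g.lead_mem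
    exact hu (h2 ▸ hu')
  omega

/-- The change of potential by a one-qubit gate. -/
theorem potential_split_one {L : Layer a b} (hL : Layer.Valid L) {g : Gate a b} (hg : g ∈ L)
    {u : Site a b} (hu : g.support = {u}) (hlead : g.lead = u) {α β : ℝ} (hβ : 1 ≤ β)
    (hαβ : β ≤ α) (q : ℕ → ℕ) :
    ∃ (R : ℝ) (S : ℕ), 0 ≤ R ∧
      potential L α β u.idx q = (if q u.idx = 0 then 1 else α) * R ∧
      pending L u.idx q = (if q u.idx = 0 then 0 else 1) + S ∧
      ∀ m, potential L α β (u.idx + 1) (Function.update q u.idx m) =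
          (if m = 0 then 1 else β) * R ∧
        pending L (u.idx + 1) (Function.update q u.idx m) = S := by
  classical
  subst hlead
  have hmem := g.lead_mem
  refine ⟨∏ w ∈ Finset.univ.erase g.lead,
      if q w.idx = 0 then 1 else if Processed L g.lead.idx w then β else α,
    ∑ w ∈ Finset.univ.erase g.lead, if q w.idx = 0 then 0 else if Processed L g.lead.idx w
      then 0 else 1, ?_, ?_, ?_, fun m => ⟨?_, ?_⟩⟩
  · refine Finset.prod_nonneg fun w _ => ?_
    split_ifs <;> linarith
  · rw [potential, ← Finset.mul_prod_erase _ _ (Finset.mem_univ g.lead),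
      if_neg (not_processed_lead hg hmem)]
  · rw [pending, ← Finset.add_sum_erase _ _ (Finset.mem_univ g.lead),
      if_neg (not_processed_lead hg hmem)]
  · rw [potential, ← Finset.mul_prod_erase _ _ (Finset.mem_univ g.lead),
      if_pos (processed_succ_lead hL hg hmem), Function.update_self]
    congr 1
    refine Finset.prod_congr rfl fun w hw => ?_
    have hw := Finset.ne_of_mem_erase hw
    rw [Function.update_of_ne fun h => hw (Site.idx_injective h)]
    have : w ∉ g.support := by rw [hu]; exact hw
    simp only [processed_succ_iff hL hg this]
  · rw [pending, ← Finset.add_sum_erase _ _ (Finset.mem_univ g.lead),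
      if_pos (processed_succ_lead hL hg hmem), ite_self, zero_add]
    refine Finset.sum_congr rfl fun w hw => ?_
    have hw := Finset.ne_of_mem_erase hw
    rw [Function.update_of_ne fun h => hw (Site.idx_injective h)]
    have : w ∉ g.support := by rw [hu]; exact hw
    simp only [processed_succ_iff hL hg this]

/-- The change of potential by a two-qubit gate. -/
theorem potential_split_two {L : Layer a b} (hL : Layer.Valid L) {u v : Site a b}
    {U : Matrix (Fin 2 × Fin 2) (Fin 2 × Fin 2) ℂ} (hg : Gate.cliffordTwo u v U ∈ L) (huv : u ≠ v)
    {α β : ℝ} (hβ : 1 ≤ β) (hαβ : β ≤ α) (q : ℕ → ℕ) :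
    ∃ (R : ℝ) (S T : ℕ), 0 ≤ R ∧
      potential L α β u.idx q =
        (if q u.idx = 0 then 1 else α) * ((if q v.idx = 0 then 1 else α) * R) ∧
      pending L u.idx q = T + S ∧
      ∀ m m', potential L α β (u.idx + 1)
          (Function.update (Function.update q u.idx m) v.idx m') =
          (if m = 0 then 1 else β) * ((if m' = 0 then 1 else β) * R) ∧
        pending L (u.idx + 1) (Function.update (Function.update q u.idx m) v.idx m') = S := by
  classical
  have hu : u ∈ (Gate.cliffordTwo u v U).support := by simp [Gate.support]
  have hv : v ∈ (Gate.cliffordTwo u v U).support := by simp [Gate.support]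
  have hvmem : v ∈ Finset.univ.erase u := Finset.mem_erase.2 ⟨huv.symm, Finset.mem_univ v⟩
  have hnu : ¬ Processed L u.idx u := not_processed_lead hg hu
  have hnv : ¬ Processed L u.idx v := not_processed_lead hg hv
  have hpu : Processed L (u.idx + 1) u := processed_succ_lead hL hg hu
  have hpv : Processed L (u.idx + 1) v := processed_succ_lead hL hg hv
  have hother : ∀ w ∈ (Finset.univ.erase u).erase v,
      (Processed L (u.idx + 1) w ↔ Processed L u.idx w) ∧
      ∀ m m', Function.update (Function.update q u.idx m) v.idx m' w.idx = q w.idx := by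
    intro w hw
    simp only [Finset.mem_erase, Finset.mem_univ, and_true] at hw
    refine ⟨processed_succ_iff hL hg (by simp [Gate.support, hw]), fun m m' => ?_⟩
    rw [Function.update_of_ne fun h => hw.1 (Site.idx_injective h),
      Function.update_of_ne fun h => hw.2 (Site.idx_injective h)]
  have hidx : u.idx ≠ v.idx := fun h => huv (Site.idx_injective h)
  refine ⟨∏ w ∈ (Finset.univ.erase u).erase v,
      if q w.idx = 0 then 1 else if Processed L u.idx w then β else α,
    ∑ w ∈ (Finset.univ.erase u).erase v, if q w.idx = 0 then 0 else if Processed L u.idx w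
      then 0 else 1, (if q u.idx = 0 then 0 else 1) + (if q v.idx = 0 then 0 else 1),
      ?_, ?_, ?_, fun m m' => ⟨?_, ?_⟩⟩
  · refine Finset.prod_nonneg fun w _ => ?_
    split_ifs <;> linarith
  · rw [potential, ← Finset.mul_prod_erase _ _ (Finset.mem_univ u),
      ← Finset.mul_prod_erase _ _ hvmem, if_neg hnu, if_neg hnv]
  · rw [pending, ← Finset.add_sum_erase _ _ (Finset.mem_univ u),
      ← Finset.add_sum_erase _ _ hvmem, if_neg hnu, if_neg hnv, add_assoc]
  · rw [potential, ← Finset.mul_prod_erase _ _ (Finset.mem_univ u),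
      ← Finset.mul_prod_erase _ _ hvmem, if_pos hpu, if_pos hpv, Function.update_self,
      Function.update_of_ne hidx, Function.update_self]
    congr 2
    refine Finset.prod_congr rfl fun w hw => ?_
    simp only [(hother w hw).1, (hother w hw).2]
  · rw [pending, ← Finset.add_sum_erase _ _ (Finset.mem_univ u),
      ← Finset.add_sum_erase _ _ hvmem, if_pos hpu, if_pos hpv, ite_self, ite_self, zero_add,
      zero_add]
    refine Finset.sum_congr rfl fun w hw => ?_
    simp only [(hother w hw).1, (hother w hw).2]

theorem IsString.update {n : ℕ} {q : ℕ → ℕ} (hq : IsString n q) (i : ℕ) {m : ℕ} (hm : m < 4) :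
    IsString n (Function.update q i m) := by
  intro j hj
  by_cases h : j = i
  · subst h; simpa using hm
  · rw [Function.update_of_ne h]; exact hq j hj

theorem Fin.ofNat_four_eq (P : Fin 4) : Fin.ofNat 4 (P : ℕ) = P := by
  ext; simp

theorem ite_neg_eq_pow {x : ℕ} (hx : x < 2) (y : ℝ) :
    (if x = 1 then -y else y) = (-1) ^ x * y := by
  interval_cases x <;> simp

/-- Averaging over the leading bit when it decides between two continuations. -/
theorem bitAvg_branch {out : PathState → ℂ} {D : Mem} {adr i k : ℕ} {q : ℕ → ℕ} {x s δ : ℝ}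
    {z₁ z₂ : ℂ} (hT : D.natArr 2 adr = 1) (hq : q i = 1 ∨ q i = 2)
    (hs : s = if q i = 1 then -1 else 1)
    (h1 : ‖bitAvg k (fun r => out ⟨Function.update q i 1, k, r, x * √2⟩) - (x * √2 : ℝ) * z₁‖ ≤ δ)
    (h2 : ‖bitAvg k (fun r => out ⟨Function.update q i 2, k, r, s * (x * √2)⟩) -
      (s * (x * √2) : ℝ) * z₂‖ ≤ δ) :
    ‖bitAvg (k + 1) (fun r => out (siteStep D adr i ⟨q, k + 1, r, x⟩)) -
      x * ((√2 / 2 : ℝ) * (z₁ + s * z₂))‖ ≤ δ := by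
  have e1 : bitAvg k (fun r => out (siteStep D adr i ⟨q, k + 1, r, x⟩)) =
      bitAvg k (fun r => out ⟨Function.update q i 1, k, r, x * √2⟩) := by
    refine bitAvg_congr fun r hr => ?_
    rw [siteStep, if_pos hT, if_pos hq, if_neg (by simpa using hr)]
    rfl
  have e2 : bitAvg k (fun r => out (siteStep D adr i ⟨q, k + 1, 2 ^ k + r, x⟩)) =
      bitAvg k (fun r => out ⟨Function.update q i 2, k, r, s * (x * √2)⟩) := by
    refine bitAvg_congr fun r _ => ?_
    rw [siteStep, if_pos hT, if_pos hq, if_pos (by simp)]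
    congr 2
    · simp
    · rw [hs]; split_ifs <;> ring
  rw [bitAvg_succ, e1, e2]
  set A₁ := bitAvg k (fun r => out ⟨Function.update q i 1, k, r, x * √2⟩)
  set A₂ := bitAvg k (fun r => out ⟨Function.update q i 2, k, r, s * (x * √2)⟩)
  have : (A₁ + A₂) / 2 - x * ((√2 / 2 : ℝ) * (z₁ + s * z₂)) =
      ((A₁ - (x * √2 : ℝ) * z₁) + (A₂ - (s * (x * √2) : ℝ) * z₂)) / 2 := by
    push_cast; ring
  rw [this, norm_div]
  have h3 := norm_add_le (A₁ - (x * √2 : ℝ) * z₁) (A₂ - (s * (x * √2) : ℝ) * z₂)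
  have : ‖(2 : ℂ)‖ = 2 := by simp
  rw [this]
  linarith

/-- What a step of the sampling procedure at the site `i` achieves for an observable: `Φ` is the
expectation value before and `Φ'` after the gates processed at this site have been moved over to
the state. -/
theorem siteStep_error {L : Layer a b} (hL : Layer.Valid L) {D : Mem} {base : ℕ}
    (hD : HoldsLayer D base L) {α β : ℝ} (hc : Compensates L α β) {i : ℕ} (hi : i < a * b)
    (ρ : Op a b) (out : PathState → ℂ) {bits : ℕ} {E : ℝ} (hE : 0 ≤ E)
    (hout : ∀ q k x, IsString (a * b) q → bits + pending L (i + 1) q ≤ k →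
      ‖bitAvg k (fun r => out ⟨q, k, r, x⟩) - x * expect ρ q‖ ≤
        |x| * potential L α β (i + 1) q * E)
    {q : ℕ → ℕ} {k : ℕ} {x : ℝ} (hq : IsString (a * b) q) (hk : bits + pending L i q ≤ k) :
    ‖bitAvg k (fun r => out (siteStep D (base + i) i ⟨q, k, r, x⟩)) -
        x * expect (Layer.unitary (gatesAt L i) * ρ * (Layer.unitary (gatesAt L i))ᴴ) q‖ ≤
      |x| * potential L α β i q * E := by
  have hαβ := hc.le
  have hβ := hc.1
  have hα : 1 ≤ α := hβ.trans hαβ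
  by_cases hlead : ∃ g ∈ L, g.lead.idx = i
  · obtain ⟨g, hg, rfl⟩ := hlead
    rw [gatesAt_eq_singleton hL hg, show Layer.unitary [g] = g.unitary by simp [Layer.unitary]]
    have hgate := hD.gates g.lead g hg g.lead_mem
    have hvalid := hL.1 g hg
    cases g with
    | tGate u =>
      simp only [Gate.lead, Gate.unitary] at *
      have hT : D.natArr 2 (base + u.idx) = 1 := hgate
      obtain ⟨R, S, hR, p1, p2, p3⟩ := potential_split_one hL hg rfl rfl hβ hαβ q
      have hqu := hq _ hi
      by_cases hxy : q u.idx = 1 ∨ q u.idx = 2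
      · have hne : q u.idx ≠ 0 := by omega
        rw [if_neg hne] at p1 p2
        obtain ⟨k, rfl⟩ : ∃ k', k = k' + 1 := ⟨k - 1, by omega⟩
        have hsqrt : √2 * β ≤ α := by
          rcases hc.2 with h | ⟨h, -⟩
          · have := one_le_sqrt_two
            nlinarith
          · obtain ⟨u', v', h⟩ := h _ hg
            cases h
        have hb : ∀ m < 4, ∀ s : ℝ, |s| = 1 → m ≠ 0 →
            ‖bitAvg k (fun r => out ⟨Function.update q u.idx m, k, r, s * (x * √2)⟩) -
              (s * (x * √2) : ℝ) * expect ρ (Function.update q u.idx m)‖ ≤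
              |x| * potential L α β u.idx q * E := by
          intro m hm s hs hm0
          refine (hout _ k _ (hq.update _ hm) (by rw [(p3 m).2]; omega)).trans ?_
          rw [(p3 m).1, if_neg hm0, p1, abs_mul, abs_mul, hs, abs_of_nonneg (Real.sqrt_nonneg 2)]
          refine mul_le_mul_of_nonneg_right ?_ hE
          have := mul_le_mul_of_nonneg_left hsqrt (mul_nonneg (abs_nonneg x) hR)
          linarith
        have hb1 := hb 1 (by norm_num) 1 (by simp) (by norm_num)
        simp only [one_mul] at hb1
        rcases hxy with h | h
        · rw [expect_tGate_one h]
          refine le_of_eq_of_le (congrArg _ ?_) (bitAvg_branch (s := -1) hT (Or.inl h)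
            (by simp [h]) hb1 (hb 2 (by norm_num) (-1) (by simp) (by norm_num)))
          push_cast; ring
        · rw [expect_tGate_two h]
          refine le_of_eq_of_le (congrArg _ ?_) (bitAvg_branch (s := 1) hT (Or.inr h)
            (by simp [h]) hb1 (hb 2 (by norm_num) 1 (by simp) (by norm_num)))
          push_cast; ring
      · rw [expect_tGate_fix (by omega)]
        have hstep : ∀ r, siteStep D (base + u.idx) u.idx ⟨q, k, r, x⟩ = ⟨q, k, r, x⟩ := by
          intro r
          rw [siteStep, if_pos hT, if_neg hxy]
        simp only [hstep]
        have h3 := p3 (q u.idx)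
        rw [Function.update_eq_self] at h3
        refine (hout q k x hq (by rw [h3.2]; omega)).trans ?_
        rw [h3.1, p1]
        gcongr
        split_ifs <;> linarith
    | cliffordOne u U =>
      simp only [Gate.lead, Gate.unitary] at *
      obtain ⟨R, S, hR, p1, p2, p3⟩ := potential_split_one hL hg rfl rfl hβ hαβ q
      have hqu := hq _ hi
      obtain ⟨hkind, htab⟩ := hgate
      obtain ⟨Q, y, h5, h6, hU⟩ := htab ⟨q u.idx, hqu⟩
      simp only at h5 h6
      have hP : Fin.ofNat 4 (q u.idx) = ⟨q u.idx, hqu⟩ := Fin.ofNat_four_eq ⟨q u.idx, hqu⟩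
      have hstep : ∀ r, siteStep D (base + u.idx) u.idx ⟨q, k, r, x⟩ =
          ⟨Function.update q u.idx Q, k, r, (-1) ^ (y : ℕ) * x⟩ := by
        intro r
        rw [siteStep, hkind, if_neg (by norm_num), if_pos rfl]
        simp only [h5, h6, ite_neg_eq_pow y.2]
      rw [expect_cliffordOne (m := Q) (x := y) (by rw [hP, hU, Fin.ofNat_four_eq])]
      simp only [hstep]
      have := hout (Function.update q u.idx Q) k ((-1) ^ (y : ℕ) * x) (hq.update _ Q.2)
        (by rw [(p3 Q).2]; omega)
      rw [(p3 Q).1, abs_mul, abs_pow, abs_neg, abs_one, one_pow, one_mul] at this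
      have e : (((-1) ^ (y : ℕ) * x : ℝ) : ℂ) * expect ρ (Function.update q u.idx Q) =
          x * ((-1) ^ (y : ℕ) * expect ρ (Function.update q u.idx Q)) := by
        push_cast; ring
      rw [e] at this
      refine this.trans ?_
      rw [p1]
      gcongr
      have hz := clifford_one_eq_zero_iff hvalid.1 hU
      have hz' : q u.idx = 0 ↔ (Q : ℕ) = 0 := by
        rw [Fin.ext_iff, Fin.ext_iff] at hz
        simpa using hz
      simp only [← hz']
      split_ifs <;> linarith
    | cliffordTwo u v U =>
      simp only [Gate.lead, Gate.unitary] at *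
      have huv : u ≠ v := by
        rintro rfl
        have := hvalid.1
        simp [Site.Near] at this
      obtain ⟨R, S, T, hR, p1, p2, p3⟩ := potential_split_two hL hg huv hβ hαβ q
      have hqu := hq _ hi
      have hqv := hq _ v.idx_lt
      obtain ⟨hkind, h3, h4, htab⟩ := hgate
      obtain ⟨Q, Q', y, h5, h6, hU⟩ := htab ⟨q u.idx, hqu⟩ ⟨q v.idx, hqv⟩
      simp only at h5 h6
      have hP : Fin.ofNat 4 (q u.idx) = ⟨q u.idx, hqu⟩ := Fin.ofNat_four_eq ⟨q u.idx, hqu⟩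
      have hP' : Fin.ofNat 4 (q v.idx) = ⟨q v.idx, hqv⟩ := Fin.ofNat_four_eq ⟨q v.idx, hqv⟩
      have hdiv : (4 * (Q : ℕ) + Q') / 4 = Q := by omega
      have hmod : (4 * (Q : ℕ) + Q') % 4 = Q' := by omega
      have hstep : ∀ r, siteStep D (base + u.idx) u.idx ⟨q, k, r, x⟩ =
          ⟨Function.update (Function.update q u.idx Q) v.idx Q', k, r, (-1) ^ (y : ℕ) * x⟩ := by
        intro r
        rw [siteStep, hkind, if_neg (by norm_num), if_neg (by norm_num), if_pos rfl, if_pos h3]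
        simp only [h4, h5, h6, ite_neg_eq_pow y.2, hdiv, hmod]
      rw [expect_cliffordTwo huv (m := Q) (m' := Q') (x := y)
        (by rw [hP, hP', hU, Fin.ofNat_four_eq, Fin.ofNat_four_eq])]
      simp only [hstep]
      set q' := Function.update (Function.update q u.idx (Q : ℕ)) v.idx (Q' : ℕ)
      have := hout q' k ((-1) ^ (y : ℕ) * x) ((hq.update _ Q.2).update _ Q'.2)
        (by rw [(p3 Q Q').2]; omega)
      rw [(p3 Q Q').1, abs_mul, abs_pow, abs_neg, abs_one, one_pow, one_mul] at this
      have e : (((-1) ^ (y : ℕ) * x : ℝ) : ℂ) * expect ρ q' =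
          x * ((-1) ^ (y : ℕ) * expect ρ q') := by
        push_cast; ring
      rw [e] at this
      have hfac : (if (Q : ℕ) = 0 then 1 else β) * (if (Q' : ℕ) = 0 then 1 else β) ≤
          (if q u.idx = 0 then 1 else α) * (if q v.idx = 0 then 1 else α) := by
        have hz := clifford_two_eq_zero_iff hvalid.2.1 hU
        have hz' : (q u.idx = 0 ∧ q v.idx = 0) ↔ ((Q : ℕ) = 0 ∧ (Q' : ℕ) = 0) := by
          simp only [Fin.ext_iff] at hz
          simpa using hz
        rcases hc.2 with hsq | ⟨hswap, hab⟩
        · have hββ : β * β ≤ α := by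
            have := one_le_sqrt_two
            nlinarith
          have hαα : α ≤ α * α := le_mul_of_one_le_left (by linarith) hα
          by_cases h1 : q u.idx = 0 ∧ q v.idx = 0
          · have h2 := hz'.1 h1
            simp [h1, h2]
          · have hle : (if (Q : ℕ) = 0 then 1 else β) * (if (Q' : ℕ) = 0 then 1 else β) ≤
                β * β := by
              split_ifs <;> nlinarith
            refine hle.trans (hββ.trans ?_)
            split_ifs with h2 h3 h3
            · exact absurd ⟨h2, h3⟩ h1
            · linarith
            · linarith
            · exact hαα
        · obtain ⟨u', v', h⟩ := hswap _ hg
          cases h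
          obtain ⟨h1, h2⟩ := swap_table hU
          have e1 : (Q : ℕ) = q v.idx := by rw [h1]
          have e2 : (Q' : ℕ) = q u.idx := by rw [h2]
          rw [e1, e2, hab, mul_comm]
      refine this.trans (mul_le_mul_of_nonneg_right
        (mul_le_mul_of_nonneg_left ?_ (abs_nonneg x)) hE)
      rw [p1, ← mul_assoc, ← mul_assoc]
      exact mul_le_mul_of_nonneg_right hfac hR
  · push Not at hlead
    rw [gatesAt_eq_nil hlead, show Layer.unitary ([] : Layer a b) = 1 by simp [Layer.unitary]]
    have hproc := processed_succ_of_no_lead hlead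
    have hstep : ∀ r, siteStep D (base + i) i ⟨q, k, r, x⟩ = ⟨q, k, r, x⟩ := by
      intro r
      obtain ⟨w, rfl⟩ := Site.exists_idx_eq hi
      by_cases hw : ∃ g ∈ L, w ∈ g.support
      · obtain ⟨g, hg, hwg⟩ := hw
        have hne := hlead g hg
        have hgate := hD.gates w g hg hwg
        cases g with
        | tGate u =>
          have h : w = u := by simpa [Gate.support] using hwg
          exact absurd (by rw [Gate.lead, h]) hne
        | cliffordOne u U =>
          have h : w = u := by simpa [Gate.support] using hwg
          exact absurd (by rw [Gate.lead, h]) hne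
        | cliffordTwo u v U =>
          rw [siteStep, hgate.1, if_neg (by norm_num), if_neg (by norm_num), if_pos rfl, if_neg]
          rw [hgate.2.1]
          exact hne
      · push Not at hw
        rw [siteStep, hD.idle w hw]
        simp
    have hpot : potential L α β (i + 1) q = potential L α β i q := by
      refine Finset.prod_congr rfl fun u _ => ?_
      by_cases h : Processed L i u
      · rw [if_pos h, if_pos ((hproc u).2 h)]
      · rw [if_neg h, if_neg (mt (hproc u).1 h)]
    have hpend : pending L (i + 1) q = pending L i q := by
      refine Finset.sum_congr rfl fun u _ => ?_
      by_cases h : Processed L i u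
      · rw [if_pos h, if_pos ((hproc u).2 h)]
      · rw [if_neg h, if_neg (mt (hproc u).1 h)]
    rw [← hpot]
    simpa [hstep] using hout q k x hq (by rw [hpend]; exact hk)

/-- The sampling procedure for all sites of a layer whose table starts at the address `base`. -/
noncomputable def layerRun (D : Mem) (base n : ℕ) (σ : PathState) : PathState :=
  (List.range' 0 n).foldl (fun σ i => siteStep D (base + i) i σ) σ

/-- The error of the sampling procedure for the last `j` sites of a layer. -/
theorem sites_error {L : Layer a b} (hL : Layer.Valid L) {D : Mem} {base : ℕ}
    (hD : HoldsLayer D base L) {α β : ℝ} (hc : Compensates L α β)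
    (ρ : Op a b) (out : PathState → ℂ) {bits : ℕ} {E : ℝ} (hE : 0 ≤ E)
    (hout : ∀ q k x, IsString (a * b) q → bits + pending L (a * b) q ≤ k →
      ‖bitAvg k (fun r => out ⟨q, k, r, x⟩) - x * expect ρ q‖ ≤
        |x| * potential L α β (a * b) q * E) (j i : ℕ) (hij : i + j = a * b)
    {q : ℕ → ℕ} {k : ℕ} {x : ℝ} (hq : IsString (a * b) q) (hk : bits + pending L i q ≤ k) :
    ‖bitAvg k (fun r => out ((List.range' i j).foldl
        (fun σ i => siteStep D (base + i) i σ) ⟨q, k, r, x⟩)) -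
        x * expect (sitesUnitary L i j * ρ * (sitesUnitary L i j)ᴴ) q‖ ≤
      |x| * potential L α β i q * E := by
  induction j generalizing i q k x with
  | zero =>
    obtain rfl : i = a * b := by omega
    simpa [sitesUnitary] using hout q k x hq hk
  | succ j ih =>
    have h := siteStep_error hL hD hc (show i < a * b by omega)
      (sitesUnitary L (i + 1) j * ρ * (sitesUnitary L (i + 1) j)ᴴ)
      (fun σ => out ((List.range' (i + 1) j).foldl (fun σ i => siteStep D (base + i) i σ) σ)) hE
      (fun q k x hq hk => ih (i + 1) (by omega) hq hk) (x := x) hq hk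
    rw [sitesUnitary_succ, Matrix.conjTranspose_mul, List.range'_succ]
    simpa only [List.foldl_cons, Matrix.mul_assoc] using h

theorem processed_all (L : Layer a b) (u : Site a b) : Processed L (a * b) u :=
  fun g _ _ => g.lead.idx_lt

theorem potential_all (L : Layer a b) (α β : ℝ) (q : ℕ → ℕ) :
    potential L α β (a * b) q = β ^ weight (a * b) q := by
  rw [weight, ← Site.sum_idx fun i => if q i = 0 then 0 else 1, ← Finset.prod_pow_eq_pow_sum]
  refine Finset.prod_congr rfl fun u _ => ?_
  rw [if_pos (processed_all L u)]
  split_ifs <;> simp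

theorem pending_all (L : Layer a b) (q : ℕ → ℕ) : pending L (a * b) q = 0 := by
  refine Finset.sum_eq_zero fun u _ => ?_
  rw [if_pos (processed_all L u), ite_self]

theorem pending_le (L : Layer a b) (i : ℕ) (q : ℕ → ℕ) : pending L i q ≤ weight (a * b) q := by
  rw [weight, ← Site.sum_idx fun i => if q i = 0 then 0 else 1]
  refine Finset.sum_le_sum fun u _ => ?_
  split_ifs <;> simp

theorem potential_le (L : Layer a b) {α β : ℝ} (hβ : 1 ≤ β) (hαβ : β ≤ α) (i : ℕ) (q : ℕ → ℕ) :
    potential L α β i q ≤ α ^ weight (a * b) q := by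
  rw [weight, ← Site.sum_idx fun i => if q i = 0 then 0 else 1, ← Finset.prod_pow_eq_pow_sum]
  refine Finset.prod_le_prod (fun u _ => ?_) fun u _ => ?_
  · split_ifs <;> linarith
  · split_ifs <;> simp [hαβ]

/-- What the sampling procedure achieves for a whole layer. -/
theorem layerRun_error {L : Layer a b} (hL : Layer.Valid L) {D : Mem} {base : ℕ}
    (hD : HoldsLayer D base L) {α β : ℝ} (hc : Compensates L α β)
    (ρ : Op a b) (out : PathState → ℂ) {bits : ℕ} {E : ℝ} (hE : 0 ≤ E)
    (hout : ∀ q k x, IsString (a * b) q → bits ≤ k →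
      ‖bitAvg k (fun r => out ⟨q, k, r, x⟩) - x * expect ρ q‖ ≤ |x| * β ^ weight (a * b) q * E)
    {q : ℕ → ℕ} {k : ℕ} {x : ℝ} (hq : IsString (a * b) q) (hk : bits + weight (a * b) q ≤ k) :
    ‖bitAvg k (fun r => out (layerRun D base (a * b) ⟨q, k, r, x⟩)) -
        x * expect (Layer.unitary L * ρ * (Layer.unitary L)ᴴ) q‖ ≤
      |x| * α ^ weight (a * b) q * E := by
  rw [Layer.unitary_eq_sitesUnitary hL]
  refine (sites_error hL hD hc ρ out (bits := bits) hE ?_ (a * b) 0 (zero_add _) hq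
    ((Nat.add_le_add_left (pending_le L 0 q) _).trans hk)).trans ?_
  · intro q k x hq hk
    rw [potential_all]
    exact hout q k x hq (by rw [pending_all] at hk; exact hk)
  · have := potential_le L hc.1 hc.le 0 q
    gcongr

theorem siteStep_k_le (D : Mem) (adr i : ℕ) (σ : PathState) : (siteStep D adr i σ).k ≤ σ.k := by
  unfold siteStep
  split_ifs <;> simp

/-- Sampling steps keep Pauli strings nontrivial. -/
theorem siteStep_isString {L : Layer a b} (hL : Layer.Valid L) {D : Mem} {base : ℕ}
    (hD : HoldsLayer D base L) {i : ℕ} (hi : i < a * b) {σ : PathState}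
    (hq : IsString (a * b) σ.q) (hq0 : ∃ j < a * b, σ.q j ≠ 0) :
    IsString (a * b) (siteStep D (base + i) i σ).q ∧
      ∃ j < a * b, (siteStep D (base + i) i σ).q j ≠ 0 := by
  obtain ⟨q, k, r, x⟩ := σ
  simp only at hq hq0
  have keep : ∀ m : ℕ, m ≠ 0 → ∃ j < a * b, Function.update q i m j ≠ 0 := fun m hm =>
    ⟨i, hi, by simpa using hm⟩
  obtain ⟨w, rfl⟩ := Site.exists_idx_eq hi
  by_cases hw : ∃ g ∈ L, w ∈ g.support
  · obtain ⟨g, hg, hwg⟩ := hw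
    have hgate := hD.gates w g hg hwg
    have hvalid := hL.1 g hg
    have hqw := hq _ hi
    cases g with
    | tGate u =>
      have hT : D.natArr 2 (base + w.idx) = 1 := hgate
      simp only [siteStep, hT, if_true]
      by_cases h1 : q w.idx = 1 ∨ q w.idx = 2
      · rw [if_pos h1]
        by_cases h2 : 2 ^ (k - 1) ≤ r
        · rw [if_pos h2]
          exact ⟨IsString.update hq _ (by norm_num), keep 2 (by norm_num)⟩
        · rw [if_neg h2]
          exact ⟨IsString.update hq _ (by norm_num), keep 1 (by norm_num)⟩
      · rw [if_neg h1]
        exact ⟨hq, hq0⟩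
    | cliffordOne u U =>
      obtain ⟨hkind, htab⟩ := hgate
      obtain ⟨Q, y, h5, h6, hU⟩ := htab ⟨q w.idx, hqw⟩
      simp only at h5
      have hz := clifford_one_eq_zero_iff hvalid.1 hU
      have hz' : q w.idx = 0 ↔ (Q : ℕ) = 0 := by
        rw [Fin.ext_iff, Fin.ext_iff] at hz
        simpa using hz
      have : (siteStep D (base + w.idx) w.idx ⟨q, k, r, x⟩).q = Function.update q w.idx Q := by
        rw [siteStep, hkind, if_neg (by norm_num), if_pos rfl]
        simp only [h5]
      rw [this]
      refine ⟨IsString.update hq _ Q.2, ?_⟩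
      by_cases h0 : q w.idx = 0
      · have : Function.update q w.idx (Q : ℕ) = q := by
          rw [hz'.1 h0, ← h0, Function.update_eq_self]
        rw [this]
        exact hq0
      · exact keep _ fun h => h0 (hz'.2 h)
    | cliffordTwo u v U =>
      have huv : u ≠ v := by
        rintro rfl
        have := hvalid.1
        simp [Site.Near] at this
      have hidx : u.idx ≠ v.idx := fun h => huv (Site.idx_injective h)
      obtain ⟨hkind, h3, h4, htab⟩ := hgate
      by_cases hwu : u.idx = w.idx
      · obtain rfl := Site.idx_injective hwu
        have hqv := hq _ v.idx_lt
        obtain ⟨Q, Q', y, h5, h6, hU⟩ := htab ⟨q u.idx, hqw⟩ ⟨q v.idx, hqv⟩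
        simp only at h5
        have hz := clifford_two_eq_zero_iff hvalid.2.1 hU
        have hz' : (q u.idx = 0 ∧ q v.idx = 0) ↔ ((Q : ℕ) = 0 ∧ (Q' : ℕ) = 0) := by
          simp only [Fin.ext_iff] at hz
          simpa using hz
        have hdiv : (4 * (Q : ℕ) + Q') / 4 = Q := by omega
        have hmod : (4 * (Q : ℕ) + Q') % 4 = Q' := by omega
        have : (siteStep D (base + u.idx) u.idx ⟨q, k, r, x⟩).q =
            Function.update (Function.update q u.idx Q) v.idx Q' := by
          rw [siteStep, hkind, if_neg (by norm_num), if_neg (by norm_num), if_pos rfl, if_pos h3]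
          simp only [h4, h5, hdiv, hmod]
        rw [this]
        refine ⟨(IsString.update hq _ Q.2).update _ Q'.2, ?_⟩
        by_cases h0 : q u.idx = 0 ∧ q v.idx = 0
        · obtain ⟨e1, e2⟩ := hz'.1 h0
          obtain ⟨j, hj, hj0⟩ := hq0
          refine ⟨j, hj, ?_⟩
          have hju : j ≠ u.idx := fun h => hj0 (h ▸ h0.1)
          have hjv : j ≠ v.idx := fun h => hj0 (h ▸ h0.2)
          rwa [Function.update_of_ne hjv, Function.update_of_ne hju]
        · by_cases hQ' : (Q' : ℕ) = 0
          · have hQ : (Q : ℕ) ≠ 0 := fun hQ => h0 (hz'.2 ⟨hQ, hQ'⟩)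
            exact ⟨u.idx, u.idx_lt, by rwa [Function.update_of_ne hidx, Function.update_self]⟩
          · exact ⟨v.idx, v.idx_lt, by rwa [Function.update_self]⟩
      · have : siteStep D (base + w.idx) w.idx ⟨q, k, r, x⟩ = ⟨q, k, r, x⟩ := by
          rw [siteStep, hkind, if_neg (by norm_num), if_neg (by norm_num), if_pos rfl, if_neg]
          rwa [h3]
        rw [this]
        exact ⟨hq, hq0⟩
  · push Not at hw
    have : siteStep D (base + w.idx) w.idx ⟨q, k, r, x⟩ = ⟨q, k, r, x⟩ := by
      rw [siteStep, hD.idle w hw]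
      simp
    rw [this]
    exact ⟨hq, hq0⟩

theorem layerRun_succ (D : Mem) (base n : ℕ) (σ : PathState) :
    layerRun D base (n + 1) σ = siteStep D (base + n) n (layerRun D base n σ) := by
  simp [layerRun, List.range'_concat]

theorem layerRun_isString {L : Layer a b} (hL : Layer.Valid L) {D : Mem} {base : ℕ}
    (hD : HoldsLayer D base L) {σ : PathState} (hq : IsString (a * b) σ.q)
    (hq0 : ∃ j < a * b, σ.q j ≠ 0) {i : ℕ} (hi : i ≤ a * b) :
    IsString (a * b) (layerRun D base i σ).q ∧ (∃ j < a * b, (layerRun D base i σ).q j ≠ 0) ∧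
      (layerRun D base i σ).k ≤ σ.k := by
  induction i with
  | zero => exact ⟨hq, hq0, le_rfl⟩
  | succ i ih =>
    obtain ⟨h1, h2, h3⟩ := ih (by omega)
    rw [layerRun_succ]
    obtain ⟨h4, h5⟩ := siteStep_isString hL hD (i := i) (by omega) h1 h2
    exact ⟨h4, h5, (siteStep_k_le _ _ _ _).trans h3⟩

/-! ### The error of the sampling procedure for a circuit -/

/-- The contribution of the Pauli matrix `m` at the site `i` to the expectation value in the initial
product state. -/
noncomputable def blochFactor (D : Mem) (i m : ℕ) : ℝ := if m = 0 then 1 else D.realArr (m + 1) i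

/-- The sampling procedure for the first `t` layers of a circuit, processed from the last one to the
first one. A path is abandoned once its total weight, counted over all layers of noise, exceeds
`budget`. -/
noncomputable def samplePath (D : Mem) (n : ℕ) : ℕ → ℕ → PathState → ℝ
  | 0, budget, σ => if budget < weight n σ.q then 0 else
      σ.x * (1 - D.real 1) ^ weight n σ.q * ∏ i ∈ Finset.range n, blochFactor D i (σ.q i)
  | t + 1, budget, σ => if budget < weight n σ.q then 0 else
      samplePath D n t (budget - weight n σ.q)
        (layerRun D (t * n) n ⟨σ.q, σ.k, σ.r, σ.x * (1 - D.real 1) ^ weight n σ.q⟩)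

/-- The output of a noisy circuit whose layers are listed from the last one to the first one. -/
noncomputable def noisyRev (p : ℝ) (ρ : Op a b) : List (Layer a b) → Op a b
  | [] => depolarize p ρ
  | L :: R => depolarize p (Layer.unitary L * noisyRev p ρ R * (Layer.unitary L)ᴴ)

theorem Circuit.noisy_eq_noisyRev (C : Circuit a b) (p : ℝ) (ρ : Op a b) :
    C.noisy p ρ = noisyRev p ρ C.reverse := by
  induction C using List.reverseRecOn with
  | nil => rfl
  | append_singleton C L ih =>
    rw [Circuit.noisy, List.foldl_append, List.reverse_append]
    rw [Circuit.noisy] at ih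
    rw [ih]
    rfl

/-- Memory with the tables of a circuit whose layers are listed from the last one to the first
one. -/
def HoldsRev (D : Mem) : List (Layer a b) → Prop
  | [] => True
  | L :: R => HoldsLayer D (R.length * (a * b)) L ∧ HoldsRev D R

/-- `Contracts θ R g`: for circuits with the layers `R`, listed from the last one to the first one,
noise that shrinks every nontrivial Pauli factor by `θ` makes up for the growth of Pauli paths, if
nontrivial factors at the end are weighted by `g`. -/
def Contracts (θ : ℝ) : List (Layer a b) → ℝ → Prop
  | [], g => 1 ≤ g
  | L :: R, g => 1 ≤ g ∧ ∃ α β, Compensates L α β ∧ Contracts θ R β ∧ θ * α ≤ g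

theorem Contracts.one_le {θ g : ℝ} {R : List (Layer a b)} (h : Contracts θ R g) : 1 ≤ g := by
  cases R with
  | nil => exact h
  | cons L R => exact h.1

theorem pauli_zero : pauli 0 = 1 := by
  ext i j
  fin_cases i <;> fin_cases j <;> simp [pauli]

theorem pauli_mul_self (P : Fin 4) : pauli P * pauli P = 1 := by
  ext i j
  fin_cases P <;> fin_cases i <;> fin_cases j <;> simp [pauli, Matrix.mul_apply]

/-- Bloch vectors are real, with entries of absolute value at most one, since the expectation values
of `1 ± P = (1 ± P) ^ 2 / 2` are nonnegative. -/
theorem IsDensity.trace_pauli {ρ : Matrix (Fin 2) (Fin 2) ℂ} (hρ : IsDensity ρ) (P : Fin 4) :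
    ∃ y : ℝ, (pauli P * ρ).trace = y ∧ |y| ≤ 1 := by
  have key : ∀ s : ℝ, s * s = 1 → (0 : ℂ) ≤ 1 + s * (pauli P * ρ).trace := by
    intro s hs
    have h1 := (hρ.1.mul_mul_conjTranspose_same (1 + (s : ℂ) • pauli P)).trace_nonneg
    have hs' : (s : ℂ) * s = 1 := by rw [← Complex.ofReal_mul, hs, Complex.ofReal_one]
    have h2 : (1 + (s : ℂ) • pauli P)ᴴ * (1 + (s : ℂ) • pauli P) =
        (2 : ℂ) • (1 + (s : ℂ) • pauli P) := by
      rw [Matrix.conjTranspose_add, Matrix.conjTranspose_smul, pauli_conjTranspose,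
        Matrix.conjTranspose_one, Complex.star_def, Complex.conj_ofReal]
      simp only [add_mul, mul_add, one_mul, mul_one, Matrix.smul_mul, Matrix.mul_smul, smul_smul,
        pauli_mul_self, hs', one_smul, two_smul]
      abel
    rw [Matrix.trace_mul_comm, ← Matrix.mul_assoc, h2, Matrix.smul_mul, Matrix.trace_smul, add_mul,
      Matrix.trace_add, one_mul, hρ.2, Matrix.smul_mul, Matrix.trace_smul, smul_eq_mul,
      smul_eq_mul] at h1
    have h3 : (0 : ℂ) ≤ ((1 / 2 : ℝ) : ℂ) := Complex.zero_le_real.2 (by norm_num)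
    have := mul_nonneg h3 h1
    rw [← mul_assoc] at this
    simpa using this
  have h1 := Complex.le_def.1 (key 1 (by norm_num))
  have h2 := Complex.le_def.1 (key (-1) (by norm_num))
  simp at h1 h2
  exact ⟨(pauli P * ρ).trace.re, Complex.ext (by simp) (by simpa using h1.2.symm),
    abs_le.2 ⟨by linarith, by linarith⟩⟩

/-- The memory `D` holds the noise rate and the Bloch vectors of the initial state. -/
structure HoldsNoise (D : Mem) (p : ℝ) (ρ : Site a b → Matrix (Fin 2) (Fin 2) ℂ) : Prop where
  noise : D.real 1 = p
  bloch : ∀ (u : Site a b) (P : Fin 4), P ≠ 0 →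
    D.realArr (P + 1) u.idx = (Matrix.trace (pauli P * ρ u)).re

theorem HoldsNoise.expect {D : Mem} {p : ℝ} {ρ : Site a b → Matrix (Fin 2) (Fin 2) ℂ}
    (hD : HoldsNoise D p ρ) (hρ : ∀ u, IsDensity (ρ u)) {q : ℕ → ℕ} (hq : IsString (a * b) q) :
    expect (productState ρ) q = (∏ i ∈ Finset.range (a * b), blochFactor D i (q i) : ℝ) ∧
      |∏ i ∈ Finset.range (a * b), blochFactor D i (q i)| ≤ 1 := by
  have key : ∀ u : Site a b, Matrix.trace (pauli (Fin.ofNat 4 (q u.idx)) * ρ u) =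
      blochFactor D u.idx (q u.idx) ∧ |blochFactor D u.idx (q u.idx)| ≤ 1 := by
    intro u
    have hqu := hq _ u.idx_lt
    rw [show Fin.ofNat 4 (q u.idx) = ⟨q u.idx, hqu⟩ from Fin.ofNat_four_eq ⟨q u.idx, hqu⟩]
    rw [blochFactor]
    split_ifs with h
    · have : (⟨q u.idx, hqu⟩ : Fin 4) = 0 := Fin.ext h
      rw [this, pauli_zero, one_mul, (hρ u).2]
      simp
    · obtain ⟨y, hy, hy1⟩ := (hρ u).trace_pauli ⟨q u.idx, hqu⟩
      have := hD.bloch u ⟨q u.idx, hqu⟩ fun h' => h (by simpa [Fin.ext_iff] using h')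
      simp only at this
      rw [this, hy, Complex.ofReal_re]
      exact ⟨rfl, hy1⟩
  rw [← Site.prod_idx fun i => blochFactor D i (q i)]
  constructor
  · rw [expect_productState, Complex.ofReal_prod]
    exact Finset.prod_congr rfl fun u _ => (key u).1
  · rw [Finset.abs_prod]
    exact Finset.prod_le_one (fun u _ => abs_nonneg _) fun u _ => (key u).2

section

variable {D : Mem} {p θ : ℝ} {ρ : Site a b → Matrix (Fin 2) (Fin 2) ℂ}

/-- Contraction bounds the expectation values of Pauli strings. -/
theorem Contracts.norm_expect_le (hD : HoldsNoise D p ρ) (hρ : ∀ u, IsDensity (ρ u)) (hp : p ≤ 1)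
    (hθ0 : 0 < θ) (hθ1 : θ ≤ 1) (hpθ : 1 - p ≤ θ ^ 2) {R : List (Layer a b)} {g : ℝ}
    (h : Contracts θ R g) (hR : ∀ L ∈ R, Layer.Valid L) (hT : HoldsRev D R) {q : ℕ → ℕ}
    (hq : IsString (a * b) q) :
    ‖expect (noisyRev p (productState ρ) R) q‖ ≤ (g * θ) ^ weight (a * b) q := by
  have hp0 : 0 ≤ 1 - p := by linarith
  have hnorm : ∀ w : ℕ, ‖(1 - p : ℂ) ^ w‖ = (1 - p) ^ w := by
    intro w
    rw [← Complex.ofReal_one, ← Complex.ofReal_sub, norm_pow, Complex.norm_real, Real.norm_eq_abs,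
      abs_of_nonneg hp0]
  induction R generalizing g q with
  | nil =>
    obtain ⟨h1, h2⟩ := hD.expect hρ hq
    rw [noisyRev, expect_depolarize p _ q hq, norm_mul, hnorm, h1, Complex.norm_real,
      Real.norm_eq_abs]
    refine (mul_le_of_le_one_right (pow_nonneg hp0 _) h2).trans (pow_le_pow_left₀ hp0 ?_ _)
    have : 1 ≤ g := h
    nlinarith
  | cons L R ih =>
    obtain ⟨hg, α, β, hc, hβ, hα⟩ := h
    have hL := hR L (by simp)
    have hβ1 := hc.1
    have h1 : ∀ q k x, IsString (a * b) q → 0 ≤ k →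
        ‖bitAvg k (fun r => (fun _ => 0 : PathState → ℂ) ⟨q, k, r, x⟩) -
          x * expect (noisyRev p (productState ρ) R) q‖ ≤ |x| * β ^ weight (a * b) q * 1 := by
      intro q k x hq _
      rw [bitAvg_const, zero_sub, norm_neg, norm_mul, Complex.norm_real, Real.norm_eq_abs, mul_one]
      refine mul_le_mul_of_nonneg_left ?_ (abs_nonneg x)
      refine (ih hβ (fun L' hL' => hR L' (by simp [hL'])) hT.2 hq).trans ?_
      refine pow_le_pow_left₀ (by positivity) ?_ _
      nlinarith
    have h2 := layerRun_error hL hT.1 hc (noisyRev p (productState ρ) R) (fun _ => 0) (bits := 0)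
      zero_le_one h1 hq (x := 1) (k := weight (a * b) q) (zero_add _).le
    rw [bitAvg_const, zero_sub, norm_neg, norm_mul, Complex.norm_real, Real.norm_eq_abs, mul_one,
      abs_one, one_mul, one_mul] at h2
    rw [noisyRev, expect_depolarize p _ q hq, norm_mul, hnorm]
    have hα0 : 0 ≤ α := by linarith [hc.le]
    calc _ ≤ (1 - p) ^ weight (a * b) q * α ^ weight (a * b) q := by gcongr
      _ = ((1 - p) * α) ^ weight (a * b) q := (mul_pow _ _ _).symm
      _ ≤ (g * θ) ^ weight (a * b) q := by
        refine pow_le_pow_left₀ (by positivity) ?_ _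
        calc (1 - p) * α ≤ θ ^ 2 * α := by gcongr
          _ = (θ * α) * θ := by ring
          _ ≤ g * θ := by gcongr

/-- The error of the sampling procedure, averaged over the random bits. -/
theorem Contracts.samplePath_error (hD : HoldsNoise D p ρ) (hρ : ∀ u, IsDensity (ρ u))
    (hp : p ≤ 1) (hθ0 : 0 < θ) (hθ1 : θ ≤ 1) (hpθ : 1 - p ≤ θ ^ 2) {R : List (Layer a b)} {g : ℝ}
    (h : Contracts θ R g) (hR : ∀ L ∈ R, Layer.Valid L) (hT : HoldsRev D R) {q : ℕ → ℕ}
    (hq : IsString (a * b) q) {budget k : ℕ} (hk : budget ≤ k) (x : ℝ) :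
    ‖bitAvg k (fun r => (samplePath D (a * b) R.length budget ⟨q, k, r, x⟩ : ℂ)) -
      x * expect (noisyRev p (productState ρ) R) q‖ ≤
      |x| * g ^ weight (a * b) q * θ ^ budget := by
  have hp0 : 0 ≤ 1 - p := by linarith
  induction R generalizing g q budget k x with
  | nil =>
    by_cases hb : budget < weight (a * b) q
    · have := h.norm_expect_le hD hρ hp hθ0 hθ1 hpθ hR hT hq
      simp only [List.length_nil, samplePath, if_pos hb, Complex.ofReal_zero]
      rw [bitAvg_const, zero_sub, norm_neg, norm_mul, Complex.norm_real, Real.norm_eq_abs, mul_assoc]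
      refine mul_le_mul_of_nonneg_left (this.trans ?_) (abs_nonneg x)
      rw [mul_pow]
      have hg := h.one_le
      gcongr ?_ * ?_
      exact pow_le_pow_of_le_one hθ0.le hθ1 hb.le
    · obtain ⟨h1, -⟩ := hD.expect hρ hq
      simp only [List.length_nil, samplePath, if_neg hb, hD.noise]
      rw [bitAvg_const, noisyRev, expect_depolarize p _ q hq, h1]
      have hg := h.one_le
      have : (0 : ℝ) ≤ |x| * g ^ weight (a * b) q * θ ^ budget := by positivity
      refine le_of_eq_of_le ?_ this
      rw [norm_eq_zero]
      push_cast
      ring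
  | cons L R ih =>
    by_cases hb : budget < weight (a * b) q
    · have := h.norm_expect_le hD hρ hp hθ0 hθ1 hpθ hR hT hq
      simp only [List.length_cons, samplePath, if_pos hb, Complex.ofReal_zero]
      rw [bitAvg_const, zero_sub, norm_neg, norm_mul, Complex.norm_real, Real.norm_eq_abs, mul_assoc]
      refine mul_le_mul_of_nonneg_left (this.trans ?_) (abs_nonneg x)
      rw [mul_pow]
      have hg := h.one_le
      gcongr ?_ * ?_
      exact pow_le_pow_of_le_one hθ0.le hθ1 hb.le
    · obtain ⟨hg, α, β, hc, hβ, hα⟩ := h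
      set w := weight (a * b) q with hw
      have hα0 : 0 ≤ α := by linarith [hc.le, hc.1]
      have h2 := layerRun_error (hR L (by simp)) hT.1 hc (noisyRev p (productState ρ) R)
        (fun σ => (samplePath D (a * b) R.length (budget - w) σ : ℂ)) (pow_nonneg hθ0.le (budget - w))
        (fun q k x hq hk => ih hβ (fun L' hL' => hR L' (by simp [hL'])) hT.2 hq hk x) hq
        (k := k) (x := x * (1 - p) ^ w) (by omega)
      simp only [List.length_cons, samplePath, ← hw, if_neg hb, hD.noise]
      rw [noisyRev, expect_depolarize p _ q hq, ← hw]
      refine le_trans (le_of_eq ?_) (h2.trans ?_)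
      · push_cast
        rw [mul_assoc (x : ℂ)]
      · rw [abs_mul, abs_pow, abs_of_nonneg hp0, ← hw]
        have hle : ((1 - p) * α) ^ w ≤ (g * θ) ^ w := by
          refine pow_le_pow_left₀ (by positivity) ?_ _
          calc (1 - p) * α ≤ θ ^ 2 * α := by gcongr
            _ = (θ * α) * θ := by ring
            _ ≤ g * θ := by gcongr
        have hsplit : θ ^ budget = θ ^ w * θ ^ (budget - w) := by
          rw [← pow_add]; congr 1; omega
        calc |x| * (1 - p) ^ w * α ^ w * θ ^ (budget - w)
            = |x| * ((1 - p) * α) ^ w * θ ^ (budget - w) := by rw [mul_pow]; ring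
          _ ≤ |x| * (g * θ) ^ w * θ ^ (budget - w) := by gcongr
          _ = |x| * g ^ w * θ ^ budget := by rw [mul_pow, hsplit]; ring

end

/-! ### Contraction of Pauli paths in variational circuits -/

/-- A list of layers, of which `j` are known to consist of SWAP gates, and `i` further ones. -/
inductive Mixed : ℕ → ℕ → List (Layer a b) → Prop
  | nil : Mixed 0 0 []
  | compute {i j : ℕ} {X : List (Layer a b)} (L : Layer a b) (h : Mixed i j X) :
      Mixed (i + 1) j (L :: X)
  | swap {i j : ℕ} {X : List (Layer a b)} {L : Layer a b} (hL : IsSwapLayer L) (h : Mixed i j X) :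
      Mixed i (j + 1) (L :: X)

namespace Mixed

theorem append {i j i' j' : ℕ} {X Y : List (Layer a b)} (hX : Mixed i j X) (hY : Mixed i' j' Y) :
    Mixed (i + i') (j + j') (X ++ Y) := by
  induction hX with
  | nil => simpa using hY
  | compute L _ ih => rw [Nat.add_right_comm]; exact ih.compute L
  | swap hL _ ih => rw [Nat.add_right_comm]; exact ih.swap hL

theorem reverse {i j : ℕ} {X : List (Layer a b)} (hX : Mixed i j X) : Mixed i j X.reverse := by
  induction hX with
  | nil => exact nil
  | compute L _ ih => rw [List.reverse_cons]; exact ih.append (nil.compute L)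
  | swap hL _ ih => rw [List.reverse_cons]; exact ih.append (nil.swap hL)

theorem of_circuit (C : Circuit a b) : Mixed C.length 0 C := by
  induction C with
  | nil => exact nil
  | cons L C ih => exact ih.compute L

theorem of_swapLayers (S : List (SwapLayer a b)) :
    Mixed 0 S.length (S.map SwapLayer.toLayer) := by
  induction S with
  | nil => exact nil
  | cons L S ih =>
    refine ih.swap fun g hg => ?_
    obtain ⟨e, -, rfl⟩ := List.mem_map.1 hg
    exact ⟨_, _, rfl⟩

theorem flatten_ofFn {n : ℕ} {i j : Fin n → ℕ} {X : Fin n → List (Layer a b)}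
    (h : ∀ k, Mixed (i k) (j k) (X k)) :
    Mixed (∑ k, i k) (∑ k, j k) (List.ofFn X).flatten := by
  induction n with
  | zero => simpa using nil
  | succ n ih =>
    rw [List.ofFn_succ, List.flatten_cons, Fin.sum_univ_succ, Fin.sum_univ_succ]
    exact (h 0).append (ih fun k => h k.succ)

end Mixed

theorem Ansatz.mixed (A : Ansatz a b) (j : Fin A.m) :
    Mixed ((∑ k, (A.V j k).length) + (A.mixer j).length) A.overhead (A.mixer j ++ A.cost j) := by
  have h := (Mixed.flatten_ofFn fun k : Fin A.M =>
    (Mixed.of_circuit (A.V j k.castSucc)).append (Mixed.of_swapLayers (A.S k))).append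
      (Mixed.of_circuit (A.V j (Fin.last A.M)))
  have h2 := (Mixed.of_circuit (A.mixer j)).append h
  rw [Fin.sum_univ_castSucc, add_comm]
  simpa [Ansatz.overhead, Ansatz.cost] using h2

/-- The weight `2 ^ (f - 1 / 2)` of a nontrivial Pauli factor with exponent `f`: in these terms a
layer of SWAP gates adds a constant to `f`, and a computing layer halves it. -/
noncomputable def factorWeight (f : ℝ) : ℝ := (2 : ℝ) ^ (f - 1 / 2)

theorem one_le_factorWeight {f : ℝ} (hf : 1 / 2 ≤ f) : 1 ≤ factorWeight f :=
  Real.one_le_rpow (by norm_num) (by linarith)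

theorem sqrt_two_mul_factorWeight (f : ℝ) : √2 * factorWeight (f / 2) ^ 2 = factorWeight f := by
  rw [factorWeight, factorWeight, Real.sqrt_eq_rpow, ← Real.rpow_natCast, ← Real.rpow_mul (by norm_num),
    ← Real.rpow_add (by norm_num)]
  congr 1
  push_cast
  ring

theorem mul_factorWeight_add (f τ : ℝ) :
    (2 : ℝ) ^ (-τ) * factorWeight (f + τ) = factorWeight f := by
  rw [factorWeight, factorWeight, ← Real.rpow_add (by norm_num)]
  congr 1
  ring

/-- The worst order is to meet all layers of SWAP gates first: the computing layers then also halve what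
the SWAP layers have gained. The condition on `f` keeps all exponents at `1 / 2` or above. -/
theorem Mixed.contracts {τ : ℝ} (hτ : 0 ≤ τ) {i j : ℕ} {X : List (Layer a b)} (hX : Mixed i j X)
    {R : List (Layer a b)} {f : ℝ} (hf : 2 ^ i * (1 / 2) ≤ f)
    (hR : ∀ f', (f + τ * j) / 2 ^ i ≤ f' → Contracts (2 ^ (-τ)) R (factorWeight f')) :
    Contracts (2 ^ (-τ)) (X ++ R) (factorWeight f) := by
  induction hX generalizing f with
  | nil => exact hR f (by simp)
  | @compute i j X L hX ih =>
    have h2 : (1 : ℝ) ≤ 2 ^ i := one_le_pow₀ (by norm_num)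
    rw [pow_succ] at hf
    have hf' : 1 / 2 ≤ f / 2 := by linarith
    refine ⟨one_le_factorWeight (by linarith), factorWeight f, factorWeight (f / 2),
      ⟨one_le_factorWeight hf', Or.inl (sqrt_two_mul_factorWeight f).le⟩,
      ih (by linarith) fun f' hf' => hR f' (le_trans ?_ hf'), ?_⟩
    · rw [pow_succ, mul_comm ((2 : ℝ) ^ i), ← div_div]
      gcongr
      have : 0 ≤ τ * j := by positivity
      linarith
    · refine mul_le_of_le_one_left (by unfold factorWeight; positivity) ?_
      exact Real.rpow_le_one_of_one_le_of_nonpos (by norm_num) (by linarith)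
  | @swap i j X L hL hX ih =>
    have h2 : (1 : ℝ) ≤ 2 ^ i := one_le_pow₀ (by norm_num)
    refine ⟨one_le_factorWeight (by linarith), factorWeight (f + τ), factorWeight (f + τ),
      ⟨one_le_factorWeight (by linarith), Or.inr ⟨hL, rfl⟩⟩,
      ih (by linarith) fun f' hf' => hR f' (le_trans (le_of_eq ?_) hf'),
      (mul_factorWeight_add f τ).le⟩
    push_cast
    ring

/-- Repeated blocks with at most `c` computing layers and enough layers of SWAP gates. -/
theorem contracts_flatten {τ : ℝ} (hτ : 0 ≤ τ) {c lam : ℕ} (hlam : 2 ^ c * (2 ^ c * (1 / 2)) ≤ τ * lam)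
    {B : List (List (Layer a b))} (hB : ∀ X ∈ B, ∃ i ≤ c, Mixed i lam X) {f : ℝ}
    (hf : 2 ^ c * (1 / 2) ≤ f) :
    Contracts (2 ^ (-τ)) B.flatten (factorWeight f) := by
  have h2 : (1 : ℝ) ≤ 2 ^ c := one_le_pow₀ (by norm_num)
  induction B generalizing f with
  | nil => exact one_le_factorWeight (by linarith)
  | cons X B ih =>
    obtain ⟨i, hi, hX⟩ := hB X (by simp)
    have hic : (2 : ℝ) ^ i ≤ 2 ^ c := pow_le_pow_right₀ (by norm_num) hi
    refine hX.contracts hτ (by linarith) fun f' hf' =>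
      ih (fun Y hY => hB Y (by simp [hY])) (le_trans ?_ hf')
    rw [le_div_iff₀ (by positivity)]
    nlinarith

theorem Ansatz.contracts {τ : ℝ} (hτ : 0 ≤ τ) {c : ℕ} {A : Ansatz a b}
    (hlam : 2 ^ c * (2 ^ c * (1 / 2)) ≤ τ * A.overhead)
    (hdepth : ∀ j, (∑ k, (A.V j k).length) + (A.mixer j).length ≤ c) :
    Contracts (2 ^ (-τ)) A.circuit.reverse (factorWeight (2 ^ c * (1 / 2))) := by
  rw [Ansatz.circuit, List.reverse_flatten]
  refine contracts_flatten hτ hlam (fun X hX => ?_) le_rfl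
  obtain ⟨Y, hY, rfl⟩ := List.mem_map.1 (List.mem_reverse.1 hX)
  obtain ⟨j, rfl⟩ := List.mem_ofFn.1 hY
  exact ⟨_, hdepth j, (A.mixed j).reverse⟩

theorem Mem.HoldsCircuit.holdsRev {s : Mem} {C : Circuit a b} {p : ℝ}
    {ρ : Site a b → Matrix (Fin 2) (Fin 2) ℂ} (hs : s.HoldsCircuit C p ρ) :
    HoldsRev s C.reverse := by
  suffices H : ∀ t ≤ C.length, HoldsRev s (C.take t).reverse by
    simpa using H C.length le_rfl
  intro t
  induction t with
  | zero => intro _; simp [HoldsRev]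
  | succ t ih =>
    intro ht
    rw [List.take_succ_eq_append_getElem (by omega), List.reverse_append, List.reverse_singleton,
      List.singleton_append]
    refine ⟨⟨fun w hw => ?_, fun w g hg hw => ?_⟩, ih (by omega)⟩
    · rw [List.length_reverse, List.length_take_of_le (by omega)]
      exact hs.idle t (by omega) w hw
    · rw [List.length_reverse, List.length_take_of_le (by omega)]
      exact hs.gates t (by omega) w g hg hw

theorem Mem.HoldsCircuit.holdsNoise {s : Mem} {C : Circuit a b} {p : ℝ}
    {ρ : Site a b → Matrix (Fin 2) (Fin 2) ℂ} (hs : s.HoldsCircuit C p ρ) :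
    HoldsNoise s p ρ := by
  refine ⟨hs.noise, fun u P hP => ?_⟩
  obtain ⟨h1, h2, h3⟩ := hs.bloch u
  fin_cases P
  · exact absurd rfl hP
  · exact h1
  · exact h2
  · exact h3

/-! ### Estimating the noisy energy -/

/-- The Pauli string `Z` at the site `u`. -/
def zString (u : Site a b) : ℕ → ℕ := Function.update 0 u.idx 3

/-- The Pauli string `Z Z` at the sites `u` and `v`. -/
def zzString (u v : Site a b) : ℕ → ℕ := Function.update (zString u) v.idx 3

theorem pauliString_zero : (pauliString 0 : Op a b) = 1 := by
  ext σ τ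
  have h0 : Fin.ofNat 4 0 = 0 := rfl
  simp only [pauliString, productState, Matrix.of_apply, Pi.zero_apply, h0, pauli_zero,
    Matrix.one_apply]
  by_cases h : σ = τ
  · simp [h]
  · rw [if_neg h]
    obtain ⟨u, hu⟩ := Function.ne_iff.1 h
    exact Finset.prod_eq_zero (Finset.mem_univ u) (if_neg hu)

/-- Multiplication with `Z` at a site on which a Pauli string is trivial. -/
theorem zOp_mul_pauliString {u : Site a b} {q : ℕ → ℕ} (h : q u.idx = 0) :
    zOp u * pauliString q = (pauliString (Function.update q u.idx 3) : Op a b) := by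
  have h0 : Fin.ofNat 4 0 = 0 := rfl
  have h3 : Fin.ofNat 4 3 = 3 := rfl
  rw [pauliString_eq_update q u, zOp, embedOne_mul_productState, pauliString_update, h, h0,
    pauli_zero, mul_one, h3]

theorem zOp_eq_pauliString (u : Site a b) : zOp u = pauliString (zString u) := by
  rw [zString, ← zOp_mul_pauliString (by rfl), pauliString_zero, mul_one]

theorem zOp_mul_zOp_eq_pauliString {u v : Site a b} (h : u ≠ v) :
    zOp u * zOp v = pauliString (zzString u v) := by
  have hidx : v.idx ≠ u.idx := fun h' => h (Site.idx_injective h').symm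
  rw [zOp_mul_comm, zOp_eq_pauliString u, zOp_mul_pauliString, zzString]
  rw [zString, Function.update_of_ne hidx]
  rfl

theorem isString_zString (u : Site a b) : IsString (a * b) (zString u) :=
  IsString.update (fun _ _ => by simp) _ (by norm_num)

theorem isString_zzString (u v : Site a b) : IsString (a * b) (zzString u v) :=
  (isString_zString u).update _ (by norm_num)

theorem weight_update_le (n : ℕ) (q : ℕ → ℕ) (i m : ℕ) :
    weight n (Function.update q i m) ≤ weight n q + 1 := by
  have h1 : ∑ j ∈ Finset.range n, (if i = j then 1 else 0) ≤ 1 := by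
    rw [Finset.sum_ite_eq]
    split_ifs <;> simp
  refine le_trans ?_ (Nat.add_le_add_left h1 _)
  rw [weight, weight, ← Finset.sum_add_distrib]
  refine Finset.sum_le_sum fun j _ => ?_
  by_cases h : j = i
  · subst h; rw [Function.update_self, if_pos rfl]; split_ifs <;> simp
  · rw [Function.update_of_ne h]; omega

theorem weight_zString_le (u : Site a b) : weight (a * b) (zString u) ≤ 1 :=
  (weight_update_le _ _ _ _).trans (by simp [weight])

theorem weight_zzString_le (u v : Site a b) : weight (a * b) (zzString u v) ≤ 2 :=
  (weight_update_le _ _ _ _).trans (Nat.add_le_add_right (weight_zString_le u) 1)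

theorem noisyEnergy_eq_sum {H : Ising a b} {l : List (Site a b × Site a b)}
    (hl : IsEdgeList H.graph l) (A : Ansatz a b) (p : ℝ)
    (ρ : Site a b → Matrix (Fin 2) (Fin 2) ℂ) :
    noisyEnergy H A p ρ =
      (l.map fun e => (H.J s(e.1, e.2) : ℂ) *
        expect (noisyRev p (productState ρ) A.circuit.reverse) (zzString e.1 e.2)).sum +
      ∑ u, (H.h u : ℂ) *
        expect (noisyRev p (productState ρ) A.circuit.reverse) (zString u) := by
  rw [noisyEnergy, Circuit.noisy_eq_noisyRev, Ising.op_eq_sum hl]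
  set Ω := noisyRev p (productState ρ) A.circuit.reverse
  rw [add_mul, Matrix.trace_add]
  congr 1
  · have hne : ∀ e ∈ l, e.1 ≠ e.2 := fun e he => (hl.adj he).ne
    clear hl
    induction l with
    | nil => simp
    | cons e l ih =>
      rw [List.map_cons, List.sum_cons, add_mul, Matrix.trace_add,
        ih fun e' he' => hne e' (List.mem_cons_of_mem _ he'), List.map_cons, List.sum_cons,
        zOp_mul_zOp_eq_pauliString (hne e (by simp)), Matrix.smul_mul, Matrix.trace_smul,
        smul_eq_mul, expect]
  · rw [Finset.sum_mul, Matrix.trace_sum]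
    refine Finset.sum_congr rfl fun u _ => ?_
    rw [zOp_eq_pauliString, Matrix.smul_mul, Matrix.trace_smul, smul_eq_mul, expect]

/-- The sum of the results of the sampling procedure over all strings of `B` random bits. -/
noncomputable def sampleSum (D : Mem) (n d B : ℕ) (q : ℕ → ℕ) (x : ℝ) : ℝ :=
  ∑ r ∈ Finset.range (2 ^ B), samplePath D n d B ⟨q, B, r, x⟩

theorem norm_sum_map_sub_le {α : Type*} {f g : α → ℂ} {C : ℝ} (l : List α)
    (h : ∀ e ∈ l, ‖f e - g e‖ ≤ C) : ‖(l.map f).sum - (l.map g).sum‖ ≤ l.length * C := by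
  induction l with
  | nil => simp
  | cons e l ih =>
    rw [List.map_cons, List.map_cons, List.sum_cons, List.sum_cons, add_sub_add_comm,
      List.length_cons]
    have h1 := h e (by simp)
    have h2 := ih fun e' he' => h e' (by simp [he'])
    have h3 := norm_add_le (f e - g e) ((l.map f).sum - (l.map g).sum)
    push_cast
    linarith

/-- The averages of the sampling procedure for all terms of the Hamiltonian approximate the noisy
energy. -/
theorem norm_estimate_sub_noisyEnergy_le {H : Ising a b} {l : List (Site a b × Site a b)}
    (hl : IsEdgeList H.graph l) {A : Ansatz a b} {p : ℝ}
    {ρ : Site a b → Matrix (Fin 2) (Fin 2) ℂ} (hρ : ∀ u, IsDensity (ρ u)) {D : Mem}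
    (hD : D.HoldsCircuit A.circuit p ρ) (hA : ∀ L ∈ A.circuit, Layer.Valid L) (hp : p ≤ 1)
    {θ g : ℝ} (hθ0 : 0 < θ) (hθ1 : θ ≤ 1) (hpθ : 1 - p ≤ θ ^ 2)
    (hg : Contracts θ A.circuit.reverse g) {J : ℝ} (hJ : ∀ e ∈ H.graph.edgeSet, |H.J e| ≤ J)
    (hh : ∀ u, |H.h u| ≤ J) (B : ℕ) :
    ‖(((l.map fun e => sampleSum D (a * b) A.circuit.length B (zzString e.1 e.2)
        (H.J s(e.1, e.2))).sum +
      ∑ u, sampleSum D (a * b) A.circuit.length B (zString u) (H.h u)) / 2 ^ B : ℝ) -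
      noisyEnergy H A p ρ‖ ≤ (l.length + (a * b : ℕ)) * (J * g ^ 2 * θ ^ B) := by
  set Ω := noisyRev p (productState ρ) A.circuit.reverse
  have hg1 := hg.one_le
  have key : ∀ q x, IsString (a * b) q → weight (a * b) q ≤ 2 → |x| ≤ J →
      ‖((sampleSum D (a * b) A.circuit.length B q x / 2 ^ B : ℝ) : ℂ) - x * expect Ω q‖ ≤
        J * g ^ 2 * θ ^ B := by
    intro q x hq hw hx
    have := hg.samplePath_error hD.holdsNoise hρ hp hθ0 hθ1 hpθ
      (fun L hL => hA L (List.mem_reverse.1 hL)) hD.holdsRev hq (le_refl B) x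
    rw [List.length_reverse, bitAvg] at this
    rw [sampleSum]
    push_cast
    refine this.trans ?_
    have hJ0 := (abs_nonneg x).trans hx
    have : g ^ weight (a * b) q ≤ g ^ 2 := pow_le_pow_right₀ hg1 hw
    gcongr
  rw [noisyEnergy_eq_sum hl]
  have e1 : ((((l.map fun e => sampleSum D (a * b) A.circuit.length B (zzString e.1 e.2)
        (H.J s(e.1, e.2))).sum +
      ∑ u, sampleSum D (a * b) A.circuit.length B (zString u) (H.h u)) / 2 ^ B : ℝ) : ℂ) =
      (l.map fun e => ((sampleSum D (a * b) A.circuit.length B (zzString e.1 e.2)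
        (H.J s(e.1, e.2)) / 2 ^ B : ℝ) : ℂ)).sum +
      ∑ u, ((sampleSum D (a * b) A.circuit.length B (zString u) (H.h u) / 2 ^ B : ℝ) : ℂ) := by
    rw [add_div, Finset.sum_div, Complex.ofReal_add, Complex.ofReal_sum]
    congr 1
    clear hl
    induction l with
    | nil => simp
    | cons e l ih =>
      rw [List.map_cons, List.sum_cons, add_div, List.map_cons, List.sum_cons, Complex.ofReal_add,
        ih]
  rw [e1, add_sub_add_comm]
  have h1 := norm_sum_map_sub_le (f := fun e : Site a b × Site a b =>
      ((sampleSum D (a * b) A.circuit.length B (zzString e.1 e.2)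
        (H.J s(e.1, e.2)) / 2 ^ B : ℝ) : ℂ))
    (g := fun e => (H.J s(e.1, e.2) : ℂ) * expect Ω (zzString e.1 e.2)) l fun e he =>
      key _ _ (isString_zzString _ _) (weight_zzString_le _ _)
        (hJ _ (by rw [SimpleGraph.mem_edgeSet]; exact hl.adj he))
  have h2 : ‖∑ u, ((sampleSum D (a * b) A.circuit.length B (zString u) (H.h u) / 2 ^ B : ℝ) : ℂ) -
      ∑ u, (H.h u : ℂ) * expect Ω (zString u)‖ ≤ (a * b : ℕ) * (J * g ^ 2 * θ ^ B) := by
    rw [← Finset.sum_sub_distrib]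
    refine (norm_sum_le_of_le _ fun u _ => key _ _ (isString_zString u)
      ((weight_zString_le u).trans (by norm_num)) (hh u)).trans ?_
    simp
  refine (norm_add_le _ _).trans ((add_le_add h1 h2).trans ?_)
  rw [add_mul]

/-! ### The program that samples a Pauli path -/

namespace Prog

/-- Splits the number `V < 16` in register `23` into `V / 4` in register `24` and `V % 4`. -/
def divModFour : Prog :=
  setNat 24 (.const 0) ;;
  cond (.natLe (.const 8) (.var 23))
    (setNat 23 (.sub (.var 23) (.const 8)) ;; setNat 24 (.const 2)) skip ;;
  cond (.natLe (.const 4) (.var 23))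
    (setNat 23 (.sub (.var 23) (.const 4)) ;; setNat 24 (.add (.var 24) (.const 1))) skip

/-- A `T` gate at the site in register `16`. -/
def siteT : Prog :=
  cond (.conj (.neg (.natEq (.arr 9 (.var 16)) (.const 1)))
      (.neg (.natEq (.arr 9 (.var 16)) (.const 2))))
    skip
    (setReal 8 (.mul (.var 8) (.sqrt (.cast (.const 2)))) ;;
     setNat 14 (.sub (.var 14) (.const 1)) ;;
     cond (.natLe (.arr 8 (.var 14)) (.var 18))
       (setNat 18 (.sub (.var 18) (.arr 8 (.var 14))) ;;
        cond (.natEq (.arr 9 (.var 16)) (.const 1)) (setReal 8 (.sub (.cast (.const 0)) (.var 8)))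
          skip ;;
        setNatArr 9 (.var 16) (.const 2))
       (setNatArr 9 (.var 16) (.const 1)))

/-- Changes the sign of the coefficient if the table entry in register `21` says so. -/
def applySign : Prog :=
  cond (.natEq (.arr 6 (.var 21)) (.const 1)) (setReal 8 (.sub (.cast (.const 0)) (.var 8))) skip

/-- A one-qubit Clifford gate at the site in register `16`. -/
def siteOne : Prog :=
  setNat 21 (.add (.smul 16 (.var 20)) (.arr 9 (.var 16))) ;;
  applySign ;;
  setNatArr 9 (.var 16) (.arr 5 (.var 21))

/-- A two-qubit Clifford gate with the first site in register `16`. -/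
def siteTwo : Prog :=
  setNat 22 (.arr 4 (.var 20)) ;;
  setNat 21 (.add (.smul 16 (.var 20)) (.add (.smul 4 (.arr 9 (.var 16))) (.arr 9 (.var 22)))) ;;
  applySign ;;
  setNat 23 (.arr 5 (.var 21)) ;;
  divModFour ;;
  setNatArr 9 (.var 16) (.var 24) ;;
  setNatArr 9 (.var 22) (.var 23)

/-- The sampling step at the site in register `16`. -/
def siteStep : Prog :=
  setNat 20 (.add (.var 11) (.var 16)) ;;
  cond (.natEq (.arr 2 (.var 20)) (.const 1)) siteT
    (cond (.natEq (.arr 2 (.var 20)) (.const 2)) siteOne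
      (cond (.conj (.natEq (.arr 2 (.var 20)) (.const 3)) (.natEq (.arr 3 (.var 20)) (.var 16)))
        siteTwo skip))

end Prog

/-- The tables that the sampling programs rely on: those parts of the input memory `D` that describe
the circuit, the numbers `n`, `d * n` and `B`, and the powers of two up to `2 ^ B`. -/
structure Ready (D : Mem) (n d B : ℕ) (s : Mem) : Prop where
  kind : s.natArr 2 = D.natArr 2
  first : s.natArr 3 = D.natArr 3
  second : s.natArr 4 = D.natArr 4
  table : s.natArr 5 = D.natArr 5
  sign : s.natArr 6 = D.natArr 6
  noise : s.real 1 = D.real 1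
  bloch : ∀ k, 2 ≤ k → k ≤ 4 → s.realArr k = D.realArr k
  depth : s.nat 3 = d
  sites : s.nat 8 = n
  base : s.nat 9 = d * n
  bits : s.nat 10 = B
  two_pow : ∀ i ≤ B, s.natArr 8 i = 2 ^ i
  strings : s.nat 25 = 2 ^ B

theorem Ready.frame {D s s' : Mem} {n d B : ℕ} {P : Prog} (h : Ready D n d B s) (hF : Frame P s s')
    (hP : (P.wNatArr 2 || P.wNatArr 3 || P.wNatArr 4 || P.wNatArr 5 || P.wNatArr 6 || P.wNatArr 8 ||
      P.wReal 1 || P.wRealArr 2 || P.wRealArr 3 || P.wRealArr 4 || P.wNat 3 || P.wNat 8 ||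
      P.wNat 9 || P.wNat 10 || P.wNat 25) = false) : Ready D n d B s' := by
  simp only [Bool.or_eq_false_iff] at hP
  obtain ⟨⟨⟨⟨⟨⟨⟨⟨⟨⟨⟨⟨⟨⟨h1, h2⟩, h3⟩, h4⟩, h5⟩, h6⟩, h7⟩, h8⟩, h9⟩, h10⟩, h11⟩, h12⟩, h13⟩, h14⟩,
    h15⟩ := hP
  refine ⟨(hF.natArr _ h1).trans h.kind, (hF.natArr _ h2).trans h.first,
    (hF.natArr _ h3).trans h.second, (hF.natArr _ h4).trans h.table,
    (hF.natArr _ h5).trans h.sign, (hF.real _ h7).trans h.noise, fun k hk hk' => ?_,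
    (hF.nat _ h11).trans h.depth, (hF.nat _ h12).trans h.sites, (hF.nat _ h13).trans h.base,
    (hF.nat _ h14).trans h.bits, ?_, (hF.nat _ h15).trans h.strings⟩
  · refine Eq.trans (hF.realArr _ ?_) (h.bloch k hk hk')
    interval_cases k <;> assumption
  · rw [hF.natArr _ h6]
    exact h.two_pow

/-- The memory holds the state of the sampling procedure, with the Pauli string on `n` sites. -/
structure HoldsPath (n : ℕ) (σ : PathState) (s : Mem) : Prop where
  q : ∀ j < n, s.natArr 9 j = σ.q j
  k : s.nat 14 = σ.k
  r : s.nat 18 = σ.r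
  x : s.real 8 = σ.x

theorem HoldsPath.update {n i m : ℕ} {q q' : ℕ → ℕ} (h : ∀ j < n, q j = q' j) :
    ∀ j < n, Function.update q i m j = Function.update q' i m j := by
  intro j hj
  simp only [Function.update_apply, h j hj]

theorem runs_siteT {D s : Mem} {n d B i adr : ℕ} {σ : PathState} (hr : Ready D n d B s)
    (h16 : s.nat 16 = i) (hi : i < n) (hσ : HoldsPath n σ s) (hk : σ.k ≤ B)
    (hkind : D.natArr 2 adr = 1) :
    Runs Prog.siteT s Prog.siteT.cost (HoldsPath n (siteStep D adr i σ)) := by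
  refine Runs.of_run rfl ?_
  have hqi := hσ.q i hi
  have hpw := hr.two_pow (σ.k - 1) (by omega)
  obtain ⟨q, k, r, x⟩ := σ
  obtain ⟨hq, hk', hr', hx⟩ := hσ
  simp only at hq hk' hr' hx hqi hpw hk
  by_cases h12 : q i = 1 ∨ q i = 2
  · have hc : ¬ (¬ q i = 1 ∧ ¬ q i = 2) := by tauto
    by_cases hb : 2 ^ (k - 1) ≤ r
    · rw [siteStep, if_pos hkind, if_pos h12, if_pos hb]
      by_cases h1 : q i = 1
      · constructor <;>
        simp +contextual [Prog.siteT, Prog.run, NExpr.eval, RExpr.eval, Test.Holds, h16, hqi, hpw,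
          hk', hr', hx, hb, h1, Function.update_apply, hq]
      · have h2 : q i = 2 := h12.resolve_left h1
        constructor <;>
        simp +contextual [Prog.siteT, Prog.run, NExpr.eval, RExpr.eval, Test.Holds, h16, hqi, hpw,
          hk', hr', hx, hb, h2, Function.update_apply, hq]
    · rw [siteStep, if_pos hkind, if_pos h12, if_neg hb]
      constructor <;>
      simp +contextual [Prog.siteT, Prog.run, NExpr.eval, RExpr.eval, Test.Holds, h16, hqi, hc, hpw,
        hk', hr', hx, hb, Function.update_apply, hq]
  · rw [siteStep, if_pos hkind, if_neg h12]
    have hc : ¬ q i = 1 ∧ ¬ q i = 2 := by tauto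
    have : Prog.siteT.run s = s := by
      simp [Prog.siteT, Prog.run, NExpr.eval, Test.Holds, h16, hqi, hc]
    rw [this]
    exact ⟨hq, hk', hr', hx⟩

theorem runs_applySign {D s : Mem} {n d B adr : ℕ} (hr : Ready D n d B s) (h21 : s.nat 21 = adr) :
    Runs Prog.applySign s Prog.applySign.cost
      (fun s' => s'.real 8 = if D.natArr 6 adr = 1 then -s.real 8 else s.real 8) := by
  refine Runs.of_run rfl ?_
  by_cases h : D.natArr 6 adr = 1 <;>
  simp [Prog.applySign, Prog.run, NExpr.eval, RExpr.eval, Test.Holds, h21, hr.sign, h]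

theorem runs_divModFour {s : Mem} {V : ℕ} (h23 : s.nat 23 = V) (hV : V < 16) :
    Runs Prog.divModFour s Prog.divModFour.cost
      (fun s' => s'.nat 24 = V / 4 ∧ s'.nat 23 = V % 4) := by
  refine Runs.of_run rfl ?_
  have h1 : 12 ≤ V ∨ 8 ≤ V ∧ V < 12 ∨ 4 ≤ V ∧ V < 8 ∨ V < 4 := by omega
  rcases h1 with h | h | h | h
  · have h2 : 8 ≤ V := by omega
    have h3 : 4 ≤ V - 8 := by omega
    simp [Prog.divModFour, Prog.run, NExpr.eval, Test.Holds, h23, h2, h3]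
    omega
  · have h3 : ¬ 4 ≤ V - 8 := by omega
    simp [Prog.divModFour, Prog.run, NExpr.eval, Test.Holds, h23, h.1, h3]
    omega
  · have h2 : ¬ 8 ≤ V := by omega
    simp [Prog.divModFour, Prog.run, NExpr.eval, Test.Holds, h23, h.1, h2]
    omega
  · have h2 : ¬ 8 ≤ V := by omega
    have h3 : ¬ 4 ≤ V := by omega
    simp [Prog.divModFour, Prog.run, NExpr.eval, Test.Holds, h23, h2, h3]
    omega

theorem runs_siteOne {D s : Mem} {n d B i adr : ℕ} {σ : PathState} (hr : Ready D n d B s)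
    (h16 : s.nat 16 = i) (h20 : s.nat 20 = adr) (hi : i < n) (hσ : HoldsPath n σ s)
    (hkind : D.natArr 2 adr = 2) :
    Runs Prog.siteOne s Prog.siteOne.cost (HoldsPath n (siteStep D adr i σ)) := by
  have h1 : ¬ D.natArr 2 adr = 1 := by omega
  rw [siteStep, if_neg h1, if_pos hkind]
  refine Runs.seq_frame (Runs.of_run (P := .setNat 21 _) rfl
    (Q := fun s' => s'.nat 21 = 16 * adr + σ.q i) ?_) fun s1 hF1 h21 => ?_
  · simp [Prog.run, NExpr.eval, NExpr.eval_smul, h16, h20, hσ.q i hi]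
  refine Runs.seq_frame (runs_applySign (hr.frame hF1 rfl) h21) fun s2 hF2 h8 => ?_
  refine Runs.of_run (P := .setNatArr 9 _ _) rfl ⟨?_, ?_, ?_, ?_⟩
  · intro j hj
    simp [Prog.run, NExpr.eval, hF2.nat 16 rfl, hF1.nat 16 rfl, hF2.nat 21 rfl, h21, h16,
      hF2.natArr 9 rfl, hF1.natArr 9 rfl, hF2.natArr 5 rfl, hF1.natArr 5 rfl, hr.table,
      HoldsPath.update hσ.q j hj]
  · simp [Prog.run, hF2.nat 14 rfl, hF1.nat 14 rfl, hσ.k]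
  · simp [Prog.run, hF2.nat 18 rfl, hF1.nat 18 rfl, hσ.r]
  · simp [Prog.run, h8, hF1.real 8 rfl, hσ.x]

theorem runs_siteTwo {D s : Mem} {n d B i adr : ℕ} {σ : PathState} (hr : Ready D n d B s)
    (h16 : s.nat 16 = i) (h20 : s.nat 20 = adr) (hi : i < n) (hσ : HoldsPath n σ s)
    (hkind : D.natArr 2 adr = 3) (hfirst : D.natArr 3 adr = i) (hsecond : D.natArr 4 adr < n)
    (hV : D.natArr 5 (16 * adr + (4 * σ.q i + σ.q (D.natArr 4 adr))) < 16) :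
    Runs Prog.siteTwo s Prog.siteTwo.cost (HoldsPath n (siteStep D adr i σ)) := by
  have h1 : ¬ D.natArr 2 adr = 1 := by omega
  have h2 : ¬ D.natArr 2 adr = 2 := by omega
  rw [siteStep, if_neg h1, if_neg h2, if_pos hkind, if_pos hfirst]
  set j := D.natArr 4 adr with hj
  set e := 16 * adr + (4 * σ.q i + σ.q j) with he
  refine Runs.seq_frame (Runs.of_run (P := .setNat 22 _) rfl
    (Q := fun s' => s'.nat 22 = j) ?_) fun s1 hF1 h22 => ?_
  · simp [Prog.run, NExpr.eval, h20, hr.second, hj]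
  refine Runs.seq_frame (Runs.of_run (P := .setNat 21 _) rfl
    (Q := fun s' => s'.nat 21 = e) ?_) fun s2 hF2 h21 => ?_
  · simp [Prog.run, NExpr.eval, NExpr.eval_smul, hF1.nat 16 rfl, hF1.nat 20 rfl, h16, h20, h22,
      hF1.natArr 9 rfl, hσ.q i hi, hσ.q j hsecond, he]
  have hr2 := (hr.frame hF1 rfl).frame hF2 rfl
  refine Runs.seq_frame (runs_applySign hr2 h21) fun s3 hF3 h8 => ?_
  refine Runs.seq_frame (Runs.of_run (P := .setNat 23 _) rfl
    (Q := fun s' => s'.nat 23 = D.natArr 5 e) ?_) fun s4 hF4 h23 => ?_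
  · simp [Prog.run, NExpr.eval, hF3.nat 21 rfl, h21, hF3.natArr 5 rfl, hr2.table]
  refine Runs.seq_frame (runs_divModFour h23 hV) fun s5 hF5 h5 => ?_
  refine Runs.of_run (P := .setNatArr 9 _ _ ;; .setNatArr 9 _ _) rfl ⟨?_, ?_, ?_, ?_⟩
  · intro j' hj'
    simp [Prog.run, NExpr.eval, h5, hF5.nat 16 rfl, hF4.nat 16 rfl, hF3.nat 16 rfl, hF2.nat 16 rfl,
      hF1.nat 16 rfl, h16, hF5.nat 22 rfl, hF4.nat 22 rfl, hF3.nat 22 rfl, hF2.nat 22 rfl, h22,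
      hF5.natArr 9 rfl, hF4.natArr 9 rfl, hF3.natArr 9 rfl, hF2.natArr 9 rfl, hF1.natArr 9 rfl]
    exact HoldsPath.update (HoldsPath.update hσ.q) j' hj'
  · simp [Prog.run, hF5.nat 14 rfl, hF4.nat 14 rfl, hF3.nat 14 rfl, hF2.nat 14 rfl, hF1.nat 14 rfl,
      hσ.k]
  · simp [Prog.run, hF5.nat 18 rfl, hF4.nat 18 rfl, hF3.nat 18 rfl, hF2.nat 18 rfl, hF1.nat 18 rfl,
      hσ.r]
  · simp [Prog.run, hF5.real 8 rfl, hF4.real 8 rfl, h8, hF2.real 8 rfl, hF1.real 8 rfl, hσ.x]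

theorem runs_siteStep {D s : Mem} {n d B i base : ℕ} {σ : PathState} (hr : Ready D n d B s)
    (h11 : s.nat 11 = base) (h16 : s.nat 16 = i) (hi : i < n) (hσ : HoldsPath n σ s) (hk : σ.k ≤ B)
    (htwo : D.natArr 2 (base + i) = 3 → D.natArr 3 (base + i) = i → D.natArr 4 (base + i) < n ∧
      D.natArr 5 (16 * (base + i) + (4 * σ.q i + σ.q (D.natArr 4 (base + i)))) < 16) :
    Runs Prog.siteStep s 60 (HoldsPath n (siteStep D (base + i) i σ)) := by
  set adr := base + i with hadr
  have key : Runs Prog.siteStep s (1 + (Prog.siteT.cost + (Prog.siteOne.cost +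
      (Prog.siteTwo.cost + 1 + 1) + 1) + 1)) (HoldsPath n (siteStep D adr i σ)) := by
    refine Runs.seq_frame (Runs.of_run (P := .setNat 20 _) rfl
      (Q := fun s' => s'.nat 20 = adr) ?_) fun s1 hF1 h20 => ?_
    · simp [Prog.run, NExpr.eval, h11, h16, hadr]
    have hr1 := hr.frame hF1 rfl
    have h16' : s1.nat 16 = i := by rw [hF1.nat 16 rfl, h16]
    have hσ1 : HoldsPath n σ s1 := ⟨by rw [hF1.natArr 9 rfl]; exact hσ.q,
      by rw [hF1.nat 14 rfl, hσ.k], by rw [hF1.nat 18 rfl, hσ.r], by rw [hF1.real 8 rfl, hσ.x]⟩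
    have hk2 : (NExpr.arr 2 (.var 20)).eval s1 = D.natArr 2 adr := by
      simp [NExpr.eval, hr1.kind, h20]
    have hk3 : (NExpr.arr 3 (.var 20)).eval s1 = D.natArr 3 adr := by
      simp [NExpr.eval, hr1.first, h20]
    refine Runs.cond (fun h => ?_) fun h1 => ?_
    · exact runs_siteT hr1 h16' hi hσ1 hk (hk2.symm.trans h)
    refine Runs.cond (fun h => ?_) fun h2 => ?_
    · exact runs_siteOne hr1 h16' h20 hi hσ1 (hk2.symm.trans h)
    refine Runs.cond (fun h => ?_) fun h3 => ?_
    · simp only [Test.Holds, hk2, hk3] at h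
      simp only [NExpr.eval, h16'] at h
      obtain ⟨h4, h5⟩ := htwo h.1 h.2
      exact runs_siteTwo hr1 h16' h20 hi hσ1 h.1 h.2 h4 h5
    · simp only [Test.Holds, hk2, hk3] at h1 h2 h3
      simp only [NExpr.eval, h16', not_and] at h1 h2 h3
      have : siteStep D adr i σ = σ := by
        rw [siteStep, if_neg h1, if_neg h2]
        by_cases h4 : D.natArr 2 adr = 3
        · rw [if_pos h4, if_neg (h3 h4)]
        · rw [if_neg h4]
      rw [this]
      exact Runs.of_run (P := .skip) rfl hσ1
  exact key.mono (by decide) fun _ _ h => h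

namespace Prog

/-- Counts the nontrivial factors of the Pauli string in register `19` and multiplies the
coefficient by `1 - p` for each of them. -/
def weigh : Prog :=
  setNat 19 (.const 0) ;;
  forTo 16 (.var 8)
    (cond (.natEq (.arr 9 (.var 16)) (.const 0)) skip
      (setNat 19 (.add (.var 19) (.const 1)) ;;
       setReal 8 (.mul (.var 8) (.sub (.cast (.const 1)) (.var 1)))))

/-- Multiplies the coefficient by the expectation value in the initial product state. -/
def bloch : Prog :=
  forTo 16 (.var 8)
    (cond (.natEq (.arr 9 (.var 16)) (.const 0)) skip
      (cond (.natEq (.arr 9 (.var 16)) (.const 1)) (setReal 8 (.mul (.var 8) (.arr 2 (.var 16))))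
        (cond (.natEq (.arr 9 (.var 16)) (.const 2))
          (setReal 8 (.mul (.var 8) (.arr 3 (.var 16))))
          (setReal 8 (.mul (.var 8) (.arr 4 (.var 16)))))))

/-- One layer of noise and the layer of gates before it. -/
def pathStep : Prog :=
  weigh ;;
  cond (.natLe (.var 19) (.var 13))
    (setNat 13 (.sub (.var 13) (.var 19)) ;;
     cond (.natEq (.var 12) (.const 0))
       (bloch ;; setNat 17 (.const 0))
       (setNat 12 (.sub (.var 12) (.const 1)) ;;
        setNat 11 (.sub (.var 11) (.var 8)) ;;
        forTo 16 (.var 8) siteStep))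
    (setReal 8 (.cast (.const 0)) ;; setNat 17 (.const 0))

/-- Samples a Pauli path with the random bits in register `15`; register `17` tells whether the end
has not been reached yet. -/
def path : Prog :=
  (setNat 11 (.var 9) ;; setNat 12 (.var 3) ;; setNat 13 (.var 10) ;; setNat 14 (.var 10) ;;
   setNat 18 (.var 15) ;; setNat 17 (.const 1)) ;;
  loop (.natEq (.var 17) (.const 1)) pathStep

end Prog

theorem weight_succ (n : ℕ) (q : ℕ → ℕ) :
    weight (n + 1) q = weight n q + if q n = 0 then 0 else 1 := Finset.sum_range_succ _ _

theorem HoldsPath.frame {P : Prog} {s s' : Mem} {n : ℕ} {σ : PathState} (h : HoldsPath n σ s)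
    (hF : Frame P s s') (hP : (P.wNatArr 9 || P.wNat 14 || P.wNat 18 || P.wReal 8) = false) :
    HoldsPath n σ s' := by
  simp only [Bool.or_eq_false_iff] at hP
  obtain ⟨⟨⟨h1, h2⟩, h3⟩, h4⟩ := hP
  exact ⟨by rw [hF.natArr _ h1]; exact h.q, (hF.nat _ h2).trans h.k, (hF.nat _ h3).trans h.r,
    (hF.real _ h4).trans h.x⟩

theorem runs_weigh {D s : Mem} {n d B : ℕ} {σ : PathState} (hr : Ready D n d B s)
    (hσ : HoldsPath n σ s) :
    Runs Prog.weigh s (6 * n + 3) (fun s' => s'.nat 19 = weight n σ.q ∧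
      HoldsPath n ⟨σ.q, σ.k, σ.r, σ.x * (1 - D.real 1) ^ weight n σ.q⟩ s') := by
  have key : Runs Prog.weigh s (1 + (n * (4 + 2) + 2)) (fun s' => s'.nat 19 = weight n σ.q ∧
      HoldsPath n ⟨σ.q, σ.k, σ.r, σ.x * (1 - D.real 1) ^ weight n σ.q⟩ s') := by
    refine Runs.seq_frame (Runs.of_run (P := .setNat 19 _) rfl (Q := fun s' => s'.nat 19 = 0) ?_)
      fun s1 hF1 h19 => ?_
    · simp [Prog.run, NExpr.eval]
    have hr1 := hr.frame hF1 rfl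
    have hσ1 := hσ.frame hF1 rfl
    refine Runs.for_loop (N := n) (T := 4) (fun j s' => s'.nat 19 = weight j σ.q ∧
      s'.real 8 = σ.x * (1 - D.real 1) ^ weight j σ.q) rfl ?_ ?_ ?_ ?_
    · intro s' hF
      exact (hF.nat 8 rfl).trans hr1.sites
    · simp [weight, h19, hσ1.x]
    · rintro j s' hj hF h16 ⟨h19', h8⟩
      have hq : s'.natArr 9 j = σ.q j := by rw [hF.natArr 9 rfl]; exact hσ1.q j hj
      have h1 : s'.real 1 = D.real 1 := by rw [hF.real 1 rfl]; exact hr1.noise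
      refine Runs.of_run (P := .cond _ _ _) rfl ?_
      rw [weight_succ]
      by_cases h : σ.q j = 0
      · simp [Prog.run, NExpr.eval, Test.Holds, h16, hq, h, h19', h8]
      · simp [Prog.run, NExpr.eval, RExpr.eval, Test.Holds, h16, hq, h, h19', h8, h1, pow_succ,
          mul_assoc]
    · rintro s' hF ⟨h19', h8⟩
      refine ⟨h19', by rw [hF.natArr 9 rfl]; exact hσ1.q, by rw [hF.nat 14 rfl]; exact hσ1.k,
        by rw [hF.nat 18 rfl]; exact hσ1.r, h8⟩
  exact key.mono (by omega) fun _ _ h => h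

theorem runs_bloch {D s : Mem} {n d B : ℕ} {σ : PathState} (hr : Ready D n d B s)
    (hσ : HoldsPath n σ s) (hq : IsString n σ.q) :
    Runs Prog.bloch s (n * (7 + 2) + 2) (fun s' =>
      s'.real 8 = σ.x * ∏ i ∈ Finset.range n, blochFactor D i (σ.q i)) := by
  refine Runs.for_loop (N := n) (T := 7) (fun j s' =>
    s'.real 8 = σ.x * ∏ i ∈ Finset.range j, blochFactor D i (σ.q i)) rfl ?_ ?_ ?_ ?_
  · intro s' hF
    exact (hF.nat 8 rfl).trans hr.sites
  · simp [hσ.x]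
  · intro j s' hj hF h16 h8
    have hqj : s'.natArr 9 j = σ.q j := by rw [hF.natArr 9 rfl]; exact hσ.q j hj
    have h2 : s'.realArr 2 = D.realArr 2 := (hF.realArr 2 rfl).trans (hr.bloch 2 le_rfl (by norm_num))
    have h3 : s'.realArr 3 = D.realArr 3 :=
      (hF.realArr 3 rfl).trans (hr.bloch 3 (by norm_num) (by norm_num))
    have h4 : s'.realArr 4 = D.realArr 4 := (hF.realArr 4 rfl).trans (hr.bloch 4 (by norm_num) le_rfl)
    refine Runs.of_run (P := .cond _ _ _) rfl ?_
    rw [Finset.prod_range_succ, ← mul_assoc, blochFactor]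
    have := hq j hj
    interval_cases h : σ.q j <;>
    simp [Prog.run, NExpr.eval, RExpr.eval, Test.Holds, h16, hqj, h8, h2, h3, h4]
  · exact fun s' _ h => h

/-- The entries of the tables of two-qubit gates are in range. -/
theorem HoldsLayer.two_lt {L : Layer a b} {D : Mem} {base : ℕ} (hD : HoldsLayer D base L) {i : ℕ}
    (hi : i < a * b) {q : ℕ → ℕ} (hq : IsString (a * b) q) (h2 : D.natArr 2 (base + i) = 3)
    (h3 : D.natArr 3 (base + i) = i) : D.natArr 4 (base + i) < a * b ∧
      D.natArr 5 (16 * (base + i) + (4 * q i + q (D.natArr 4 (base + i)))) < 16 := by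
  obtain ⟨w, rfl⟩ := Site.exists_idx_eq hi
  by_cases hw : ∃ g ∈ L, w ∈ g.support
  · obtain ⟨g, hg, hwg⟩ := hw
    have hgate := hD.gates w g hg hwg
    cases g with
    | tGate u => exact absurd (h2.symm.trans hgate) (by norm_num)
    | cliffordOne u U => exact absurd (h2.symm.trans hgate.1) (by norm_num)
    | cliffordTwo u v U =>
      obtain ⟨-, -, h4, htab⟩ := hgate
      rw [h4]
      obtain ⟨Q, Q', x, h5, -⟩ := htab ⟨q w.idx, hq _ hi⟩ ⟨q v.idx, hq _ v.idx_lt⟩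
      simp only at h5
      exact ⟨v.idx_lt, by rw [h5]; omega⟩
  · push Not at hw
    exact absurd (h2.symm.trans (hD.idle w hw)) (by norm_num)

theorem runs_layer {D s : Mem} {d B base : ℕ} {σ : PathState} {L : Layer a b}
    (hL : Layer.Valid L) (hD : HoldsLayer D base L) (hr : Ready D (a * b) d B s)
    (h11 : s.nat 11 = base) (hσ : HoldsPath (a * b) σ s) (hk : σ.k ≤ B)
    (hq : IsString (a * b) σ.q) (hq0 : ∃ j < a * b, σ.q j ≠ 0) :
    Runs (Prog.forTo 16 (.var 8) Prog.siteStep) s (a * b * (60 + 2) + 2)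
      (HoldsPath (a * b) (layerRun D base (a * b) σ)) := by
  refine Runs.for_loop (N := a * b) (T := 60)
    (fun j s' => HoldsPath (a * b) (layerRun D base j σ) s') rfl ?_ ?_ ?_ ?_
  · intro s' hF
    exact (hF.nat 8 rfl).trans hr.sites
  · exact ⟨hσ.q, hσ.k, hσ.r, hσ.x⟩
  · intro j s' hj hF h16 hI
    obtain ⟨h1, -, h3⟩ := layerRun_isString hL hD hq hq0 hj.le
    rw [layerRun_succ]
    refine (runs_siteStep (hr.frame hF rfl) ((hF.nat 11 rfl).trans h11) h16 hj hI (h3.trans hk)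
      (hD.two_lt hj h1)).mono le_rfl fun s'' _ h => ?_
    exact ⟨h.q, by simpa using h.k, by simpa using h.r, h.x⟩
  · exact fun s' _ h => h

theorem weight_pos {n : ℕ} {q : ℕ → ℕ} (h : ∃ j < n, q j ≠ 0) : 1 ≤ weight n q := by
  obtain ⟨j, hj, hj0⟩ := h
  refine le_trans ?_ (Finset.single_le_sum (fun _ _ => Nat.zero_le _) (Finset.mem_range.2 hj))
  rw [if_neg hj0]

/-- The loop is counted by the remaining budget, which every step decreases because nontrivial strings have
positive weight; this makes the time independent of the depth `d`. -/
theorem runs_path {D s : Mem} {d B r : ℕ} {q : ℕ → ℕ} {x : ℝ}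
    (hlayer : ∀ t < d, ∃ L : Layer a b, Layer.Valid L ∧ HoldsLayer D (t * (a * b)) L)
    (hr : Ready D (a * b) d B s) (h15 : s.nat 15 = r) (h8 : s.real 8 = x)
    (hqs : ∀ j < a * b, s.natArr 9 j = q j) (hq : IsString (a * b) q)
    (hq0 : ∃ j < a * b, q j ≠ 0) :
    Runs Prog.path s (6 + ((B + 1) * (77 * (a * b) + 20 + 1) + 1))
      (fun s' => s'.real 8 = samplePath D (a * b) d B ⟨q, B, r, x⟩) := by
  set n := a * b with hn
  set res := samplePath D n d B ⟨q, B, r, x⟩ with hres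
  refine Runs.seq_frame (Runs.of_run (P := _ ;; _ ;; _ ;; _ ;; _ ;; _) rfl (Q := fun s' =>
    s'.nat 11 = d * n ∧ s'.nat 12 = d ∧ s'.nat 13 = B ∧ s'.nat 14 = B ∧ s'.nat 18 = r ∧
      s'.nat 17 = 1) ?_) fun s1 hF1 h1 => ?_
  · simp [Prog.run, NExpr.eval, hr.base, hr.depth, hr.bits, h15]
  have hr1 := hr.frame hF1 rfl
  obtain ⟨h11, h12, h13, h14, h18, h17⟩ := h1
  refine Runs.while_loop (fun j s' => (s'.nat 17 = 0 ∧ s'.real 8 = res) ∨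
    (s'.nat 17 = 1 ∧ ∃ t budget σ, j = budget + 1 ∧ t ≤ d ∧ s'.nat 11 = t * n ∧ s'.nat 12 = t ∧
      s'.nat 13 = budget ∧ HoldsPath n σ s' ∧ IsString n σ.q ∧ (∃ j < n, σ.q j ≠ 0) ∧ σ.k ≤ B ∧
      samplePath D n t budget σ = res)) ?_ ?_ ?_
  · exact Or.inr ⟨h17, d, B, ⟨q, B, r, x⟩, rfl, le_rfl, h11, h12, h13,
      ⟨by rw [hF1.natArr 9 rfl]; exact hqs, h14, h18, (hF1.real 8 rfl).trans h8⟩, hq, hq0, le_rfl,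
      hres.symm⟩
  · rintro j s' hF (⟨h, -⟩ | ⟨-, t, budget, σ, rfl, ht, h11, h12, h13, hσ, hq, hq0, hk, hv⟩) hc
    · simp [Test.Holds, NExpr.eval, h] at hc
    have hr' := hr1.frame hF rfl
    set w := weight n σ.q with hw
    have hw1 : 1 ≤ w := weight_pos hq0
    have key : Runs Prog.pathStep s' ((6 * n + 3) + ((1 + ((n * (7 + 2) + 2 + 1) +
        (1 + (1 + (n * (60 + 2) + 2))) + 1)) + 2 + 1)) (fun s'' => ∃ j' < budget + 1,
      (s''.nat 17 = 0 ∧ s''.real 8 = res) ∨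
    (s''.nat 17 = 1 ∧ ∃ t budget σ, j' = budget + 1 ∧ t ≤ d ∧ s''.nat 11 = t * n ∧ s''.nat 12 = t ∧
      s''.nat 13 = budget ∧ HoldsPath n σ s'' ∧ IsString n σ.q ∧ (∃ j < n, σ.q j ≠ 0) ∧ σ.k ≤ B ∧
      samplePath D n t budget σ = res)) := by
      refine Runs.seq_frame (runs_weigh hr' hσ) fun s2 hF2 ⟨h19, hσ2⟩ => ?_
      have hr2 := hr'.frame hF2 rfl
      have h13' : s2.nat 13 = budget := (hF2.nat 13 rfl).trans h13
      have h12' : s2.nat 12 = t := (hF2.nat 12 rfl).trans h12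
      have h11' : s2.nat 11 = t * n := (hF2.nat 11 rfl).trans h11
      refine Runs.cond (fun hle => ?_) fun hlt => ?_
      · simp only [Test.Holds, NExpr.eval, h19, h13', ← hw] at hle
        refine Runs.seq_frame (Runs.of_run (P := .setNat 13 _) rfl
          (Q := fun s' => s'.nat 13 = budget - w) ?_) fun s3 hF3 h13'' => ?_
        · simp [Prog.run, NExpr.eval, h13', h19, ← hw]
        have hr3 := hr2.frame hF3 rfl
        have hσ3 := hσ2.frame hF3 rfl
        have h12'' : s3.nat 12 = t := (hF3.nat 12 rfl).trans h12'
        refine Runs.cond (fun h0 => ?_) fun h0 => ?_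
        · simp only [Test.Holds, NExpr.eval, h12''] at h0
          subst h0
          refine Runs.seq_frame (runs_bloch hr3 hσ3 hq) fun s4 hF4 h8' => ?_
          refine Runs.of_run (P := .setNat 17 _) rfl ⟨0, by omega, Or.inl ⟨?_, ?_⟩⟩
          · simp [Prog.run, NExpr.eval]
          · rw [samplePath, if_neg (by omega)] at hv
            simpa [Prog.run] using h8'.trans hv
        · simp only [Test.Holds, NExpr.eval, h12''] at h0
          obtain ⟨t, rfl⟩ : ∃ t', t = t' + 1 := ⟨t - 1, by omega⟩
          obtain ⟨L, hL, hD⟩ := hlayer t (by omega)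
          refine Runs.seq_frame (Runs.of_run (P := .setNat 12 _) rfl
            (Q := fun s' => s'.nat 12 = t) ?_) fun s4 hF4 h12a => ?_
          · simp [Prog.run, NExpr.eval, h12'']
          refine Runs.seq_frame (Runs.of_run (P := .setNat 11 _) rfl
            (Q := fun s' => s'.nat 11 = t * n) ?_) fun s5 hF5 h11a => ?_
          · simp [Prog.run, NExpr.eval, hF4.nat 11 rfl, hF3.nat 11 rfl, h11', hF4.nat 8 rfl,
              hr3.sites, Nat.add_mul]
          have hr5 := (hr3.frame hF4 rfl).frame hF5 rfl
          have hσ5 := (hσ3.frame hF4 rfl).frame hF5 rfl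
          refine (runs_layer hL hD hr5 h11a hσ5 hk hq hq0).mono le_rfl fun s6 hF6 hσ6 => ?_
          obtain ⟨g1, g2, g3⟩ := layerRun_isString hL hD hq hq0 (σ := ⟨σ.q, σ.k, σ.r,
            σ.x * (1 - D.real 1) ^ w⟩) (le_refl (a * b))
          refine ⟨budget - w + 1, by omega, Or.inr ⟨?_, t, budget - w, _, rfl, by omega,
            (hF6.nat 11 rfl).trans h11a, ?_, ?_, hσ6, g1, g2, g3.trans hk, ?_⟩⟩
          · rw [hF6.nat 17 rfl, hF5.nat 17 rfl, hF4.nat 17 rfl, hF3.nat 17 rfl, hF2.nat 17 rfl]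
            simpa [Test.Holds, NExpr.eval] using hc
          · rw [hF6.nat 12 rfl, hF5.nat 12 rfl, h12a]
          · rw [hF6.nat 13 rfl, hF5.nat 13 rfl, hF4.nat 13 rfl, h13'']
          · rw [samplePath, if_neg (by omega)] at hv
            exact hv
      · simp only [Test.Holds, NExpr.eval, h19, h13', ← hw, not_le] at hlt
        refine Runs.of_run (P := .setReal 8 _ ;; .setNat 17 _) rfl ⟨0, by omega, Or.inl ⟨?_, ?_⟩⟩
        · simp [Prog.run, NExpr.eval]
        · cases t <;> rw [samplePath, if_pos (by omega)] at hv <;>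
          simp [Prog.run, NExpr.eval, RExpr.eval, ← hv]
    exact key.mono (by omega) fun _ _ h => h
  · rintro j s' hF (⟨-, h⟩ | ⟨h, -⟩) hc
    · exact h
    · simp [Test.Holds, NExpr.eval, h] at hc

/-! ### The program for large overhead -/

namespace Prog

/-- Adds up the results for all strings of random bits in the real register `11`; the Pauli string
has a factor `Z` at the sites in the registers `27` and `28`, and the real register `12` holds the
coefficient. -/
def sampleTerm : Prog :=
  forTo 15 (.var 25)
    (forTo 16 (.var 8) (setNatArr 9 (.var 16) (.const 0)) ;;
     (setNatArr 9 (.var 27) (.const 3) ;; setNatArr 9 (.var 28) (.const 3) ;;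
      setReal 8 (.var 12)) ;;
     path ;;
     setReal 11 (.add (.var 11) (.var 8)))

/-- The numbers `n` and `d * n`. -/
def counts : Prog :=
  setNat 8 (.const 0) ;;
  forTo 16 (.var 0) (setNat 8 (.add (.var 8) (.var 1))) ;;
  setNat 9 (.const 0) ;;
  forTo 16 (.var 8) (setNat 9 (.add (.var 9) (.var 3)))

/-- The number of random bits: `k` bits for each time that `C` is halved until it is at most `ε`. -/
def bits (C k : ℕ) : Prog :=
  (setNat 10 (.const 0) ;; setReal 9 (.cast (.const C))) ;;
  loop (.neg (.realLe (.var 9) (.var 0)))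
    (setReal 9 (.div (.var 9) (.cast (.const 2))) ;; setNat 10 (.add (.var 10) (.const k)))

/-- The table of powers of two. -/
def powers : Prog :=
  setNatArr 8 (.const 0) (.const 1) ;;
  forTo 16 (.var 10)
    (setNatArr 8 (.add (.var 16) (.const 1)) (.add (.arr 8 (.var 16)) (.arr 8 (.var 16)))) ;;
  (setNat 25 (.arr 8 (.var 10)) ;; setReal 11 (.cast (.const 0)))

/-- The contributions of all couplings and fields. -/
def terms : Prog :=
  forTo 26 (.var 2)
    ((setNat 27 (.arr 0 (.var 26)) ;; setNat 28 (.arr 1 (.var 26)) ;;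
      setReal 12 (.arr 0 (.var 26))) ;; sampleTerm) ;;
  forTo 26 (.var 8)
    ((setNat 27 (.var 26) ;; setNat 28 (.var 26) ;; setReal 12 (.arr 1 (.var 26))) ;;
      sampleTerm) ;;
  setReal 0 (.div (.var 11) (.cast (.var 25)))

/-- Estimates the energy at the output of a noisy circuit. -/
def noisyEnergy (C k : ℕ) : Prog := counts ;; bits C k ;; powers ;; terms

end Prog

/-- A bound for the running time of `Prog.sampleTerm`. -/
def sampleTime (n B : ℕ) : ℕ := 2 ^ B * (3 * n + 15 + (B + 1) * (77 * n + 21)) + 2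

theorem runs_sampleTerm {D s : Mem} {d B i j : ℕ} {x y : ℝ}
    (hlayer : ∀ t < d, ∃ L : Layer a b, Layer.Valid L ∧ HoldsLayer D (t * (a * b)) L)
    (hr : Ready D (a * b) d B s) (h27 : s.nat 27 = i) (h28 : s.nat 28 = j)
    (hj : j < a * b) (h12 : s.real 12 = x) (h11 : s.real 11 = y) :
    Runs Prog.sampleTerm s (sampleTime (a * b) B) (fun s' => s'.real 11 = y +
      sampleSum D (a * b) d B (Function.update (Function.update 0 i 3) j 3) x) := by
  set n := a * b with hn
  set q : ℕ → ℕ := Function.update (Function.update 0 i 3) j 3 with hqdef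
  have hq : IsString n q :=
    IsString.update (IsString.update (fun _ _ => by simp) _ (by norm_num)) _ (by norm_num)
  have hq0 : ∃ j < n, q j ≠ 0 := ⟨j, hj, by simp [hqdef]⟩
  have key : Runs Prog.sampleTerm s (2 ^ B * (((n * (1 + 2) + 2) + (3 + ((6 + ((B + 1) *
      (77 * n + 20 + 1) + 1)) + 1))) + 2) + 2) (fun s' => s'.real 11 = y + sampleSum D n d B q x) := by
    refine Runs.for_loop (N := 2 ^ B) (fun r s' => s'.real 11 = y +
      ∑ r ∈ Finset.range r, samplePath D n d B ⟨q, B, r, x⟩) rfl ?_ ?_ ?_ ?_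
    · intro s' hF
      exact (hF.nat 25 rfl).trans hr.strings
    · simp [h11]
    · intro r s1 hlt hF1 h15 hacc
      have hr1 := hr.frame hF1 rfl
      refine Runs.seq_frame (Runs.for_loop (N := n) (T := 1) (fun k s' => ∀ m < k, s'.natArr 9 m = 0)
        rfl ?_ ?_ ?_ fun _ _ h => h) fun s2 hF2 hclear => ?_
      · intro s' hF
        exact (hF.nat 8 rfl).trans hr1.sites
      · intro m hm; omega
      · intro k s' hk hF h16 hI
        refine Runs.of_run (P := .setNatArr 9 _ _) rfl fun m hm => ?_
        by_cases h : m = k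
        · simp [Prog.run, NExpr.eval, h16, h]
        · simp [Prog.run, NExpr.eval, h16, h, hI m (by omega)]
      have hr2 := hr1.frame hF2 rfl
      refine Runs.seq_frame (Runs.of_run (P := _ ;; _ ;; _) rfl (Q := fun s' =>
        (∀ m < n, s'.natArr 9 m = q m) ∧ s'.real 8 = x) ?_) fun s3 hF3 ⟨hq3, h8⟩ => ?_
      · refine ⟨fun m hm => ?_, ?_⟩
        · simp [Prog.run, NExpr.eval, hF2.nat 27 rfl, hF1.nat 27 rfl, h27, hF2.nat 28 rfl,
            hF1.nat 28 rfl, h28, hqdef, Function.update_apply, hclear m hm]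
        · simp [Prog.run, RExpr.eval, hF2.real 12 rfl, hF1.real 12 rfl, h12]
      have hr3 := hr2.frame hF3 rfl
      refine Runs.seq_frame (runs_path hlayer hr3 (r := r) (by
        rw [hF3.nat 15 rfl, hF2.nat 15 rfl, h15]) h8 hq3 hq hq0) fun s4 hF4 h8' => ?_
      refine Runs.of_run (P := .setReal 11 _) rfl ?_
      rw [Finset.sum_range_succ]
      simp [Prog.run, RExpr.eval, h8', hF4.real 11 rfl, hF3.real 11 rfl, hF2.real 11 rfl, hacc,
        add_assoc, hn]
    · exact fun s' _ h => h
  exact key.mono (le_of_eq (by rw [sampleTime]; ring)) fun _ _ h => h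

theorem runs_counts {s : Mem} {d : ℕ} (h0 : s.nat 0 = a) (h1 : s.nat 1 = b) (h3 : s.nat 3 = d) :
    Runs Prog.counts s (1 + ((a * (1 + 2) + 2) + (1 + (a * b * (1 + 2) + 2))))
      (fun s' => s'.nat 8 = a * b ∧ s'.nat 9 = d * (a * b)) := by
  refine Runs.seq_frame (Runs.of_run (P := .setNat 8 _) rfl (Q := fun s' => s'.nat 8 = 0) (by
    simp [Prog.run, NExpr.eval])) fun s1 hF1 h8 => ?_
  refine Runs.seq_frame (Runs.for_loop (N := a) (T := 1) (fun j s' => s'.nat 8 = j * b) rfl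
    (fun s' hF => ?_) ?_ (fun j s' _ hF h16 hI => ?_) fun s' _ h => h) fun s2 hF2 h8' => ?_
  · exact (hF.nat 0 rfl).trans ((hF1.nat 0 rfl).trans h0)
  · simp [h8]
  · refine Runs.of_run (P := .setNat 8 _) rfl ?_
    simp [Prog.run, NExpr.eval, hI, hF.nat 1 rfl, hF1.nat 1 rfl, h1, Nat.add_mul]
  refine Runs.seq_frame (Runs.of_run (P := .setNat 9 _) rfl (Q := fun s' => s'.nat 9 = 0) (by
    simp [Prog.run, NExpr.eval])) fun s3 hF3 h9 => ?_
  refine Runs.for_loop (N := a * b) (T := 1) (fun j s' => s'.nat 9 = d * j) rfl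
    (fun s' hF => ?_) ?_ (fun j s' _ hF h16 hI => ?_) fun s' hF h => ⟨?_, h⟩
  · exact (hF.nat 8 rfl).trans ((hF3.nat 8 rfl).trans h8')
  · simp [h9]
  · refine Runs.of_run (P := .setNat 9 _) rfl ?_
    simp [Prog.run, NExpr.eval, hI, hF.nat 3 rfl, hF3.nat 3 rfl, hF2.nat 3 rfl, hF1.nat 3 rfl, h3,
      Nat.mul_add]
  · exact (hF.nat 8 rfl).trans ((hF3.nat 8 rfl).trans h8')

theorem runs_bits {s : Mem} {C k : ℕ} {ε : ℝ} (hε : 0 < ε) (h0 : s.real 0 = ε) :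
    Runs (Prog.bits C k) s (2 + (⌈C / ε⌉₊ * (2 + 1) + 1)) (fun s' => ∃ m, s'.nat 10 = k * m ∧
      (C : ℝ) ≤ ε * 2 ^ m ∧ (m = 0 ∨ ε * 2 ^ m ≤ 2 * C)) := by
  refine Runs.seq_frame (Runs.of_run (P := _ ;; _) rfl (Q := fun s' => s'.nat 10 = 0 ∧
    s'.real 9 = C) (by simp [Prog.run, NExpr.eval, RExpr.eval])) fun s1 hF1 ⟨h10, h9⟩ => ?_
  have h0' : s1.real 0 = ε := (hF1.real 0 rfl).trans h0
  refine Runs.while_loop (fun j s' => ∃ m, j = ⌈C / ε⌉₊ - m ∧ s'.nat 10 = k * m ∧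
    s'.real 9 = C / 2 ^ m ∧ (m = 0 ∨ ε * 2 ^ m ≤ 2 * C)) ⟨0, by simp, by simp [h10], by simp [h9],
      Or.inl rfl⟩ ?_ ?_
  · rintro j s' hF ⟨m, rfl, h10, h9, -⟩ hc
    have hpos : (0 : ℝ) < 2 ^ m := by positivity
    have hlt : ε * 2 ^ m < C := by
      simp only [Test.Holds, RExpr.eval, h9, hF.real 0 rfl, h0', not_le] at hc
      rwa [lt_div_iff₀ hpos] at hc
    have hm : m < ⌈C / ε⌉₊ := by
      have h1 : (2 : ℝ) ^ m < C / ε := by rwa [lt_div_iff₀ hε, mul_comm]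
      have h2 : (2 ^ m : ℕ) < ⌈C / ε⌉₊ := by
        rw [Nat.lt_ceil]
        push_cast
        exact h1
      exact Nat.lt_two_pow_self.trans h2
    refine Runs.of_run (P := _ ;; _) rfl ⟨⌈C / ε⌉₊ - (m + 1), by omega, m + 1, rfl, ?_, ?_, ?_⟩
    · simp [Prog.run, NExpr.eval, h10, Nat.mul_add]
    · simp [Prog.run, NExpr.eval, RExpr.eval, h9, pow_succ, div_div]
    · right
      rw [pow_succ]
      linarith
  · rintro j s' hF ⟨m, -, h10, h9, hm⟩ hc
    have hpos : (0 : ℝ) < 2 ^ m := by positivity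
    simp only [Test.Holds, RExpr.eval, h9, hF.real 0 rfl, h0', not_not] at hc
    rw [div_le_iff₀ hpos] at hc
    exact ⟨m, h10, hc, hm⟩

theorem runs_powers {s : Mem} {B : ℕ} (h10 : s.nat 10 = B) :
    Runs Prog.powers s (1 + ((B * (1 + 2) + 2) + 2)) (fun s' => (∀ i ≤ B, s'.natArr 8 i = 2 ^ i) ∧
      s'.nat 25 = 2 ^ B ∧ s'.real 11 = 0) := by
  refine Runs.seq_frame (Runs.of_run (P := .setNatArr 8 _ _) rfl (Q := fun s' => s'.natArr 8 0 = 1)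
    (by simp [Prog.run, NExpr.eval])) fun s1 hF1 h8 => ?_
  refine Runs.seq_frame (Runs.for_loop (N := B) (T := 1) (fun j s' => ∀ i ≤ j, s'.natArr 8 i = 2 ^ i)
    rfl (fun s' hF => ?_) ?_ (fun j s' _ hF h16 hI => ?_) fun s' _ h => h) fun s2 hF2 hpow => ?_
  · exact (hF.nat 10 rfl).trans ((hF1.nat 10 rfl).trans h10)
  · intro i hi
    obtain rfl : i = 0 := by omega
    simpa using h8
  · refine Runs.of_run (P := .setNatArr 8 _ _) rfl fun i hi => ?_
    by_cases h : i = j + 1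
    · subst h
      simp [Prog.run, NExpr.eval, h16, hI j le_rfl, pow_succ, mul_two]
    · simp [Prog.run, NExpr.eval, h16, h, hI i (by omega)]
  · refine Runs.of_run (P := _ ;; _) rfl ⟨?_, ?_, ?_⟩
    · simpa [Prog.run] using hpow
    · simp [Prog.run, NExpr.eval, hF2.nat 10 rfl, hF1.nat 10 rfl, h10, hpow B le_rfl]
    · simp [Prog.run, NExpr.eval, RExpr.eval]

/-! ### Running time and error for large overhead -/

theorem runs_terms {D s : Mem} {d B : ℕ} {H : Ising a b} {l : List (Site a b × Site a b)}
    (hlayer : ∀ t < d, ∃ L : Layer a b, Layer.Valid L ∧ HoldsLayer D (t * (a * b)) L)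
    (hr : Ready D (a * b) d B s) (h11 : s.real 11 = 0) (hlen : s.nat 2 = l.length)
    (hlist : ∀ (i : ℕ) (hi : i < l.length), s.natArr 0 i = (l[i]).1.idx ∧
      s.natArr 1 i = (l[i]).2.idx ∧ s.realArr 0 i = H.J s((l[i]).1, (l[i]).2))
    (hfield : ∀ u : Site a b, s.realArr 1 u.idx = H.h u) :
    Runs Prog.terms s ((l.length * (3 + sampleTime (a * b) B + 2) + 2) +
      ((a * b * (3 + sampleTime (a * b) B + 2) + 2) + 1)) (fun s' => s'.real 0 =
      ((l.map fun e => sampleSum D (a * b) d B (zzString e.1 e.2) (H.J s(e.1, e.2))).sum +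
        ∑ u, sampleSum D (a * b) d B (zString u) (H.h u)) / 2 ^ B) := by
  set f : Site a b × Site a b → ℝ := fun e =>
    sampleSum D (a * b) d B (zzString e.1 e.2) (H.J s(e.1, e.2)) with hf
  set g : ℕ → ℝ := fun i =>
    sampleSum D (a * b) d B (Function.update 0 i 3) (s.realArr 1 i) with hg
  have hsum : ∑ u, sampleSum D (a * b) d B (zString u) (H.h u) = ∑ i ∈ Finset.range (a * b), g i := by
    rw [← Site.sum_idx]
    refine Finset.sum_congr rfl fun u _ => ?_
    simp only [hg, hfield]
    rfl
  rw [hsum]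
  refine Runs.seq_frame (Runs.for_loop (N := l.length) (fun j s' =>
    s'.real 11 = ((l.take j).map f).sum) rfl ?_ ?_ ?_ ?_ (Q := fun s' =>
      s'.real 11 = (l.map f).sum)) fun s1 hF1 h1 => ?_
  · intro s' hF
    exact (hF.nat 2 rfl).trans hlen
  · simp [h11]
  · intro j s' hj hF h26 hI
    obtain ⟨e1, e2, e3⟩ := hlist j hj
    refine Runs.seq_frame (Runs.of_run (P := _ ;; _ ;; _) rfl (Q := fun s' =>
      s'.nat 27 = (l[j]).1.idx ∧ s'.nat 28 = (l[j]).2.idx ∧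
        s'.real 12 = H.J s((l[j]).1, (l[j]).2)) ?_) fun s2 hF2 h2 => ?_
    · simp [Prog.run, NExpr.eval, RExpr.eval, h26, hF.natArr 0 rfl, hF.natArr 1 rfl,
        hF.realArr 0 rfl, e1, e2, e3]
    refine (runs_sampleTerm hlayer ((hr.frame hF rfl).frame hF2 rfl) h2.1 h2.2.1
      (Site.idx_lt _) h2.2.2 ((hF2.real 11 rfl).trans hI)).mono le_rfl fun s3 _ h3 => ?_
    rw [List.take_succ_eq_append_getElem hj, List.map_append, List.sum_append, List.map_singleton,
      List.sum_singleton]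
    exact h3
  · intro s' _ h
    rwa [List.take_length] at h
  have hr1 := hr.frame hF1 rfl
  refine Runs.seq_frame (Runs.for_loop (N := a * b) (fun j s' =>
    s'.real 11 = (l.map f).sum + ∑ i ∈ Finset.range j, g i) rfl ?_ ?_ ?_ fun _ _ h => h)
      fun s2 hF2 h2 => ?_
  · intro s' hF
    exact (hF.nat 8 rfl).trans hr1.sites
  · simp [h1]
  · intro j s' hj hF h26 hI
    refine Runs.seq_frame (Runs.of_run (P := _ ;; _ ;; _) rfl (Q := fun s' =>
      s'.nat 27 = j ∧ s'.nat 28 = j ∧ s'.real 12 = s.realArr 1 j) ?_) fun s3 hF3 h3 => ?_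
    · simp [Prog.run, NExpr.eval, RExpr.eval, h26, hF.realArr 1 rfl, hF1.realArr 1 rfl]
    refine (runs_sampleTerm hlayer ((hr1.frame hF rfl).frame hF3 rfl) h3.1 h3.2.1 hj h3.2.2
      ((hF3.real 11 rfl).trans hI)).mono le_rfl fun s4 _ h4 => ?_
    rw [Function.update_idem] at h4
    rw [Finset.sum_range_succ, ← add_assoc]
    exact h4
  · refine Runs.of_run (P := .setReal 0 _) rfl ?_
    simp [Prog.run, NExpr.eval, RExpr.eval, h2, (hr1.frame hF2 rfl).strings]

theorem Mem.HoldsCircuit.holdsLayer {s : Mem} {C : Circuit a b} {p : ℝ}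
    {ρ : Site a b → Matrix (Fin 2) (Fin 2) ℂ} (hs : s.HoldsCircuit C p ρ)
    (hC : ∀ L ∈ C, Layer.Valid L) :
    ∀ t < C.length, ∃ L : Layer a b, Layer.Valid L ∧ HoldsLayer s (t * (a * b)) L :=
  fun t ht => ⟨C[t], hC _ (List.getElem_mem ht), ⟨hs.idle t ht, hs.gates t ht⟩⟩

/-- The program and its running time, with `B = k * m` random bits. -/
theorem runs_noisyEnergy {s : Mem} {H : Ising a b} {ε : ℝ} {C : Circuit a b} {p : ℝ} {K k : ℕ}
    {ρ : Site a b → Matrix (Fin 2) (Fin 2) ℂ} {l : List (Site a b × Site a b)} (hε : 0 < ε)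
    (hs : s.HoldsIsing H ε) (hsC : s.HoldsCircuit C p ρ) (hC : ∀ L ∈ C, Layer.Valid L)
    (hlen : s.nat 2 = l.length)
    (hlist : ∀ (i : ℕ) (hi : i < l.length), s.natArr 0 i = (l[i]).1.idx ∧
      s.natArr 1 i = (l[i]).2.idx ∧ s.realArr 0 i = H.J s((l[i]).1, (l[i]).2)) :
    ∃ m : ℕ, (K : ℝ) ≤ ε * 2 ^ m ∧ (m = 0 ∨ ε * 2 ^ m ≤ 2 * K) ∧
      Runs (Prog.noisyEnergy K k) s (3 * a + 3 * (a * b) + 3 * ⌈K / ε⌉₊ + 3 * (k * m) + 20 +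
        (l.length + a * b) * (sampleTime (a * b) (k * m) + 5)) (fun s' => s'.real 0 =
        ((l.map fun e =>
          sampleSum s (a * b) C.length (k * m) (zzString e.1 e.2) (H.J s(e.1, e.2))).sum +
          ∑ u, sampleSum s (a * b) C.length (k * m) (zString u) (H.h u)) / 2 ^ (k * m)) := by
  obtain ⟨t1, s1, he1, ht1, h8, h9⟩ := runs_counts hs.dims.1 hs.dims.2 hsC.depth
  have hF1 := he1.frame
  obtain ⟨t2, s2, he2, ht2, m, h10, hm, hm'⟩ := runs_bits (s := s1) (C := K) (k := k) hε
    ((hF1.real 0 rfl).trans hs.prec)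
  have hF2 := he2.frame
  obtain ⟨t3, s3, he3, ht3, hpow, h25, h11⟩ := runs_powers h10
  have hF3 := he3.frame
  have hr : Ready s (a * b) C.length (k * m) s3 := by
    refine ⟨?_, ?_, ?_, ?_, ?_, ?_, ?_, ?_, ?_, ?_, ?_, hpow, h25⟩
    · rw [hF3.natArr 2 rfl, hF2.natArr 2 rfl, hF1.natArr 2 rfl]
    · rw [hF3.natArr 3 rfl, hF2.natArr 3 rfl, hF1.natArr 3 rfl]
    · rw [hF3.natArr 4 rfl, hF2.natArr 4 rfl, hF1.natArr 4 rfl]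
    · rw [hF3.natArr 5 rfl, hF2.natArr 5 rfl, hF1.natArr 5 rfl]
    · rw [hF3.natArr 6 rfl, hF2.natArr 6 rfl, hF1.natArr 6 rfl]
    · rw [hF3.real 1 rfl, hF2.real 1 rfl, hF1.real 1 rfl]
    · intro i _ _
      rw [hF3.realArr i rfl, hF2.realArr i rfl, hF1.realArr i rfl]
    · rw [hF3.nat 3 rfl, hF2.nat 3 rfl, hF1.nat 3 rfl, hsC.depth]
    · rw [hF3.nat 8 rfl, hF2.nat 8 rfl, h8]
    · rw [hF3.nat 9 rfl, hF2.nat 9 rfl, h9]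
    · rw [hF3.nat 10 rfl, h10]
  obtain ⟨t4, s4, he4, ht4, hout⟩ := runs_terms (H := H) (l := l) (hsC.holdsLayer hC) hr h11
    (by rw [hF3.nat 2 rfl, hF2.nat 2 rfl, hF1.nat 2 rfl, hlen])
    (by
      rw [hF3.natArr 0 rfl, hF2.natArr 0 rfl, hF1.natArr 0 rfl, hF3.natArr 1 rfl,
        hF2.natArr 1 rfl, hF1.natArr 1 rfl, hF3.realArr 0 rfl, hF2.realArr 0 rfl,
        hF1.realArr 0 rfl]
      exact hlist)
    (by rw [hF3.realArr 1 rfl, hF2.realArr 1 rfl, hF1.realArr 1 rfl]; exact hs.fields)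
  refine ⟨m, hm, hm', _, s4, he1.seq (he2.seq (he3.seq he4)), ?_, hout⟩
  have e : (l.length + a * b) * (sampleTime (a * b) (k * m) + 5) =
      l.length * (3 + sampleTime (a * b) (k * m) + 2) +
        a * b * (3 + sampleTime (a * b) (k * m) + 2) := by ring
  rw [e]
  omega

theorem sampleTime_le {n B : ℕ} (hn : 1 ≤ n) :
    sampleTime n B ≤ 120 * (n * (2 ^ B * 2 ^ B)) := by
  have h1 : B + 1 ≤ 2 ^ B := Nat.lt_two_pow_self
  have h2 : 1 ≤ 2 ^ B := Nat.one_le_two_pow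
  have h3 : 3 * n + 15 + (B + 1) * (77 * n + 21) ≤ 116 * (n * 2 ^ B) := by
    generalize 2 ^ B = X at *
    calc 3 * n + 15 + (B + 1) * (77 * n + 21) ≤ 18 * (n * X) + X * (98 * n) := by
          have : n ≤ n * X := Nat.le_mul_of_pos_right _ h2
          gcongr
          · omega
          · omega
      _ = 116 * (n * X) := by ring
  have h4 : 1 ≤ n * (2 ^ B * 2 ^ B) := Nat.one_le_iff_ne_zero.2 (by positivity)
  calc sampleTime n B ≤ 2 ^ B * (116 * (n * 2 ^ B)) + 2 := by unfold sampleTime; gcongr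
    _ = 116 * (n * (2 ^ B * 2 ^ B)) + 2 := by ring
    _ ≤ _ := by omega

/-- The running time is polynomial in `n` and `1 / ε`, as `2 ^ m` is at most proportional to `1 / ε`. -/
theorem noisyEnergy_time_le {a b Δ K k m L : ℕ} {ε : ℝ} (hε : 0 < ε) (ha : 0 < a) (hb : 0 < b)
    (hL : L ≤ Δ * (a * b)) (hm : m = 0 ∨ ε * 2 ^ m ≤ 2 * K) :
    ((3 * a + 3 * (a * b) + 3 * ⌈K / ε⌉₊ + 3 * (k * m) + 20 +
      (L + a * b) * (sampleTime (a * b) (k * m) + 5) : ℕ) : ℝ) ≤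
      ((125 * Δ + 160 + 3 * K) * (2 * K + 1) ^ (2 * k) : ℕ) *
        ((a * b : ℕ) + 1 / ε) ^ (2 * k + 2) := by
  set n := a * b with hn
  have hn1 : 1 ≤ n := Nat.mul_pos ha hb
  have han : a ≤ n := Nat.le_mul_of_pos_right _ hb
  set X := 2 ^ (k * m) with hX
  have hX1 : 1 ≤ X := Nat.one_le_two_pow
  have hkX : k * m ≤ X := Nat.lt_two_pow_self.le
  have h1 : 3 * a + 3 * n + 3 * ⌈K / ε⌉₊ + 3 * (k * m) + 20 + (L + n) * (sampleTime n (k * m) + 5) ≤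
      (125 * Δ + 154) * (n * n * (X * X)) + 3 * ⌈K / ε⌉₊ := by
    have h2 : sampleTime n (k * m) + 5 ≤ 125 * (n * (X * X)) := by
      have := sampleTime_le (B := k * m) hn1
      have h4 : 1 ≤ n * (X * X) := Nat.one_le_iff_ne_zero.2 (by positivity)
      rw [← hX] at this
      omega
    have h3 : (L + n) * (sampleTime n (k * m) + 5) ≤ (Δ * n + n) * (125 * (n * (X * X))) := by gcongr
    have h4 : (Δ * n + n) * (125 * (n * (X * X))) = (125 * Δ + 125) * (n * n * (X * X)) := by ring
    have h5 : n ≤ n * n * (X * X) := by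
      rw [mul_assoc]; exact Nat.le_mul_of_pos_right _ (by positivity)
    have h6 : X ≤ n * n * (X * X) := by
      rw [← mul_assoc]; exact Nat.le_mul_of_pos_left _ (by positivity)
    rw [h4] at h3
    have h7 : (125 * Δ + 154) * (n * n * (X * X)) = (125 * Δ + 125) * (n * n * (X * X)) +
      29 * (n * n * (X * X)) := by ring
    rw [h7]
    omega
  refine (Nat.cast_le.2 h1).trans ?_
  set y : ℝ := (n : ℝ) + 1 / ε with hy
  have hε' : 0 < 1 / ε := by positivity
  have hn1' : (1 : ℝ) ≤ n := by exact_mod_cast hn1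
  have hny : (n : ℝ) ≤ y := by linarith
  have hy1 : 1 ≤ y := by linarith
  have hm2 : (2 : ℝ) ^ m ≤ (2 * K + 1) * y := by
    rcases hm with rfl | hm
    · have : (0 : ℝ) ≤ K := Nat.cast_nonneg _
      rw [pow_zero]
      nlinarith
    · have h2 : (2 : ℝ) ^ m ≤ 2 * K * (1 / ε) := by
        rw [mul_one_div, le_div_iff₀ hε, mul_comm]
        exact hm
      have : (0 : ℝ) ≤ K := Nat.cast_nonneg _
      have h3 : 2 * (K : ℝ) * (1 / ε) ≤ 2 * K * y := by gcongr; linarith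
      linarith
  have hXX : (X : ℝ) * X ≤ ((2 * K + 1) * y) ^ (2 * k) := by
    have : (X : ℝ) * X = ((2 : ℝ) ^ m) ^ (2 * k) := by
      rw [hX]; push_cast; ring
    rw [this]
    gcongr
  have hceil : (⌈K / ε⌉₊ : ℝ) ≤ (K + 1) * y := by
    have h2 : (⌈K / ε⌉₊ : ℝ) ≤ K * (1 / ε) + 1 := by
      rw [mul_one_div]
      exact (Nat.ceil_lt_add_one (by positivity)).le
    have : (0 : ℝ) ≤ K := Nat.cast_nonneg _
    have h3 : (K : ℝ) * (1 / ε) ≤ K * y := by gcongr; linarith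
    linarith
  have hK1 : (1 : ℝ) ≤ (2 * K + 1) ^ (2 * k) := one_le_pow₀ (by
    have : (0 : ℝ) ≤ K := Nat.cast_nonneg _
    linarith)
  have hyk : y ≤ y ^ (2 * k + 2) := le_self_pow₀ hy1 (by omega)
  push_cast
  calc (125 * (Δ : ℝ) + 154) * (n * n * (X * X)) + 3 * ⌈K / ε⌉₊
      ≤ (125 * Δ + 154) * (y * y * ((2 * K + 1) * y) ^ (2 * k)) + 3 * ((K + 1) * y) := by gcongr
    _ = (125 * Δ + 154) * ((2 * K + 1) ^ (2 * k) * y ^ (2 * k + 2)) + (3 * K + 3) * (1 * y) := by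
        rw [mul_pow]; ring
    _ ≤ (125 * Δ + 154) * ((2 * K + 1) ^ (2 * k) * y ^ (2 * k + 2)) +
        (3 * K + 3) * ((2 * K + 1) ^ (2 * k) * y ^ (2 * k + 2)) := by gcongr
    _ ≤ (125 * Δ + 160 + 3 * K) * (2 * K + 1) ^ (2 * k) * y ^ (2 * k + 2) := by
        have : 0 ≤ ((2 * K + 1 : ℝ) ^ (2 * k) * y ^ (2 * k + 2)) := by positivity
        nlinarith

theorem exists_prog_noisyEnergy (Δ c : ℕ) (Jmin Jmax hmax : ℝ) {p : ℝ} (hp0 : 0 < p)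
    (hp1 : p ≤ 1) : ∃ (lam₀ : ℕ) (P : Prog) (K : ℝ) (k : ℕ),
      ∀ (a b : ℕ) (H : Ising a b) (A : Ansatz a b), 0 < a → 0 < b →
        H.Bounded Δ Jmin Jmax hmax → A.Implements H c → lam₀ ≤ A.overhead →
        ∀ (ρ : Site a b → Matrix (Fin 2) (Fin 2) ℂ), (∀ u, IsDensity (ρ u)) →
        ∀ (ε : ℝ) (s : Mem), 0 < ε → s.HoldsIsing H ε → s.HoldsCircuit A.circuit p ρ →
          ∃ (t : ℕ) (s' : Mem), Exec P s t s' ∧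
            (t : ℝ) ≤ K * ((a * b : ℕ) + 1 / ε) ^ k ∧
            ‖(s'.real 0 : ℂ) - noisyEnergy H A p ρ‖ ≤ ε * (a * b : ℕ) := by
  -- The square root of the noise factor, rounded up to a positive number.
  set θ : ℝ := 1 - p / 2 with hθ
  have hθ0 : 0 < θ := by linarith
  have hθ1 : θ < 1 := by linarith
  have hpθ : 1 - p ≤ θ ^ 2 := by rw [hθ]; nlinarith [sq_nonneg p]
  set τ : ℝ := -Real.logb 2 θ with hτ
  have hτ0 : 0 < τ := neg_pos.2 (Real.logb_neg (by norm_num) hθ0 hθ1)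
  have hτθ : (2 : ℝ) ^ (-τ) = θ := by
    rw [hτ, neg_neg, Real.rpow_logb (by norm_num) (by norm_num) hθ0]
  set g := factorWeight (2 ^ c * (1 / 2)) with hg
  obtain ⟨k, hk⟩ := exists_pow_lt_of_lt_one (show (0 : ℝ) < 1 / 2 by norm_num) hθ1
  obtain ⟨lam₀, hlam₀⟩ := exists_nat_ge ((2 ^ c * (2 ^ c * (1 / 2))) / τ)
  set J := max |Jmax| |hmax| with hJ
  have hJ0 : 0 ≤ J := (abs_nonneg _).trans (le_max_left _ _)
  set K := ⌈(Δ + 1) * (J * g ^ 2)⌉₊ with hK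
  refine ⟨lam₀, Prog.noisyEnergy K k, ((125 * Δ + 160 + 3 * K) * (2 * K + 1) ^ (2 * k) : ℕ),
    2 * k + 2, ?_⟩
  intro a b H A ha hb hH hA hlam ρ hρ ε s hε hs hsC
  obtain ⟨l, hnd, hmem, hlen, hlist⟩ := hs.edges
  have hl : IsEdgeList H.graph l := ⟨hnd, hmem⟩
  obtain ⟨m, hm, hm', t, s', he, ht, hout⟩ :=
    runs_noisyEnergy (K := K) (k := k) hε hs hsC hA.valid hlen hlist
  have hlenle : l.length ≤ Δ * (a * b) := by
    have := hl.length_le hH.degree (List.Sublist.refl l) Finset.univ (by simp)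
    simpa using this
  refine ⟨t, s', he, (Nat.cast_le.2 ht).trans (noisyEnergy_time_le hε ha hb hlenle hm'), ?_⟩
  have hcontr : Contracts θ A.circuit.reverse g := by
    rw [← hτθ]
    refine Ansatz.contracts hτ0.le ?_ hA.depth
    rw [div_le_iff₀ hτ0] at hlam₀
    have : (lam₀ : ℝ) ≤ A.overhead := Nat.cast_le.2 hlam
    nlinarith
  have herr := norm_estimate_sub_noisyEnergy_le hl hρ hsC hA.valid hp1 hθ0 hθ1.le hpθ hcontr
    (J := J) (fun e he => ((hH.coupling e he).2.trans (le_abs_self _)).trans (le_max_left _ _))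
    (fun u => ((hH.field u).trans (le_abs_self _)).trans (le_max_right _ _)) (k * m)
  rw [hout]
  refine herr.trans ?_
  have hpow : θ ^ (k * m) ≤ (1 / 2) ^ m := by
    rw [pow_mul]
    exact pow_le_pow_left₀ (by positivity) hk.le m
  have hlen' : (l.length : ℝ) ≤ Δ * (a * b : ℕ) := by exact_mod_cast hlenle
  have hKle : (Δ + 1) * (J * g ^ 2) ≤ (K : ℝ) := Nat.le_ceil _
  calc ((l.length : ℝ) + (a * b : ℕ)) * (J * g ^ 2 * θ ^ (k * m))
      ≤ (Δ * (a * b : ℕ) + (a * b : ℕ)) * (J * g ^ 2 * (1 / 2) ^ m) := by gcongr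
    _ = ((Δ + 1) * (J * g ^ 2)) * (1 / 2) ^ m * (a * b : ℕ) := by ring
    _ ≤ (ε * 2 ^ m) * (1 / 2) ^ m * (a * b : ℕ) := by
        have := hKle.trans hm
        gcongr ?_ * _ * _
    _ = ε * (a * b : ℕ) := by
        rw [mul_assoc ε, ← mul_pow]
        norm_num

theorem theorem2 (Δ c : ℕ) (Jmin Jmax hmax : ℝ) (hJmin : 0 < Jmin) :
    (∀ Λ : ℕ, ∃ (P : Prog) (K : ℝ),
      ∀ (a b : ℕ) (H : Ising a b) (A : Ansatz a b), 0 < a → 0 < b →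
        H.Bounded Δ Jmin Jmax hmax → A.Implements H c → A.overhead ≤ Λ →
        ∀ (ε : ℝ) (s : Mem), 0 < ε → s.HoldsIsing H ε →
          ∃ (t : ℕ) (s' : Mem), Exec P s t s' ∧
            (t : ℝ) ≤ K * (a * b : ℕ) * (2 : ℝ) ^ (1 / ε ^ 2) ∧
            |s'.real 0 - H.groundEnergy| ≤ ε * (a * b : ℕ)) ∧
    (∀ p : ℝ, 0 < p → p ≤ 1 → ∃ (lam₀ : ℕ) (P : Prog) (K : ℝ) (k : ℕ),
      ∀ (a b : ℕ) (H : Ising a b) (A : Ansatz a b), 0 < a → 0 < b →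
        H.Bounded Δ Jmin Jmax hmax → A.Implements H c → lam₀ ≤ A.overhead →
        ∀ (ρ : Site a b → Matrix (Fin 2) (Fin 2) ℂ), (∀ u, IsDensity (ρ u)) →
        ∀ (ε : ℝ) (s : Mem), 0 < ε → s.HoldsIsing H ε → s.HoldsCircuit A.circuit p ρ →
          ∃ (t : ℕ) (s' : Mem), Exec P s t s' ∧
            (t : ℝ) ≤ K * ((a * b : ℕ) + 1 / ε) ^ k ∧
            ‖(s'.real 0 : ℂ) - noisyEnergy H A p ρ‖ ≤ ε * (a * b : ℕ)) :=
  ⟨fun Λ => exists_prog_groundEnergy Δ c Λ Jmin Jmax hmax,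
    fun _ hp0 hp1 => exists_prog_noisyEnergy Δ c Jmin Jmax hmax hp0 hp1⟩
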